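/- Let $n\geqslant 1$, $b,\kappa,\delta>0$ and $\gamma\in\mathbb{R}\setminus\{0\}$, and consider the thermoelastic system of type III $$\begin{cases}u_{tt}-b^2\Delta u+\gamma\nabla\theta=0, & x\in\mathbb{R}^n,\ t>0,\\ \theta_{tt}-\kappa\Delta\theta-\delta\Delta\theta_t+\gamma\,\mathrm{div}\,u_{tt}=0, & x\in\mathbb{R}^n,\ t>0,\\ (u,u_t)(0,x)=(u_0,u_1)(x),\quad (\theta,\theta_t)(0,x)=(\theta_0,\theta_1)(x), & x\in\mathbb{R}^n,\end{cases}$$ for the elastic displacement $u(t,x)\in\mathbb{R}^n$ and the temperature difference $\theta(t,x)\in\mathbb{R}$. Put $\alpha_0=b^2-\kappa-\gamma^2$, $\alpha_1=b^2+\kappa+\gamma^2$, $\alpha_2=\sqrt{\alpha_1^2-4b^2\kappa}$, $\nu_1=\sqrt{\tfrac12(\alpha_1+\alpha_2)}$, $\nu_2=\sqrt{\tfrac12(\alpha_1-\alpha_2)}$, $c_1=\tfrac{\delta}{4}\big(-\tfrac{\alpha_0}{\alpha_2}+1\big)$, $c_2=\tfrac{\delta}{4}\big(\tfrac{\alpha_0}{\alpha_2}+1\big)$,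 and let $$\mathcal{E}_n(1+t)=\begin{cases}(1+t)^{1/2}& n=1,\\ [\ln(\mathrm{e}+t)]^{1/2}& n=2,\\ (1+t)^{\frac12-\frac n4}& n\geqslant 3.\end{cases}$$ Let $(u_0,u_1)\in(H^1\cap L^1)^n\times(L^2\cap L^1)^n$ and $(\theta_0,\theta_1)\in(L^2\cap L^1)\times(L^2\cap L^1)$, put $P_{\theta_1}=\int_{\mathbb{R}^n}\theta_1\,\mathrm{d}x$, and define the double diffusion waves profile $$\psi(t,x)=\mathcal{F}^{-1}_{\xi\to x}\left[-\frac{1}{2\alpha_2}\left((\alpha_0-\alpha_2)\frac{\sin(\nu_1|\xi|t)}{\nu_1|\xi|}\mathrm{e}^{-c_1|\xi|^2t}-(\alpha_0+\alpha_2)\frac{\sin(\nu_2|\xi|t)}{\nu_2|\xi|}\mathrm{e}^{-c_2|\xi|^2t}\right)\right]P_{\theta_1},$$ where $\mathcal{F}^{-1}$ is the inverse of $\mathcal{F}f(\xi)=\int_{\mathbb{R}^n}\mathrm{e}^{-ix\cdot\xi}f(x)\,\mathrm{d}x$; then $\psi(t,\cdot)\in L^2$ for all $t\geqslant0$. A solution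 is a pair $u\in(\mathcal{C}([0,\infty),L^2))^n$, $\theta\in\mathcal{C}([0,\infty),L^2)$ that is twice continuously differentiable in $t\in[0,\infty)$ with values in the tempered distributions and satisfies the equations and the initial conditions in that sense. Then a global solution exists, so that in particular $\theta\in\mathcal{C}([0,\infty),L^2)$, and every such solution satisfies the following, with constants $C,c>0$ that depend only on $n,b,\kappa,\gamma,\delta$. (i) For all $t\geqslant0$, $$\|\theta(t,\cdot)\|_{L^2}\leqslant C\,\mathcal{E}_n(1+t)\left(\|(u_0,u_1)\|_{(H^1\cap L^1)^n\times(L^2\cap L^1)^n}+\|(\theta_0,\theta_1)\|_{(L^2\cap L^1)\times(L^2\cap L^1)}\right).$$ (ii) $\|\theta(t,\cdot)-\psi(t,\cdot)\|_{L^2}=o\big(\mathcal{E}_n(1+t)\big)$ as $t\to\infty$. (iii) If $n=2$, assume in addition that $(\alpha_0-\alpha_2)^2(\alpha_1-\alpha_2)>2(\alpha_0+\alpha_2)^2(\alpha_1+\alpha_2)$ or $(\alpha_0+\alpha_2)^2(\alpha_1+\alpha_2)>2(\alpha_0-\alpha_2)^2(\alpha_1-\alpha_2)$. If $P_{\theta_1}\neq0$,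 then there is $T\geqslant0$ (which may depend on the data) with $\|\theta(t,\cdot)\|_{L^2}\geqslant c\,\mathcal{E}_n(1+t)\,|P_{\theta_1}|$ for all $t\geqslant T$. -/

import Mathlib

open MeasureTheory Set Filter Asymptotics
open scoped FourierTransform SchwartzMap

noncomputable section

/-- Physical space `ℝⁿ` with its Euclidean structure. -/
abbrev Space (n : ℕ) : Type := EuclideanSpace ℝ (Fin n)

namespace ThermoIII

/-! ### The constants built from the coefficients `b, κ, γ, δ` -/

def α₀ (b κ γ : ℝ) : ℝ := b ^ 2 - κ - γ ^ 2

def α₁ (b κ γ : ℝ) : ℝ := b ^ 2 + κ + γ ^ 2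

def α₂ (b κ γ : ℝ) : ℝ := Real.sqrt (α₁ b κ γ ^ 2 - 4 * b ^ 2 * κ)

def ν₁ (b κ γ : ℝ) : ℝ := Real.sqrt (1 / 2 * (α₁ b κ γ + α₂ b κ γ))

def ν₂ (b κ γ : ℝ) : ℝ := Real.sqrt (1 / 2 * (α₁ b κ γ - α₂ b κ γ))

def c₁ (b κ γ δ : ℝ) : ℝ := δ / 4 * (-(α₀ b κ γ / α₂ b κ γ) + 1)

def c₂ (b κ γ δ : ℝ) : ℝ := δ / 4 * (α₀ b κ γ / α₂ b κ γ + 1)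

/-- The symbol of the double diffusion waves with the weak singularity, as a function of time `t`
and of `r = |ξ|`. (At `r = 0` Lean's division gives `0`; this concerns a single frequency.) -/
def profileSymbol (b κ γ δ t r : ℝ) : ℝ :=
  -(1 / (2 * α₂ b κ γ)) *
    ((α₀ b κ γ - α₂ b κ γ) * (Real.sin (ν₁ b κ γ * r * t) / (ν₁ b κ γ * r))
        * Real.exp (-(c₁ b κ γ δ) * r ^ 2 * t)
      - (α₀ b κ γ + α₂ b κ γ) * (Real.sin (ν₂ b κ γ * r * t) / (ν₂ b κ γ * r))
        * Real.exp (-(c₂ b κ γ δ) * r ^ 2 * t))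

/-- The profile `ψ(t, x) = 𝓕⁻¹_{ξ → x} [profileSymbol t |ξ|] * P`, where `P` is the mean of `θ₁`.
Here `𝓕⁻¹ m (x) = (2π)⁻ⁿ ∫ exp (i x · ξ) m(ξ) dξ` is the inverse of `f ↦ ∫ exp (-i x · ξ) f(x) dx`;
the substitution `ξ = 2π w` turns it into Mathlib's `𝓕⁻`, whose kernel is `exp (2π i x · w)`. -/
def profile (n : ℕ) (b κ γ δ P t : ℝ) (x : Space n) : ℂ :=
  𝓕⁻ (fun w : Space n => (profileSymbol b κ γ δ t (2 * Real.pi * ‖w‖) : ℂ)) x * (P : ℂ)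

/-- The rate `𝓔ₙ(1 + t)`, as a function of `t`. -/
def rateE (n : ℕ) (t : ℝ) : ℝ :=
  if n = 1 then (1 + t) ^ (1 / 2 : ℝ)
  else if n = 2 then (Real.log (Real.exp 1 + t)) ^ (1 / 2 : ℝ)
  else (1 + t) ^ (1 / 2 - (n : ℝ) / 4)

/-! ### Function spaces and norms -/

/-- The pairing `⟨f, φ⟩ = ∫ f φ dx` with a real test function. -/
def pair {n : ℕ} (f : Space n → ℝ) (φ : 𝓢(Space n, ℝ)) : ℝ := ∫ x, f x * φ x

/-- The partial derivative `∂ⱼ φ` of a test function. -/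
def partialD {n : ℕ} (j : Fin n) (φ : 𝓢(Space n, ℝ)) : 𝓢(Space n, ℝ) :=
  LineDeriv.lineDerivOp (EuclideanSpace.single j (1 : ℝ)) φ

/-- The Laplacian `Δ φ` of a test function. -/
def lap {n : ℕ} (φ : 𝓢(Space n, ℝ)) : 𝓢(Space n, ℝ) := Laplacian.laplacian φ

/-- `D j` is the weak partial derivative `∂ⱼ f` of the vector field `f`, for every `j`. -/
def HasWeakPartials {n : ℕ} (f : Space n → Space n) (D : Fin n → Space n → Space n) : Prop :=
  ∀ i j : Fin n, ∀ φ : 𝓢(Space n, ℝ),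
    pair (fun x => f x i) (partialD j φ) = -pair (fun x => D j x i) φ

/-- Membership in `L² ∩ L¹`. -/
def MemL2L1 {n : ℕ} {F : Type*} [NormedAddCommGroup F] (f : Space n → F) : Prop :=
  MemLp f 2 volume ∧ MemLp f 1 volume

/-- The norm of `L² ∩ L¹`. -/
def normL2L1 {n : ℕ} {F : Type*} [NormedAddCommGroup F] (f : Space n → F) : ℝ :=
  (eLpNorm f 2 volume).toReal + (eLpNorm f 1 volume).toReal

/-- The norm of `(H¹ ∩ L¹)ⁿ`, for a vector field `f` with weak partial derivatives `D j`. -/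
def normH1L1 {n : ℕ} (f : Space n → Space n) (D : Fin n → Space n → Space n) : ℝ :=
  Real.sqrt ((eLpNorm f 2 volume).toReal ^ 2 + ∑ j, (eLpNorm (D j) 2 volume).toReal ^ 2)
    + (eLpNorm f 1 volume).toReal

/-! ### Solutions -/

/-- `(u, θ)` is a global solution, with `u ∈ C([0,∞), L²)ⁿ` and `θ ∈ C([0,∞), L²)`, of
`u_tt - b² Δu + γ ∇θ = 0`, `θ_tt - κ Δθ - δ Δθ_t + γ div u_tt = 0`,
`(u, u_t)(0) = (u₀, u₁)`, `(θ, θ_t)(0) = (θ₀, θ₁)`.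
Space derivatives are taken in the sense of distributions, and `u`, `θ` are twice continuously
differentiable in time with values in the (tempered) distributions. -/
structure IsSolution {n : ℕ} (b κ γ δ : ℝ) (u₀ u₁ : Space n → Space n) (θ₀ θ₁ : Space n → ℝ)
    (u : ℝ → Lp (Space n) 2 (volume : Measure (Space n)))
    (θ : ℝ → Lp ℝ 2 (volume : Measure (Space n))) : Prop where
  continuous_u : ContinuousOn u (Ici 0)
  continuous_θ : ContinuousOn θ (Ici 0)
  contDiff_u : ∀ (j : Fin n) (φ : 𝓢(Space n, ℝ)),
    ContDiffOn ℝ 2 (fun t => pair (fun x => u t x j) φ) (Ici 0)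
  contDiff_θ : ∀ φ : 𝓢(Space n, ℝ), ContDiffOn ℝ 2 (fun t => pair (θ t) φ) (Ici 0)
  eq_u : ∀ (j : Fin n) (φ : 𝓢(Space n, ℝ)), ∀ t ∈ Ici (0 : ℝ),
    iteratedDerivWithin 2 (fun s => pair (fun x => u s x j) φ) (Ici 0) t
      - b ^ 2 * pair (fun x => u t x j) (lap φ) - γ * pair (θ t) (partialD j φ) = 0
  eq_θ : ∀ φ : 𝓢(Space n, ℝ), ∀ t ∈ Ici (0 : ℝ),
    iteratedDerivWithin 2 (fun s => pair (θ s) φ) (Ici 0) t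
      - κ * pair (θ t) (lap φ)
      - δ * derivWithin (fun s => pair (θ s) (lap φ)) (Ici 0) t
      - γ * ∑ j : Fin n,
          iteratedDerivWithin 2 (fun s => pair (fun x => u s x j) (partialD j φ)) (Ici 0) t = 0
  init_u : u 0 =ᵐ[volume] u₀
  init_ut : ∀ (j : Fin n) (φ : 𝓢(Space n, ℝ)),
    derivWithin (fun t => pair (fun x => u t x j) φ) (Ici 0) 0 = pair (fun x => u₁ x j) φ
  init_θ : θ 0 =ᵐ[volume] θ₀
  init_θt : ∀ φ : 𝓢(Space n, ℝ),
    derivWithin (fun t => pair (θ t) φ) (Ici 0) 0 = pair θ₁ φ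

/-- The condition on the coefficients under which the lower bound in dimension two is stated. -/
def PlaneCondition (b κ γ : ℝ) : Prop :=
  (α₀ b κ γ - α₂ b κ γ) ^ 2 * (α₁ b κ γ - α₂ b κ γ)
      > 2 * (α₀ b κ γ + α₂ b κ γ) ^ 2 * (α₁ b κ γ + α₂ b κ γ) ∨
  (α₀ b κ γ + α₂ b κ γ) ^ 2 * (α₁ b κ γ + α₂ b κ γ)
      > 2 * (α₀ b κ γ - α₂ b κ γ) ^ 2 * (α₁ b κ γ - α₂ b κ γ)

end ThermoIII

end

/-!
On the Fourier side the system is, at each wave vector `k`, a linear ordinary differential equation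
for the state `(û, û_t, θ̂, q̂)` with `q = θ_t + γ div u_t - δ Δ θ`. The temperature only sees the
longitudinal part, four real equations `Y' = (r J - δ r² D) Y` with `r = |k|`, `J` skew-symmetric and
`D` the projection on the temperature (`ModeSystem`).

*One frequency.* The energy is dissipated through the temperature alone. A small correction transfers
the dissipation to the other variables, and gives decay with the rate `r² / (1 + r²)`
(`exists_correction_dissipation`, `exists_mode_decay`). For small `r` the matrix `J` has the eigenvalues
`± i ν₁`, `± i ν₂`. Averaging the damping over these four distinct frequencies, by a normal form
transformation, leaves the damping coefficients `c₁` and `c₂`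
(`exists_oscillator_approx`). The part of the temperature that comes from `θ̂₁` is therefore the symbol
of the double diffusion waves, up to an error without the singularity `1 / r`
(`exists_heatKernel_bounds`); the part that comes from the other data does not have this singularity
either (`exists_thetaRest_le`).

*Existence and uniqueness.* Solving at each frequency gives a solution: a bound of the flow without
loss of powers of `k` (`exists_sol_bounds`) yields continuity in `L²` by dominated convergence, and
pairings with Schwartz functions can be differentiated under the integral (`exists_isSolution`). For
uniqueness, a solution is paired with test functions whose Fourier transform has compact support. On
functions with frequencies in a fixed ball the derivatives are bounded, and Picard iteration shows that
the pairings of the difference of two solutions vanish (`picard_vanish`, `IsSolution.theta_unique`). So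
every solution has the temperature constructed on the Fourier side.

*Rates.* By Plancherel's theorem the norms become integrals in polar coordinates. The function
`min t (e^{-c r² t} / r)` has the `L²` norm `𝓔ₙ(1 + t)` up to constants, whereas the terms without
singularity are of order `(1 + t)^{-n/4} = o(𝓔ₙ(1 + t))`; this is the upper bound
(`exists_thetaHat_le`). In the comparison with the profile, `θ̂₁(k)` is replaced by its value at zero,
the mean of `θ₁`: it is continuous, and the frequencies away from zero decay exponentially
(`thetaHat_sub_isLittleO`). For the lower bound, the weights of the two waves are positive and their
speeds differ, so the product of the two waves oscillates and the squares of the waves dominate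
(`integral_two_waves_ge`); hence the profile has the size `𝓔ₙ(1 + t) |∫ θ₁|`, from below as well
(`exists_profile_ge`), and the temperature, being close to it, inherits this.
-/

namespace ThermoIII

/-! ### Algebra of the coefficients -/

section Coefficients

variable {b κ γ δ : ℝ}

lemma α₂_sq_eq (b κ γ : ℝ) : α₂ b κ γ ^ 2 = α₁ b κ γ ^ 2 - 4 * b ^ 2 * κ := by
  refine Real.sq_sqrt ?_
  have : α₁ b κ γ ^ 2 - 4 * b ^ 2 * κ = α₀ b κ γ ^ 2 + 4 * b ^ 2 * γ ^ 2 := by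
    simp only [α₁, α₀]; ring
  rw [this]; positivity

lemma α₂_sq_eq' (b κ γ : ℝ) : α₂ b κ γ ^ 2 = α₀ b κ γ ^ 2 + 4 * b ^ 2 * γ ^ 2 := by
  rw [α₂_sq_eq]; simp only [α₁, α₀]; ring

lemma abs_α₀_lt_α₂ (hb : 0 < b) (hγ : γ ≠ 0) : |α₀ b κ γ| < α₂ b κ γ := by
  refine abs_lt_of_sq_lt_sq ?_ (Real.sqrt_nonneg _)
  rw [α₂_sq_eq']
  have : 0 < 4 * b ^ 2 * γ ^ 2 := by positivity
  linarith

lemma α₂_pos (hb : 0 < b) (hγ : γ ≠ 0) : 0 < α₂ b κ γ :=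
  (abs_nonneg _).trans_lt (abs_α₀_lt_α₂ (κ := κ) hb hγ)

lemma α₂_lt_α₁ (hb : 0 < b) (hκ : 0 < κ) : α₂ b κ γ < α₁ b κ γ := by
  have h1 : 0 < α₁ b κ γ := by simp only [α₁]; positivity
  refine lt_of_pow_lt_pow_left₀ 2 h1.le ?_
  rw [α₂_sq_eq]
  have : 0 < 4 * b ^ 2 * κ := by positivity
  linarith

lemma ν₁_sq (hb : 0 < b) (hκ : 0 < κ) : ν₁ b κ γ ^ 2 = 1 / 2 * (α₁ b κ γ + α₂ b κ γ) := by
  refine Real.sq_sqrt ?_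
  have h1 : 0 < α₁ b κ γ := by simp only [α₁]; positivity
  have h2 : 0 ≤ α₂ b κ γ := Real.sqrt_nonneg _
  positivity

lemma ν₂_sq (hb : 0 < b) (hκ : 0 < κ) : ν₂ b κ γ ^ 2 = 1 / 2 * (α₁ b κ γ - α₂ b κ γ) := by
  refine Real.sq_sqrt ?_
  have := α₂_lt_α₁ (γ := γ) hb hκ
  linarith

lemma ν₁_pos (hb : 0 < b) (hκ : 0 < κ) : 0 < ν₁ b κ γ := by
  refine Real.sqrt_pos.2 ?_
  have h1 : 0 < α₁ b κ γ := by simp only [α₁]; positivity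
  have h2 : 0 ≤ α₂ b κ γ := Real.sqrt_nonneg _
  positivity

lemma ν₂_pos (hb : 0 < b) (hκ : 0 < κ) : 0 < ν₂ b κ γ := by
  refine Real.sqrt_pos.2 ?_
  have := α₂_lt_α₁ (γ := γ) hb hκ
  linarith

lemma ν₂_lt_ν₁ (hb : 0 < b) (hκ : 0 < κ) (hγ : γ ≠ 0) : ν₂ b κ γ < ν₁ b κ γ := by
  refine lt_of_pow_lt_pow_left₀ 2 (ν₁_pos hb hκ).le ?_
  rw [ν₁_sq hb hκ, ν₂_sq hb hκ]
  have := α₂_pos (κ := κ) hb hγ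
  linarith

lemma c₁_pos (hb : 0 < b) (hγ : γ ≠ 0) (hδ : 0 < δ) : 0 < c₁ b κ γ δ := by
  have h := (abs_lt.1 (abs_α₀_lt_α₂ (κ := κ) hb hγ)).2
  have : α₀ b κ γ / α₂ b κ γ < 1 := (div_lt_one (α₂_pos hb hγ)).2 h
  unfold c₁
  have : 0 < -(α₀ b κ γ / α₂ b κ γ) + 1 := by linarith
  positivity

lemma c₂_pos (hb : 0 < b) (hγ : γ ≠ 0) (hδ : 0 < δ) : 0 < c₂ b κ γ δ := by
  have h := (abs_lt.1 (abs_α₀_lt_α₂ (κ := κ) hb hγ)).1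
  have : -1 < α₀ b κ γ / α₂ b κ γ := (lt_div_iff₀ (α₂_pos hb hγ)).2 (by linarith)
  unfold c₂
  have : 0 < (α₀ b κ γ / α₂ b κ γ) + 1 := by linarith
  positivity

lemma c₁_add_c₂ (b κ γ δ : ℝ) : c₁ b κ γ δ + c₂ b κ γ δ = δ / 2 := by
  unfold c₁ c₂; ring

/-- `ν₁²` is a root of the characteristic polynomial of the undamped system. -/
lemma ν₁_char (hb : 0 < b) (hκ : 0 < κ) :
    γ ^ 2 * ν₁ b κ γ ^ 2 + κ * (ν₁ b κ γ ^ 2 - b ^ 2)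
      = ν₁ b κ γ ^ 2 * (ν₁ b κ γ ^ 2 - b ^ 2) := by
  rw [ν₁_sq hb hκ]
  have h := α₂_sq_eq b κ γ
  simp only [α₁] at h ⊢
  nlinarith

/-- `ν₂²` is a root of the characteristic polynomial of the undamped system. -/
lemma ν₂_char (hb : 0 < b) (hκ : 0 < κ) :
    γ ^ 2 * ν₂ b κ γ ^ 2 + κ * (ν₂ b κ γ ^ 2 - b ^ 2)
      = ν₂ b κ γ ^ 2 * (ν₂ b κ γ ^ 2 - b ^ 2) := by
  rw [ν₂_sq hb hκ]
  have h := α₂_sq_eq b κ γ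
  simp only [α₁] at h ⊢
  nlinarith

lemma ν₁_sq_sub_ne (hb : 0 < b) (hκ : 0 < κ) (hγ : γ ≠ 0) : ν₁ b κ γ ^ 2 - b ^ 2 ≠ 0 := by
  intro h
  have h1 := ν₁_char (γ := γ) hb hκ
  rw [h, mul_zero, mul_zero, add_zero] at h1
  have : 0 < γ ^ 2 * ν₁ b κ γ ^ 2 := by have := ν₁_pos (γ := γ) hb hκ; positivity
  linarith

lemma ν₂_sq_sub_ne (hb : 0 < b) (hκ : 0 < κ) (hγ : γ ≠ 0) : ν₂ b κ γ ^ 2 - b ^ 2 ≠ 0 := by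
  intro h
  have h1 := ν₂_char (γ := γ) hb hκ
  rw [h, mul_zero, mul_zero, add_zero] at h1
  have : 0 < γ ^ 2 * ν₂ b κ γ ^ 2 := by have := ν₂_pos (γ := γ) hb hκ; positivity
  linarith

/-- The strain cancels when the two waves are recombined with the weights `cⱼ`. -/
lemma c_div_add_c_div (hb : 0 < b) (hκ : 0 < κ) (hγ : γ ≠ 0) :
    c₁ b κ γ δ / (ν₁ b κ γ ^ 2 - b ^ 2) + c₂ b κ γ δ / (ν₂ b κ γ ^ 2 - b ^ 2) = 0 := by
  have h1 := ν₁_sq_sub_ne hb hκ hγ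
  have h2 := ν₂_sq_sub_ne hb hκ hγ
  have h3 := (α₂_pos (κ := κ) hb hγ).ne'
  rw [div_add_div _ _ h1 h2, div_eq_zero_iff]
  left
  rw [ν₁_sq hb hκ, ν₂_sq hb hκ]
  unfold c₁ c₂
  field_simp
  simp only [α₁, α₀]
  ring

/-- The profile symbol, written with the weights `2 cⱼ / δ` of the two waves. -/
lemma profileSymbol_eq (hb : 0 < b) (hγ : γ ≠ 0) (hδ : 0 < δ) (t r : ℝ) :
    profileSymbol b κ γ δ t r =
      2 * c₁ b κ γ δ / δ * (Real.sin (ν₁ b κ γ * r * t) / (ν₁ b κ γ * r))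
          * Real.exp (-(c₁ b κ γ δ) * r ^ 2 * t)
        + 2 * c₂ b κ γ δ / δ * (Real.sin (ν₂ b κ γ * r * t) / (ν₂ b κ γ * r))
          * Real.exp (-(c₂ b κ γ δ) * r ^ 2 * t) := by
  have h3 := (α₂_pos (κ := κ) hb hγ).ne'
  have e1 : 2 * c₁ b κ γ δ / δ = -(1 / (2 * α₂ b κ γ)) * (α₀ b κ γ - α₂ b κ γ) := by
    unfold c₁; field_simp; ring
  have e2 : 2 * c₂ b κ γ δ / δ = (1 / (2 * α₂ b κ γ)) * (α₀ b κ γ + α₂ b κ γ) := by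
    unfold c₂; field_simp; ring
  rw [e1, e2]
  unfold profileSymbol
  ring

end Coefficients

/-! ### The longitudinal modes at one frequency -/

/-- The equations of the longitudinal part of the solution at a frequency of modulus `r`, in the
variables in which they read `Y' = (r J - δ r² D) Y` with `J` skew-symmetric and `D` the projection
on `θ`: the velocity `A`, the strain `Z`, the temperature `θ` and the rescaled heat flux `s`. -/
structure ModeSystem (b κ γ δ r : ℝ) (A Z θ s : ℝ → ℝ) : Prop where
  hA : ∀ t, HasDerivAt A (r * (-b * Z t - γ * θ t)) t
  hZ : ∀ t, HasDerivAt Z (r * (b * A t)) t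
  hθ : ∀ t, HasDerivAt θ (r * (γ * A t + √κ * s t) - δ * r ^ 2 * θ t) t
  hs : ∀ t, HasDerivAt s (-(r * (√κ * θ t))) t

section Lyapunov

variable {b κ γ δ : ℝ}

/-- The time derivative of the correction `-θ p + σ² γ p Z - σ³ A Z`, where `p = γ A + √κ s`, for
the weight `μ = r / (1 + r²)`: it dissipates `A`, `Z` and `s`, up to the damping of `θ`. -/
lemma exists_correction_dissipation (hb : 0 < b) (hκ : 0 < κ) (hγ : γ ≠ 0) :
    ∃ σ k C : ℝ, 0 < σ ∧ 0 < k ∧ 0 < C ∧ ∀ r A Z θ s : ℝ,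
      r / (1 + r ^ 2) * (-((r * (γ * A + √κ * s) - δ * r ^ 2 * θ) * (γ * A + √κ * s)
            + θ * (γ * (r * (-b * Z - γ * θ)) + √κ * -(r * (√κ * θ))))
          + σ ^ 2 * γ * ((γ * (r * (-b * Z - γ * θ)) + √κ * -(r * (√κ * θ))) * Z
            + (γ * A + √κ * s) * (r * (b * A)))
          - σ ^ 3 * ((r * (-b * Z - γ * θ)) * Z + A * (r * (b * A))))
        ≤ -(k * (r ^ 2 / (1 + r ^ 2)) * (A ^ 2 + Z ^ 2 + s ^ 2)) + C * r ^ 2 * θ ^ 2 := by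
  have hg2 : 0 < γ ^ 2 := by positivity
  set σ : ℝ := γ ^ 2 / (2 + b * γ ^ 4) with hσdef
  have hden : 0 < 2 + b * γ ^ 4 := by positivity
  have hσ : 0 < σ := by positivity
  have hσ1 : σ ≤ γ ^ 2 / 2 := by
    rw [hσdef]; gcongr; have : 0 ≤ b * γ ^ 4 := by positivity
    linarith
  have hσ2 : σ * (b * γ ^ 2) ≤ 1 := by
    rw [hσdef, div_mul_eq_mul_div, div_le_one hden]; nlinarith [sq_nonneg (γ ^ 2)]
  set g : ℝ := γ ^ 2 + κ with hg
  set e : ℝ := γ * b - σ ^ 2 * g * γ + σ ^ 3 * γ with he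
  set w : ℝ := σ ^ 2 * γ ^ 2 * b with hw
  have hwpos : 0 < w := by positivity
  set k₀ : ℝ := min (1 / 4) (σ ^ 3 * b / (4 * γ ^ 2)) with hk₀
  have hk₀pos : 0 < k₀ := by rw [hk₀]; positivity
  -- `k₀ (p² + γ² A²) ≤ p² / 4 + σ³ b A² / 4` and `κ s² ≤ 2 (p² + γ² A²)`
  set k : ℝ := min (κ * k₀ / 2) (min (w / 4) (σ ^ 3 * b / 4)) with hk
  have hkpos : 0 < k := by rw [hk]; positivity
  refine ⟨σ, k, δ ^ 2 + g + e ^ 2 / w, hσ, hkpos, by positivity, ?_⟩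
  intro r A Z θ s
  set p : ℝ := γ * A + √κ * s with hp
  set m : ℝ := r ^ 2 / (1 + r ^ 2) with hm
  have hm0 : 0 ≤ m := by positivity
  have hm1 : m ≤ 1 := by rw [hm, div_le_one (by positivity)]; linarith
  have hmr : m ≤ r ^ 2 := by
    rw [hm]; exact div_le_self (sq_nonneg r) (by nlinarith [sq_nonneg r])
  have hsq : √κ * √κ = κ := Real.mul_self_sqrt hκ.le
  have key : r / (1 + r ^ 2) * (-((r * p - δ * r ^ 2 * θ) * p
            + θ * (γ * (r * (-b * Z - γ * θ)) + √κ * -(r * (√κ * θ))))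
          + σ ^ 2 * γ * ((γ * (r * (-b * Z - γ * θ)) + √κ * -(r * (√κ * θ))) * Z
            + p * (r * (b * A)))
          - σ ^ 3 * ((r * (-b * Z - γ * θ)) * Z + A * (r * (b * A))))
      = m * (-p ^ 2 + g * θ ^ 2 + e * (θ * Z) - w * Z ^ 2 + σ ^ 2 * γ * b * (p * A)
          + σ ^ 3 * b * Z ^ 2 - σ ^ 3 * b * A ^ 2) + δ * (r * θ) * (m * p) := by
    rw [hm, he, hg, hw]
    have : √κ * -(r * (√κ * θ)) = -(κ * r * θ) := by
      linear_combination (-(r * θ)) * hsq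
    rw [this]
    field_simp
    ring
  rw [key]
  have t1 : δ * (r * θ) * (m * p) ≤ δ ^ 2 * r ^ 2 * θ ^ 2 + m * (p ^ 2 / 4) := by
    have h1 : δ * (r * θ) * (m * p) ≤ δ ^ 2 * r ^ 2 * θ ^ 2 + (m * p) ^ 2 / 4 := by
      linarith [sq_nonneg (δ * (r * θ) - m * p / 2)]
    have h2 : (m * p) ^ 2 ≤ m * p ^ 2 := by
      have : m * p ^ 2 * m ≤ m * p ^ 2 * 1 := by gcongr
      linarith
    linarith
  have t2 : e * (θ * Z) ≤ w / 4 * Z ^ 2 + e ^ 2 / w * θ ^ 2 := by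
    have : w / 4 * Z ^ 2 + e ^ 2 / w * θ ^ 2 - e * (θ * Z) = w * (Z / 2 - e / w * θ) ^ 2 := by
      field_simp; ring
    linarith [mul_nonneg hwpos.le (sq_nonneg (Z / 2 - e / w * θ))]
  have t3 : σ ^ 2 * γ * b * (p * A) ≤ p ^ 2 / 2 + σ ^ 3 * b / 2 * A ^ 2 := by
    have h1 : σ ^ 2 * γ * b * (p * A) ≤ p ^ 2 / 2 + (σ ^ 2 * γ * b) ^ 2 / 2 * A ^ 2 := by
      linarith [sq_nonneg (p - σ ^ 2 * γ * b * A)]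
    have h2 : (σ ^ 2 * γ * b) ^ 2 ≤ σ ^ 3 * b := by
      have : (σ ^ 2 * γ * b) ^ 2 = σ ^ 3 * b * (σ * (b * γ ^ 2)) := by ring
      rw [this]
      exact mul_le_of_le_one_right (by positivity) hσ2
    linarith [mul_le_mul_of_nonneg_right h2 (sq_nonneg A)]
  have t4 : σ ^ 3 * b * Z ^ 2 ≤ w / 2 * Z ^ 2 := by
    have : σ ^ 3 * b ≤ w / 2 := by
      have : σ ^ 2 * b * σ ≤ σ ^ 2 * b * (γ ^ 2 / 2) := by gcongr
      rw [hw]; linarith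
    gcongr
  have t5 : k * (A ^ 2 + Z ^ 2 + s ^ 2) ≤ p ^ 2 / 4 + w / 4 * Z ^ 2 + σ ^ 3 * b / 2 * A ^ 2 := by
    have hs : κ * s ^ 2 ≤ 2 * (p ^ 2 + γ ^ 2 * A ^ 2) := by
      have : κ * s ^ 2 = (p - γ * A) ^ 2 := by
        rw [hp, add_sub_cancel_left, mul_pow, Real.sq_sqrt hκ.le]
      rw [this]; linarith [sq_nonneg (p + γ * A)]
    have h1 : k₀ * (p ^ 2 + γ ^ 2 * A ^ 2) ≤ p ^ 2 / 4 + σ ^ 3 * b / 4 * A ^ 2 := by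
      have a1 : k₀ * p ^ 2 ≤ 1 / 4 * p ^ 2 := by gcongr; exact min_le_left _ _
      have a2 : k₀ * γ ^ 2 ≤ σ ^ 3 * b / 4 := by
        calc k₀ * γ ^ 2 ≤ σ ^ 3 * b / (4 * γ ^ 2) * γ ^ 2 := by gcongr; exact min_le_right _ _
          _ = _ := by field_simp
      linarith [mul_le_mul_of_nonneg_right a2 (sq_nonneg A)]
    have a1 : k * s ^ 2 ≤ κ * k₀ / 2 * s ^ 2 := by gcongr; exact min_le_left _ _
    have a2 : k * Z ^ 2 ≤ w / 4 * Z ^ 2 := by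
      gcongr; exact (min_le_right _ _).trans (min_le_left _ _)
    have a3 : k * A ^ 2 ≤ σ ^ 3 * b / 4 * A ^ 2 := by
      gcongr; exact (min_le_right _ _).trans (min_le_right _ _)
    linarith [mul_le_mul_of_nonneg_left hs hk₀pos.le]
  have t6 : m * (g * θ ^ 2 + e ^ 2 / w * θ ^ 2) ≤ r ^ 2 * (g * θ ^ 2 + e ^ 2 / w * θ ^ 2) := by
    gcongr
  have t7 := mul_le_mul_of_nonneg_left (add_le_add (add_le_add t2 t3) (add_le_add t4 t5)) hm0
  linarith

/-- The correction of the Lyapunov functional is bounded by the energy. -/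
lemma correction_le {σ : ℝ} (hσ : 0 ≤ σ) (κ γ A Z θ s : ℝ) :
    |-(θ * (γ * A + √κ * s)) + σ ^ 2 * γ * ((γ * A + √κ * s) * Z) - σ ^ 3 * (A * Z)|
      ≤ (|γ| + √κ + σ ^ 2 * |γ| * (|γ| + √κ) + σ ^ 3) * (A ^ 2 + Z ^ 2 + θ ^ 2 + s ^ 2) := by
  set N : ℝ := A ^ 2 + Z ^ 2 + θ ^ 2 + s ^ 2 with hN
  have q : ∀ x y : ℝ, |x| * |y| ≤ 1 / 2 * (x ^ 2 + y ^ 2) := fun x y => by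
    rw [← sq_abs x, ← sq_abs y]; linarith [sq_nonneg (|x| - |y|)]
  have hA := sq_nonneg A
  have hZ := sq_nonneg Z
  have hθ := sq_nonneg θ
  have hs := sq_nonneg s
  have n0 : |γ * A + √κ * s| ≤ |γ| * |A| + √κ * |s| := by
    refine (abs_add_le _ _).trans ?_
    rw [abs_mul, abs_mul, abs_of_nonneg (Real.sqrt_nonneg κ)]
  have n1 : |θ * (γ * A + √κ * s)| ≤ (|γ| + √κ) * N := by
    rw [abs_mul]
    calc |θ| * |γ * A + √κ * s| ≤ |θ| * (|γ| * |A| + √κ * |s|) := by gcongr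
      _ = |γ| * (|θ| * |A|) + √κ * (|θ| * |s|) := by ring
      _ ≤ |γ| * N + √κ * N := by
        gcongr
        · linarith [q θ A]
        · linarith [q θ s]
      _ = _ := by ring
  have n2 : |(γ * A + √κ * s) * Z| ≤ (|γ| + √κ) * N := by
    rw [abs_mul]
    calc |γ * A + √κ * s| * |Z| ≤ (|γ| * |A| + √κ * |s|) * |Z| := by gcongr
      _ = |γ| * (|A| * |Z|) + √κ * (|s| * |Z|) := by ring
      _ ≤ |γ| * N + √κ * N := by
        gcongr
        · linarith [q A Z]
        · linarith [q s Z]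
      _ = _ := by ring
  have n3 : |A * Z| ≤ N := by
    rw [abs_mul]; linarith [q A Z]
  calc _ ≤ |θ * (γ * A + √κ * s)| + σ ^ 2 * |γ| * |(γ * A + √κ * s) * Z| + σ ^ 3 * |A * Z| := by
        refine (abs_sub _ _).trans ?_
        refine add_le_add ((abs_add_le _ _).trans (add_le_add (abs_neg _).le ?_)) ?_
        · rw [abs_mul, abs_mul, abs_of_nonneg (sq_nonneg σ)]
        · rw [abs_mul (σ ^ 3), abs_of_nonneg (pow_nonneg hσ 3)]
    _ ≤ (|γ| + √κ) * N + σ ^ 2 * |γ| * ((|γ| + √κ) * N) + σ ^ 3 * N := by gcongr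
    _ = _ := by ring

/-- Pointwise decay of the modes: like the heat kernel at low frequencies, exponential at high
frequencies. -/
lemma exists_mode_decay (hb : 0 < b) (hκ : 0 < κ) (hγ : γ ≠ 0) (hδ : 0 < δ) :
    ∃ C c : ℝ, 0 < C ∧ 0 < c ∧ ∀ (r : ℝ) (A Z θ s : ℝ → ℝ), ModeSystem b κ γ δ r A Z θ s →
      ∀ t, 0 ≤ t → A t ^ 2 + Z t ^ 2 + θ t ^ 2 + s t ^ 2
        ≤ C * Real.exp (-(c * (r ^ 2 / (1 + r ^ 2)) * t))
          * (A 0 ^ 2 + Z 0 ^ 2 + θ 0 ^ 2 + s 0 ^ 2) := by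
  obtain ⟨σ, k, C₁, hσ, hk, hC₁, hmain⟩ := exists_correction_dissipation (δ := δ) hb hκ hγ
  -- the correction is bounded by `B` times the energy
  set B : ℝ := |γ| + √κ + σ ^ 2 * |γ| * (|γ| + √κ) + σ ^ 3 with hB
  have hBpos : 0 < B := by positivity
  set η : ℝ := min (δ / C₁) (1 / (2 * B)) with hη
  have hηpos : 0 < η := by rw [hη]; positivity
  have hη1 : η * C₁ ≤ δ := by
    calc η * C₁ ≤ δ / C₁ * C₁ := by gcongr; exact min_le_left _ _
      _ = δ := by field_simp
  have hη2 : η * B ≤ 1 / 2 := by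
    calc η * B ≤ 1 / (2 * B) * B := by gcongr; exact min_le_right _ _
      _ = 1 / 2 := by field_simp
  set c : ℝ := min δ (η * k) / 2 with hc
  have hcpos : 0 < c := by rw [hc]; positivity
  refine ⟨3, c, by norm_num, hcpos, ?_⟩
  intro r A Z θ s h t ht
  set μ : ℝ := r / (1 + r ^ 2) with hμ
  set m : ℝ := r ^ 2 / (1 + r ^ 2) with hm
  have hm0 : 0 ≤ m := by positivity
  have hmr : m ≤ r ^ 2 := by
    rw [hm]; exact div_le_self (sq_nonneg r) (by nlinarith [sq_nonneg r])
  have hμ1 : |μ| ≤ 1 := by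
    rw [hμ, abs_div, abs_of_pos (show (0:ℝ) < 1 + r ^ 2 by positivity),
      div_le_one (by positivity)]
    rw [← sq_abs]; nlinarith [sq_nonneg (|r| - 1), abs_nonneg r]
  set N : ℝ → ℝ := fun t => A t ^ 2 + Z t ^ 2 + θ t ^ 2 + s t ^ 2 with hN
  set G : ℝ → ℝ := fun t => -(θ t * (γ * A t + √κ * s t))
    + σ ^ 2 * γ * ((γ * A t + √κ * s t) * Z t) - σ ^ 3 * (A t * Z t) with hG
  set L : ℝ → ℝ := fun t => N t + η * (μ * G t) with hL
  have hNd : ∀ t, HasDerivAt N (-(2 * δ * r ^ 2 * θ t ^ 2)) t := by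
    intro t
    convert! (((h.hA t).pow 2).add ((h.hZ t).pow 2)).add ((h.hθ t).pow 2) |>.add ((h.hs t).pow 2)
      using 1
    push_cast; ring
  have hpd : ∀ t, HasDerivAt (fun t => γ * A t + √κ * s t)
      (γ * (r * (-b * Z t - γ * θ t)) + √κ * -(r * (√κ * θ t))) t := fun t =>
    ((h.hA t).const_mul γ).add ((h.hs t).const_mul _)
  have hGd := fun t => (((h.hθ t).mul (hpd t)).neg.add
      (((hpd t).mul (h.hZ t)).const_mul (σ ^ 2 * γ))).sub
      (((h.hA t).mul (h.hZ t)).const_mul (σ ^ 3))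
  have hN0 : ∀ t, 0 ≤ N t := fun t => by positivity
  have hLN : ∀ t, 1 / 2 * N t ≤ L t ∧ L t ≤ 3 / 2 * N t := by
    intro t
    have hGle : |G t| ≤ B * N t := correction_le hσ.le κ γ (A t) (Z t) (θ t) (s t)
    have hμG : |η * (μ * G t)| ≤ 1 / 2 * N t := by
      calc |η * (μ * G t)| = η * (|μ| * |G t|) := by rw [abs_mul, abs_mul, abs_of_pos hηpos]
        _ ≤ η * (1 * (B * N t)) := by gcongr
        _ = (η * B) * N t := by ring
        _ ≤ _ := by gcongr
    have := abs_le.1 hμG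
    simp only [hL]
    constructor <;> linarith
  have hLd : ∀ t, ∃ L', HasDerivAt L L' t ∧ L' ≤ -(c * m * L t) := by
    intro t
    refine ⟨_, (hNd t).add (((hGd t).const_mul μ).const_mul η), ?_⟩
    have h1 := mul_le_mul_of_nonneg_left (hmain r (A t) (Z t) (θ t) (s t)) hηpos.le
    have hcm : c * m * L t ≤ δ * r ^ 2 * θ t ^ 2 + η * (k * m * (A t ^ 2 + Z t ^ 2 + s t ^ 2)) := by
      have a1 : c * m * L t ≤ c * m * (2 * N t) := by
        gcongr
        linarith [(hLN t).2, hN0 t]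
      have a2 : c * 2 ≤ δ := by
        rw [hc]; linarith [min_le_left δ (η * k)]
      have a3 : c * 2 ≤ η * k := by
        rw [hc]; linarith [min_le_right δ (η * k)]
      have a4 : (c * 2) * (m * θ t ^ 2) ≤ δ * (r ^ 2 * θ t ^ 2) := by gcongr
      have a5 : (c * 2) * (m * (A t ^ 2 + Z t ^ 2 + s t ^ 2))
          ≤ (η * k) * (m * (A t ^ 2 + Z t ^ 2 + s t ^ 2)) := by gcongr
      simp only [hN] at a1
      linarith
    have a6 : η * (C₁ * r ^ 2 * θ t ^ 2) ≤ δ * r ^ 2 * θ t ^ 2 := by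
      calc η * (C₁ * r ^ 2 * θ t ^ 2) = (η * C₁) * (r ^ 2 * θ t ^ 2) := by ring
        _ ≤ δ * (r ^ 2 * θ t ^ 2) := by gcongr
        _ = _ := by ring
    linarith
  have hanti : Antitone fun t => Real.exp (c * m * t) * L t := by
    choose L' hL' hle using hLd
    refine antitone_of_hasDerivAt_nonpos (fun t => (((hasDerivAt_id t).const_mul (c * m)).exp).mul
      (hL' t)) fun t => ?_
    have := mul_le_mul_of_nonneg_left (hle t) (Real.exp_pos (c * m * t)).le
    simp only [id, mul_one, Pi.zero_apply]
    linarith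
  have h2 := hanti ht
  simp only [mul_zero, Real.exp_zero, one_mul] at h2
  have h3 := (hLN t).1
  have h4 := (hLN 0).2
  have h5 : Real.exp (-(c * m * t)) * (Real.exp (c * m * t) * L t) = L t := by
    rw [← mul_assoc, ← Real.exp_add]; simp
  have h6 : L t ≤ Real.exp (-(c * m * t)) * L 0 := by
    rw [← h5]; gcongr
  have h7 : Real.exp (-(c * m * t)) * L 0 ≤ Real.exp (-(c * m * t)) * (3 / 2 * N 0) := by gcongr
  show N t ≤ 3 * Real.exp (-(c * m * t)) * N 0
  linarith

end Lyapunov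

/-! ### The low-frequency waves -/

section NormalForm

open ComplexConjugate

/-- A perturbed exponential: if `z' = l z + R` with `‖R‖ ≤ M e^{-a t}` and `Re l ≤ -a`, then `z` stays
close to `e^{l t} z(0)`. -/
lemma norm_sub_exp_mul_le {z R : ℝ → ℂ} {l : ℂ} {a M t : ℝ}
    (hz : ∀ t, HasDerivAt z (l * z t + R t) t) (hl : l.re ≤ -a)
    (hR : ∀ s, 0 ≤ s → ‖R s‖ ≤ M * Real.exp (-(a * s))) (hM : 0 ≤ M) (ht : 0 ≤ t) :
    ‖z t - Complex.exp (l * t) * z 0‖ ≤ M * t * Real.exp (-(a * t)) := by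
  have hd : ∀ s : ℝ, HasDerivAt (fun s : ℝ => Complex.exp (-(l * s)) * z s)
      (Complex.exp (-(l * s)) * R s) s := by
    intro s
    have h1 : HasDerivAt (fun s : ℝ => -(l * (s : ℂ))) (-(l * 1)) s :=
      ((Complex.ofRealCLM.hasDerivAt (x := s)).const_mul l).neg
    convert! h1.cexp.mul (hz s) using 1
    ring
  have hb : ∀ s ∈ Ico 0 t, ‖Complex.exp (-(l * s)) * R s‖ ≤ M * Real.exp ((-l.re - a) * t) := by
    intro s hs
    rw [norm_mul, Complex.norm_exp]
    have e1 : (-(l * (s : ℂ))).re = -l.re * s := by simp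
    rw [e1]
    calc Real.exp (-l.re * s) * ‖R s‖ ≤ Real.exp (-l.re * s) * (M * Real.exp (-(a * s))) := by
          gcongr; exact hR s hs.1
      _ = M * Real.exp ((-l.re - a) * s) := by
          rw [mul_left_comm, ← Real.exp_add]; ring_nf
      _ ≤ _ := by
          gcongr
          · linarith
          · exact hs.2.le
  have h2 := norm_image_sub_le_of_norm_deriv_le_segment' (fun s _ => (hd s).hasDerivWithinAt) hb t
    ⟨ht, le_rfl⟩
  simp only [Complex.ofReal_zero, mul_zero, neg_zero, Complex.exp_zero, one_mul, sub_zero] at h2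
  have h3 : z t - Complex.exp (l * t) * z 0
      = Complex.exp (l * t) * (Complex.exp (-(l * t)) * z t - z 0) := by
    rw [mul_sub, ← mul_assoc, ← Complex.exp_add]; simp
  rw [h3, norm_mul, Complex.norm_exp]
  have e1 : (l * (t : ℂ)).re = l.re * t := by simp
  rw [e1]
  calc _ ≤ Real.exp (l.re * t) * (M * Real.exp ((-l.re - a) * t) * t) := by gcongr
    _ = M * t * (Real.exp (l.re * t) * Real.exp ((-l.re - a) * t)) := by ring
    _ = _ := by rw [← Real.exp_add]; ring_nf

/-- The normal form of two damped oscillators with a common weak damping `δ r² θ`, where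
`θ = 2 Re (g₁ y₁ + g₂ y₂)`. Adding to `y₁` suitable multiples of order `r` of `conj y₁`, `y₂` and
`conj y₂` removes the non-resonant part of the damping at order `r²`, so that `y₁` is governed by the
exponent `i ω₁ r - δ g₁ r²`, up to errors of third order. -/
lemma exists_oscillator_approx {ω₁ ω₂ : ℝ} (h1 : ω₁ ≠ 0) (h12 : ω₁ ≠ ω₂) (h12' : ω₁ + ω₂ ≠ 0)
    (g₁ g₂ δ : ℝ) :
    ∃ C : ℝ, 0 < C ∧ ∀ (r a K : ℝ) (y₁ y₂ : ℝ → ℂ) (θ : ℝ → ℝ), 0 ≤ r → a ≤ δ * g₁ * r ^ 2 →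
      0 ≤ K →
      (∀ t, HasDerivAt y₁ (ω₁ * r * Complex.I * y₁ t - δ * r ^ 2 * θ t) t) →
      (∀ t, HasDerivAt y₂ (ω₂ * r * Complex.I * y₂ t - δ * r ^ 2 * θ t) t) →
      (∀ t, (θ t : ℂ) = g₁ * (y₁ t + conj (y₁ t)) + g₂ * (y₂ t + conj (y₂ t))) →
      (∀ t, 0 ≤ t → ‖y₁ t‖ ≤ K * Real.exp (-(a * t))) →
      (∀ t, 0 ≤ t → ‖y₂ t‖ ≤ K * Real.exp (-(a * t))) →
      ∀ t, 0 ≤ t →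
        ‖y₁ t - Complex.exp (((ω₁ * r * Complex.I - δ * g₁ * r ^ 2 : ℂ)) * t) * y₁ 0‖
          ≤ C * K * (r ^ 3 * t + r) * Real.exp (-(a * t)) := by
  set ca : ℂ := g₁ / (-(2 * ω₁ * Complex.I)) with hca
  set cb : ℂ := g₂ / ((ω₂ - ω₁) * Complex.I) with hcb
  set cc : ℂ := g₂ / (-((ω₁ + ω₂) * Complex.I)) with hcc
  set W : ℝ := ‖ca‖ + ‖cb‖ + ‖cc‖ with hW
  have hW0 : 0 ≤ W := by positivity
  set T : ℝ := 2 * |g₁| + 2 * |g₂| with hT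
  have hT0 : 0 ≤ T := by positivity
  have eI : Complex.I ≠ 0 := Complex.I_ne_zero
  have ea : ca * (-(2 * ω₁ * Complex.I)) = g₁ := by
    rw [hca, div_mul_cancel₀]
    simp [h1]
  have eb : cb * ((ω₂ - ω₁) * Complex.I) = g₂ := by
    rw [hcb, div_mul_cancel₀]
    have : (ω₂ : ℂ) - ω₁ ≠ 0 := by
      rw [sub_ne_zero]; exact_mod_cast h12.symm
    exact mul_ne_zero this eI
  have ec : cc * (-((ω₁ + ω₂) * Complex.I)) = g₂ := by
    rw [hcc, div_mul_cancel₀]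
    have : (ω₁ : ℂ) + ω₂ ≠ 0 := by exact_mod_cast h12'
    exact neg_ne_zero.2 (mul_ne_zero this eI)
  refine ⟨δ ^ 2 * (|g₁| * W + T * W) + 2 * |δ| * W + 1, by positivity, ?_⟩
  intro r a K y₁ y₂ θ hr ha hK hy₁ hy₂ hθ hb₁ hb₂ t ht
  set w : ℝ → ℂ := fun t => ca * conj (y₁ t) + cb * y₂ t + cc * conj (y₂ t) with hw
  set z : ℝ → ℂ := fun t => y₁ t + δ * r * w t with hz
  set l : ℂ := ω₁ * r * Complex.I - δ * g₁ * r ^ 2 with hl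
  set R : ℝ → ℂ := fun t => δ ^ 2 * r ^ 3 * (g₁ * w t - θ t * (ca + cb + cc)) with hR
  have hconj : ∀ {y : ℝ → ℂ} {y' : ℂ} {t : ℝ}, HasDerivAt y y' t →
      HasDerivAt (fun t => conj (y t)) (conj y') t := fun h => by
    simpa using! (Complex.conjCLE : ℂ →L[ℝ] ℂ).hasFDerivAt.comp_hasDerivAt _ h
  have hzd : ∀ t, HasDerivAt z (l * z t + R t) t := by
    intro t
    have := (hy₁ t).add (((((hconj (hy₁ t)).const_mul ca).add ((hy₂ t).const_mul cb)).add
      ((hconj (hy₂ t)).const_mul cc)).const_mul (δ * r : ℂ))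
    refine this.congr_deriv ?_
    simp only [map_sub, map_mul, Complex.conj_ofReal, Complex.conj_I, map_pow]
    simp only [hz, hR, hl, hw]
    linear_combination (δ * r ^ 2 * conj (y₁ t)) * ea + (δ * r ^ 2 * y₂ t) * eb
      + (δ * r ^ 2 * conj (y₂ t)) * ec - δ * r ^ 2 * hθ t
  have hwb : ∀ t, 0 ≤ t → ‖w t‖ ≤ W * (K * Real.exp (-(a * t))) := by
    intro t ht
    have n1 := hb₁ t ht
    have n2 := hb₂ t ht
    calc ‖w t‖ ≤ ‖ca * conj (y₁ t)‖ + ‖cb * y₂ t‖ + ‖cc * conj (y₂ t)‖ := norm_add₃_le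
      _ = ‖ca‖ * ‖y₁ t‖ + ‖cb‖ * ‖y₂ t‖ + ‖cc‖ * ‖y₂ t‖ := by simp
      _ ≤ ‖ca‖ * (K * Real.exp (-(a * t))) + ‖cb‖ * (K * Real.exp (-(a * t)))
          + ‖cc‖ * (K * Real.exp (-(a * t))) := by gcongr
      _ = _ := by rw [hW]; ring
  have hθb : ∀ t, 0 ≤ t → ‖(θ t : ℂ)‖ ≤ T * (K * Real.exp (-(a * t))) := by
    intro t ht
    have n1 := hb₁ t ht
    have n2 := hb₂ t ht
    rw [hθ t]
    calc _ ≤ ‖(g₁ : ℂ) * (y₁ t + conj (y₁ t))‖ + ‖(g₂ : ℂ) * (y₂ t + conj (y₂ t))‖ :=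
          norm_add_le _ _
      _ ≤ |g₁| * (‖y₁ t‖ + ‖y₁ t‖) + |g₂| * (‖y₂ t‖ + ‖y₂ t‖) := by
          rw [norm_mul, norm_mul, Complex.norm_real, Complex.norm_real, Real.norm_eq_abs,
            Real.norm_eq_abs]
          gcongr
          · exact (norm_add_le _ _).trans (by simp)
          · exact (norm_add_le _ _).trans (by simp)
      _ ≤ |g₁| * (K * Real.exp (-(a * t)) + K * Real.exp (-(a * t)))
          + |g₂| * (K * Real.exp (-(a * t)) + K * Real.exp (-(a * t))) := by gcongr
      _ = _ := by rw [hT]; ring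
  have hRb : ∀ t, 0 ≤ t → ‖R t‖ ≤ (δ ^ 2 * (|g₁| * W + T * W) * K * r ^ 3) * Real.exp (-(a * t)) := by
    intro t ht
    have n1 := hwb t ht
    have n2 := hθb t ht
    have n3 : ‖ca + cb + cc‖ ≤ W := norm_add₃_le
    have e0 : ‖((δ : ℂ) ^ 2 * r ^ 3)‖ = δ ^ 2 * r ^ 3 := by
      rw [norm_mul, norm_pow, norm_pow, Complex.norm_real, Complex.norm_real, Real.norm_eq_abs,
        Real.norm_eq_abs, sq_abs, abs_of_nonneg hr]
    calc ‖R t‖ = δ ^ 2 * r ^ 3 * ‖g₁ * w t - θ t * (ca + cb + cc)‖ := by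
          simp only [hR]; rw [norm_mul, e0]
      _ ≤ δ ^ 2 * r ^ 3 * (|g₁| * ‖w t‖ + ‖(θ t : ℂ)‖ * ‖ca + cb + cc‖) := by
          gcongr
          refine (norm_sub_le _ _).trans ?_
          rw [norm_mul, norm_mul, Complex.norm_real g₁, Real.norm_eq_abs]
      _ ≤ δ ^ 2 * r ^ 3 * (|g₁| * (W * (K * Real.exp (-(a * t))))
            + (T * (K * Real.exp (-(a * t)))) * W) := by gcongr
      _ = _ := by ring
  have hlre : l.re = -(δ * g₁ * r ^ 2) := by
    simp [hl, pow_two]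
  have hmain := norm_sub_exp_mul_le hzd (a := a) (by rw [hlre]; linarith) hRb (by positivity) ht
  have hexp : ‖Complex.exp (l * t)‖ ≤ Real.exp (-(a * t)) := by
    rw [Complex.norm_exp]
    have e1 : (l * (t : ℂ)).re = l.re * t := by simp
    rw [e1, hlre]
    have := mul_le_mul_of_nonneg_right ha ht
    gcongr; linarith
  have hdec : y₁ t - Complex.exp (l * t) * y₁ 0
      = (z t - Complex.exp (l * t) * z 0) - δ * r * w t + Complex.exp (l * t) * (δ * r * w 0) := by
    simp only [hz]; ring
  have hδr : ‖(δ : ℂ) * r‖ = |δ| * r := by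
    rw [norm_mul, Complex.norm_real, Complex.norm_real, Real.norm_eq_abs, Real.norm_eq_abs,
      abs_of_nonneg hr]
  have hw0 := hwb 0 le_rfl
  simp only [mul_zero, neg_zero, Real.exp_zero, mul_one] at hw0
  rw [hdec]
  set E := Real.exp (-(a * t)) with hE
  have hE0 : 0 < E := Real.exp_pos _
  calc _ ≤ ‖z t - Complex.exp (l * t) * z 0‖ + ‖(δ : ℂ) * r * w t‖
        + ‖Complex.exp (l * t) * (δ * r * w 0)‖ := norm_add_le_of_le (norm_sub_le _ _) le_rfl
    _ ≤ (δ ^ 2 * (|g₁| * W + T * W) * K * r ^ 3) * t * E + |δ| * r * (W * (K * E))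
        + E * (|δ| * r * (W * K)) := by
        gcongr
        · rw [norm_mul, hδr]; gcongr; exact hwb t ht
        · rw [norm_mul, norm_mul _ (w 0), hδr]; gcongr
    _ = (δ ^ 2 * (|g₁| * W + T * W)) * (K * (r ^ 3 * t) * E) + (2 * |δ| * W) * (K * r * E) := by ring
    _ ≤ (δ ^ 2 * (|g₁| * W + T * W) + 2 * |δ| * W + 1) * (K * (r ^ 3 * t) * E)
        + (δ ^ 2 * (|g₁| * W + T * W) + 2 * |δ| * W + 1) * (K * r * E) := by
        have p1 : 0 ≤ δ ^ 2 * (|g₁| * W + T * W) := by positivity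
        have p2 : 0 ≤ 2 * |δ| * W := by positivity
        gcongr <;> linarith
    _ = _ := by ring

end NormalForm

section Waves

open ComplexConjugate

variable {b κ γ δ r : ℝ} {A Z θ s : ℝ → ℝ}

/-- The amplitude of the undamped wave of speed `ω`, normalised so that `θ` enters with
coefficient `1`. -/
noncomputable def waveMode (b κ γ ω : ℝ) (A Z θ s : ℝ) : ℂ :=
  ((θ + γ * b / (ω ^ 2 - b ^ 2) * Z : ℝ) : ℂ)
    + ((-(γ * ω / (ω ^ 2 - b ^ 2)) * A - √κ / ω * s : ℝ) : ℂ) * Complex.I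

/-- Without damping, the amplitude of a wave rotates with the frequency `ω r` if `ω` is one of the
two speeds. -/
lemma ModeSystem.hasDerivAt_waveMode (h : ModeSystem b κ γ δ r A Z θ s) (hκ : 0 < κ) {ω : ℝ}
    (hω : ω ≠ 0) (hωb : ω ^ 2 - b ^ 2 ≠ 0)
    (hchar : γ ^ 2 * ω ^ 2 + κ * (ω ^ 2 - b ^ 2) = ω ^ 2 * (ω ^ 2 - b ^ 2)) (t : ℝ) :
    HasDerivAt (fun t => waveMode b κ γ ω (A t) (Z t) (θ t) (s t))
      (ω * r * Complex.I * waveMode b κ γ ω (A t) (Z t) (θ t) (s t) - δ * r ^ 2 * θ t) t := by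
  have h1 := ((h.hθ t).add ((h.hZ t).const_mul (γ * b / (ω ^ 2 - b ^ 2)))).ofReal_comp
  have h2 := (((h.hA t).const_mul (-(γ * ω / (ω ^ 2 - b ^ 2)))).sub
    ((h.hs t).const_mul (√κ / ω))).ofReal_comp.mul_const Complex.I
  refine (h1.add h2).congr_deriv ?_
  have hsq : √κ * √κ = κ := Real.mul_self_sqrt hκ.le
  have e1 : r * (γ * A t + √κ * s t) - δ * r ^ 2 * θ t + γ * b / (ω ^ 2 - b ^ 2) * (r * (b * A t))
      = -(ω * r * (-(γ * ω / (ω ^ 2 - b ^ 2)) * A t - √κ / ω * s t)) - δ * r ^ 2 * θ t := by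
    field_simp; ring
  have e2 : -(γ * ω / (ω ^ 2 - b ^ 2)) * (r * (-b * Z t - γ * θ t)) - √κ / ω * -(r * (√κ * θ t))
      = ω * r * (θ t + γ * b / (ω ^ 2 - b ^ 2) * Z t) := by
    have : √κ / ω * -(r * (√κ * θ t)) = -(κ / ω * (r * θ t)) := by
      linear_combination (-(r * θ t) / ω) * hsq
    rw [this]
    field_simp
    linear_combination (θ t * r) * hchar
  rw [e1, e2]
  unfold waveMode
  push_cast
  linear_combination (-(ω * r * (-(γ * ω / (ω ^ 2 - b ^ 2)) * A t - √κ / ω * s t)) : ℂ)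
    * Complex.I_sq

lemma waveMode_add_conj (b κ γ ω A Z θ s : ℝ) :
    waveMode b κ γ ω A Z θ s + conj (waveMode b κ γ ω A Z θ s)
      = ((2 * (θ + γ * b / (ω ^ 2 - b ^ 2) * Z) : ℝ) : ℂ) := by
  unfold waveMode
  simp only [map_add, map_mul, Complex.conj_ofReal, Complex.conj_I]
  push_cast; ring

lemma exists_norm_waveMode_le (b κ γ ω : ℝ) : ∃ C : ℝ, 0 < C ∧ ∀ A Z θ s : ℝ,
    ‖waveMode b κ γ ω A Z θ s‖ ≤ C * √(A ^ 2 + Z ^ 2 + θ ^ 2 + s ^ 2) := by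
  refine ⟨1 + |γ * b / (ω ^ 2 - b ^ 2)| + |γ * ω / (ω ^ 2 - b ^ 2)| + |√κ / ω|, by positivity, ?_⟩
  intro A Z θ s
  set N := √(A ^ 2 + Z ^ 2 + θ ^ 2 + s ^ 2) with hN
  have hA : |A| ≤ N := Real.abs_le_sqrt (by linarith [sq_nonneg Z, sq_nonneg θ, sq_nonneg s])
  have hZ : |Z| ≤ N := Real.abs_le_sqrt (by linarith [sq_nonneg A, sq_nonneg θ, sq_nonneg s])
  have hθ : |θ| ≤ N := Real.abs_le_sqrt (by linarith [sq_nonneg Z, sq_nonneg A, sq_nonneg s])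
  have hs : |s| ≤ N := Real.abs_le_sqrt (by linarith [sq_nonneg Z, sq_nonneg θ, sq_nonneg A])
  have h1 : |θ + γ * b / (ω ^ 2 - b ^ 2) * Z| ≤ N + |γ * b / (ω ^ 2 - b ^ 2)| * N := by
    refine (abs_add_le _ _).trans ?_
    rw [abs_mul]; gcongr
  have h2 : |-(γ * ω / (ω ^ 2 - b ^ 2)) * A - √κ / ω * s|
      ≤ |γ * ω / (ω ^ 2 - b ^ 2)| * N + |√κ / ω| * N := by
    refine (abs_sub _ _).trans ?_
    rw [abs_mul, abs_mul, abs_neg]; gcongr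
  unfold waveMode
  refine (norm_add_le _ _).trans ?_
  rw [norm_mul, Complex.norm_I, mul_one, Complex.norm_real, Complex.norm_real, Real.norm_eq_abs,
    Real.norm_eq_abs]
  linarith

/-- The two waves recombine to the temperature. -/
lemma eq_waveMode_add_waveMode (hb : 0 < b) (hκ : 0 < κ) (hγ : γ ≠ 0) (hδ : 0 < δ)
    (A Z θ s : ℝ) :
    (θ : ℂ) = ((c₁ b κ γ δ / δ : ℝ) : ℂ) * (waveMode b κ γ (ν₁ b κ γ) A Z θ s
        + conj (waveMode b κ γ (ν₁ b κ γ) A Z θ s))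
      + ((c₂ b κ γ δ / δ : ℝ) : ℂ) * (waveMode b κ γ (ν₂ b κ γ) A Z θ s
        + conj (waveMode b κ γ (ν₂ b κ γ) A Z θ s)) := by
  rw [waveMode_add_conj, waveMode_add_conj]
  norm_cast
  have h1 := c_div_add_c_div (δ := δ) hb hκ hγ
  have h2 := c₁_add_c₂ b κ γ δ
  have e : c₁ b κ γ δ / δ * (2 * (θ + γ * b / (ν₁ b κ γ ^ 2 - b ^ 2) * Z))
      + c₂ b κ γ δ / δ * (2 * (θ + γ * b / (ν₂ b κ γ ^ 2 - b ^ 2) * Z))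
      = 2 / δ * (c₁ b κ γ δ + c₂ b κ γ δ) * θ + 2 / δ * γ * b * Z *
        (c₁ b κ γ δ / (ν₁ b κ γ ^ 2 - b ^ 2) + c₂ b κ γ δ / (ν₂ b κ γ ^ 2 - b ^ 2)) := by
    ring
  rw [e, h1, h2]; field_simp; ring

lemma re_exp_mul_neg_I (ω c r t q : ℝ) :
    (Complex.exp (((ω * r * Complex.I - c * r ^ 2 : ℂ)) * t) * (((-q : ℝ) : ℂ) * Complex.I)).re
      = q * (Real.sin (ω * r * t) * Real.exp (-c * r ^ 2 * t)) := by
  have : ((ω * r * Complex.I - c * r ^ 2 : ℂ)) * t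
      = ((-c * r ^ 2 * t : ℝ) : ℂ) + ((ω * r * t : ℝ) : ℂ) * Complex.I := by
    push_cast; ring
  rw [this, Complex.exp_add, ← Complex.ofReal_exp, Complex.exp_mul_I, ← Complex.ofReal_cos,
    ← Complex.ofReal_sin]
  simp only [Complex.mul_re, Complex.mul_im, Complex.add_re, Complex.add_im, Complex.ofReal_re,
    Complex.ofReal_im, Complex.I_re, Complex.I_im]
  ring

/-- At low frequencies the temperature produced by an initial heat flux is the double diffusion wave,
up to an error which is smaller by a factor `r`. -/
lemma exists_mode_profile (hb : 0 < b) (hκ : 0 < κ) (hγ : γ ≠ 0) (hδ : 0 < δ) :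
    ∃ C c : ℝ, 0 < C ∧ 0 < c ∧ ∀ (r : ℝ) (A Z θ s : ℝ → ℝ), 0 < r → r ≤ 1 →
      ModeSystem b κ γ δ r A Z θ s → A 0 = 0 → Z 0 = 0 → θ 0 = 0 →
      ∀ t, 0 ≤ t → |θ t - √κ * r * s 0 * profileSymbol b κ γ δ t r|
        ≤ C * r * Real.exp (-(c * r ^ 2 * t)) * |s 0| := by
  obtain ⟨C₀, c₀, hC₀, hc₀, hdecay⟩ := exists_mode_decay hb hκ hγ hδ
  have hν₁ := ν₁_pos (γ := γ) hb hκ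
  have hν₂ := ν₂_pos (γ := γ) hb hκ
  have hν := ν₂_lt_ν₁ hb hκ hγ
  have hc₁ := c₁_pos (κ := κ) hb hγ hδ
  have hc₂ := c₂_pos (κ := κ) hb hγ hδ
  set ω₁ := ν₁ b κ γ with hω₁
  set ω₂ := ν₂ b κ γ with hω₂
  set d₁ := c₁ b κ γ δ with hd₁
  set d₂ := c₂ b κ γ δ with hd₂
  obtain ⟨K₁, hK₁, hw₁⟩ := exists_norm_waveMode_le b κ γ ω₁
  obtain ⟨K₂, hK₂, hw₂⟩ := exists_norm_waveMode_le b κ γ ω₂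
  obtain ⟨M₁, hM₁, ho₁⟩ := exists_oscillator_approx (ω₁ := ω₁) (ω₂ := ω₂) hν₁.ne' hν.ne'
    (by positivity) (d₁ / δ) (d₂ / δ) δ
  obtain ⟨M₂, hM₂, ho₂⟩ := exists_oscillator_approx (ω₁ := ω₂) (ω₂ := ω₁) hν₂.ne' hν.ne
    (by positivity) (d₂ / δ) (d₁ / δ) δ
  set a₀ : ℝ := min (c₀ / 4) (min d₁ d₂) with ha₀
  have ha₀pos : 0 < a₀ := by rw [ha₀]; positivity
  set K₀ : ℝ := (K₁ + K₂) * √C₀ with hK₀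
  have hK₀pos : 0 < K₀ := by positivity
  set G : ℝ := 2 * (d₁ / δ) * M₁ + 2 * (d₂ / δ) * M₂ with hG
  have hGpos : 0 < G := by positivity
  refine ⟨G * K₀ * (2 / a₀ + 1), a₀ / 2, by positivity, by positivity, ?_⟩
  intro r A Z θ s hr hr1 h hA0 hZ0 hθ0 t ht
  set y₁ : ℝ → ℂ := fun t => waveMode b κ γ ω₁ (A t) (Z t) (θ t) (s t) with hy₁
  set y₂ : ℝ → ℂ := fun t => waveMode b κ γ ω₂ (A t) (Z t) (θ t) (s t) with hy₂
  have hN : ∀ t, 0 ≤ t → √(A t ^ 2 + Z t ^ 2 + θ t ^ 2 + s t ^ 2)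
      ≤ √C₀ * |s 0| * Real.exp (-(a₀ * r ^ 2 * t)) := by
    intro t ht
    have h1 := hdecay r A Z θ s h t ht
    rw [hA0, hZ0, hθ0] at h1
    have h2 : Real.exp (-(c₀ * (r ^ 2 / (1 + r ^ 2)) * t)) ≤ Real.exp (-(a₀ * r ^ 2 * t)) ^ 2 := by
      rw [← Real.exp_nat_mul]
      gcongr
      have : r ^ 2 / 2 ≤ r ^ 2 / (1 + r ^ 2) := by gcongr; nlinarith
      have h3 : a₀ ≤ c₀ / 4 := min_le_left _ _
      have h4 : 2 * a₀ * r ^ 2 ≤ c₀ * (r ^ 2 / (1 + r ^ 2)) := by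
        calc 2 * a₀ * r ^ 2 ≤ 2 * (c₀ / 4) * r ^ 2 := by gcongr
          _ = c₀ * (r ^ 2 / 2) := by ring
          _ ≤ _ := by gcongr
      have := mul_le_mul_of_nonneg_right h4 ht
      push_cast
      linarith
    refine Real.sqrt_le_iff.2 ⟨by positivity, h1.trans ?_⟩
    rw [mul_pow, mul_pow, Real.sq_sqrt hC₀.le, sq_abs]
    calc _ = C₀ * s 0 ^ 2 * Real.exp (-(c₀ * (r ^ 2 / (1 + r ^ 2)) * t)) := by ring
      _ ≤ _ := by gcongr
  have hyb₁ : ∀ t, 0 ≤ t → ‖y₁ t‖ ≤ K₀ * |s 0| * Real.exp (-(a₀ * r ^ 2 * t)) := fun t ht => by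
    calc ‖y₁ t‖ ≤ K₁ * (√C₀ * |s 0| * Real.exp (-(a₀ * r ^ 2 * t))) := by
          refine (hw₁ _ _ _ _).trans ?_
          gcongr; exact hN t ht
      _ ≤ (K₁ + K₂) * (√C₀ * |s 0| * Real.exp (-(a₀ * r ^ 2 * t))) := by gcongr; linarith
      _ = _ := by rw [hK₀]; ring
  have hyb₂ : ∀ t, 0 ≤ t → ‖y₂ t‖ ≤ K₀ * |s 0| * Real.exp (-(a₀ * r ^ 2 * t)) := fun t ht => by
    calc ‖y₂ t‖ ≤ K₂ * (√C₀ * |s 0| * Real.exp (-(a₀ * r ^ 2 * t))) := by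
          refine (hw₂ _ _ _ _).trans ?_
          gcongr; exact hN t ht
      _ ≤ (K₁ + K₂) * (√C₀ * |s 0| * Real.exp (-(a₀ * r ^ 2 * t))) := by gcongr; linarith
      _ = _ := by rw [hK₀]; ring
  have hyd₁ := h.hasDerivAt_waveMode hκ hν₁.ne' (ν₁_sq_sub_ne hb hκ hγ) (ν₁_char hb hκ)
  have hyd₂ := h.hasDerivAt_waveMode hκ hν₂.ne' (ν₂_sq_sub_ne hb hκ hγ) (ν₂_char hb hκ)
  have hsplit : ∀ t, (θ t : ℂ) = ((d₁ / δ : ℝ) : ℂ) * (y₁ t + conj (y₁ t))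
      + ((d₂ / δ : ℝ) : ℂ) * (y₂ t + conj (y₂ t)) := fun t =>
    eq_waveMode_add_waveMode hb hκ hγ hδ _ _ _ _
  have hδd₁ : δ * (d₁ / δ) = d₁ := by field_simp
  have hδd₂ : δ * (d₂ / δ) = d₂ := by field_simp
  have h1 := ho₁ r (a₀ * r ^ 2) (K₀ * |s 0|) y₁ y₂ θ hr.le
    (by rw [hδd₁]; gcongr; exact (min_le_right _ _).trans (min_le_left _ _)) (by positivity)
    hyd₁ hyd₂ hsplit hyb₁ hyb₂ t ht
  have h2 := ho₂ r (a₀ * r ^ 2) (K₀ * |s 0|) y₂ y₁ θ hr.le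
    (by rw [hδd₂]; gcongr; exact (min_le_right _ _).trans (min_le_right _ _)) (by positivity)
    hyd₂ hyd₁ (fun t => by rw [hsplit t, add_comm]) hyb₂ hyb₁ t ht
  have hδc₁ : (δ : ℂ) * ((d₁ / δ : ℝ) : ℂ) = (d₁ : ℂ) := by exact_mod_cast hδd₁
  have hδc₂ : (δ : ℂ) * ((d₂ / δ : ℝ) : ℂ) = (d₂ : ℂ) := by exact_mod_cast hδd₂
  rw [hδc₁] at h1
  rw [hδc₂] at h2
  have hy₁0 : y₁ 0 = ((-(√κ / ω₁ * s 0) : ℝ) : ℂ) * Complex.I := by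
    simp only [hy₁, waveMode, hA0, hZ0, hθ0]; push_cast; ring
  have hy₂0 : y₂ 0 = ((-(√κ / ω₂ * s 0) : ℝ) : ℂ) * Complex.I := by
    simp only [hy₂, waveMode, hA0, hZ0, hθ0]; push_cast; ring
  rw [hy₁0] at h1
  rw [hy₂0] at h2
  have h1' := (Complex.abs_re_le_norm _).trans h1
  have h2' := (Complex.abs_re_le_norm _).trans h2
  rw [Complex.sub_re, re_exp_mul_neg_I] at h1' h2'
  have hθre : θ t = 2 * (d₁ / δ) * (y₁ t).re + 2 * (d₂ / δ) * (y₂ t).re := by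
    have := congrArg Complex.re (hsplit t)
    simp only [Complex.ofReal_re, Complex.add_re, Complex.re_ofReal_mul, Complex.conj_re] at this
    rw [this]; ring
  have hdiff : θ t - √κ * r * s 0 * profileSymbol b κ γ δ t r
      = 2 * (d₁ / δ) * ((y₁ t).re - √κ / ω₁ * s 0 * (Real.sin (ω₁ * r * t)
          * Real.exp (-d₁ * r ^ 2 * t)))
        + 2 * (d₂ / δ) * ((y₂ t).re - √κ / ω₂ * s 0 * (Real.sin (ω₂ * r * t)
          * Real.exp (-d₂ * r ^ 2 * t))) := by
    rw [hθre, profileSymbol_eq hb hγ hδ]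
    simp only [← hω₁, ← hω₂, ← hd₁, ← hd₂]
    field_simp
    ring
  rw [hdiff]
  set E := Real.exp (-(a₀ * r ^ 2 * t)) with hE
  -- `x e^{-x} ≤ 2 e^{-x/2}` absorbs the secular factor `r² t`
  have hsec : (r ^ 3 * t + r) * E ≤ (2 / a₀ + 1) * r * Real.exp (-(a₀ / 2 * r ^ 2 * t)) := by
    set F := Real.exp (-(a₀ / 2 * r ^ 2 * t)) with hF
    have hF0 : 0 < F := Real.exp_pos _
    have hEF : E = F * F := by rw [hE, hF, ← Real.exp_add]; ring_nf
    have hF1 : F ≤ 1 := Real.exp_le_one_iff.2 (by have : 0 ≤ a₀ / 2 * r ^ 2 * t := by positivity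
                                                  linarith)
    have hx : (a₀ / 2 * r ^ 2 * t) * F ≤ 1 := by
      have := Real.add_one_le_exp (a₀ / 2 * r ^ 2 * t)
      have h3 : Real.exp (a₀ / 2 * r ^ 2 * t) * F = 1 := by rw [hF, ← Real.exp_add]; simp
      calc (a₀ / 2 * r ^ 2 * t) * F ≤ Real.exp (a₀ / 2 * r ^ 2 * t) * F := by gcongr; linarith
        _ = 1 := h3
    have hy : r ^ 2 * t * F ≤ 2 / a₀ := by
      rw [le_div_iff₀ ha₀pos]; linarith
    calc (r ^ 3 * t + r) * E = r * F * (r ^ 2 * t * F + F) := by rw [hEF]; ring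
      _ ≤ r * F * (2 / a₀ + 1) := by gcongr
      _ = _ := by ring
  calc _ ≤ 2 * (d₁ / δ) * |(y₁ t).re - √κ / ω₁ * s 0 * (Real.sin (ω₁ * r * t)
          * Real.exp (-d₁ * r ^ 2 * t))|
        + 2 * (d₂ / δ) * |(y₂ t).re - √κ / ω₂ * s 0 * (Real.sin (ω₂ * r * t)
          * Real.exp (-d₂ * r ^ 2 * t))| := by
        refine (abs_add_le _ _).trans (add_le_add ?_ ?_)
        · rw [abs_mul, abs_of_pos (by positivity)]
        · rw [abs_mul, abs_of_pos (by positivity)]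
    _ ≤ 2 * (d₁ / δ) * (M₁ * (K₀ * |s 0|) * (r ^ 3 * t + r) * E)
        + 2 * (d₂ / δ) * (M₂ * (K₀ * |s 0|) * (r ^ 3 * t + r) * E) := by gcongr
    _ = G * K₀ * |s 0| * ((r ^ 3 * t + r) * E) := by rw [hG]; ring
    _ ≤ G * K₀ * |s 0| * ((2 / a₀ + 1) * r * Real.exp (-(a₀ / 2 * r ^ 2 * t))) := by gcongr
    _ = _ := by ring

end Waves

/-! ### The full system at one frequency -/

/-- The state `(û, û_t, θ̂, q̂)` of the system at one frequency, where
`q = θ_t + γ div u_t - δ Δ θ`, so that the second equation reads `q_t = κ Δ θ`. -/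
abbrev Phase (n : ℕ) : Type :=
  EuclideanSpace ℂ (Fin n) × EuclideanSpace ℂ (Fin n) × ℂ × ℂ

/-- The bilinear product `k · v` of a real wave vector with a complex vector. -/
noncomputable def dotC {n : ℕ} (k : Space n) : EuclideanSpace ℂ (Fin n) →ₗ[ℂ] ℂ where
  toFun v := ∑ j, (k j : ℂ) * v j
  map_add' v w := by simp [mul_add, Finset.sum_add_distrib]
  map_smul' c v := by simp [Finset.mul_sum, mul_left_comm]

/-- The wave vector as a complex vector. -/
noncomputable def vecC {n : ℕ} (k : Space n) : EuclideanSpace ℂ (Fin n) :=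
  WithLp.toLp 2 fun j => (k j : ℂ)

section Generator

variable {n : ℕ} {b κ γ δ : ℝ}

lemma dotC_apply (k : Space n) (v : EuclideanSpace ℂ (Fin n)) :
    dotC k v = ∑ j, (k j : ℂ) * v j := rfl

lemma norm_vecC (k : Space n) : ‖vecC k‖ = ‖k‖ := by
  simp [vecC, EuclideanSpace.norm_eq]

lemma inner_vecC (k : Space n) (v : EuclideanSpace ℂ (Fin n)) : inner ℂ (vecC k) v = dotC k v := by
  simp [dotC_apply, vecC, PiLp.inner_apply, mul_comm]

lemma inner_real_eq_re (v w : EuclideanSpace ℂ (Fin n)) : inner ℝ v w = (inner ℂ v w).re := by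
  simp only [PiLp.inner_apply, Complex.re_sum, Complex.inner, RCLike.inner_apply]

lemma norm_dotC_le (k : Space n) (v : EuclideanSpace ℂ (Fin n)) : ‖dotC k v‖ ≤ ‖k‖ * ‖v‖ := by
  rw [← inner_vecC, ← norm_vecC]; exact norm_inner_le_norm _ _

lemma dotC_vecC (k : Space n) : dotC k (vecC k) = (‖k‖ : ℂ) ^ 2 := by
  rw [← inner_vecC, inner_self_eq_norm_sq_to_K, norm_vecC]; rfl

/-- The generator at the wave vector `k`, on the state `(û, û_t, θ̂, q̂)`. -/
noncomputable def gen (b κ γ δ : ℝ) (k : Space n) : Phase n →L[ℂ] Phase n :=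
  LinearMap.toContinuousLinearMap
    { toFun := fun X => (X.2.1, -((b ^ 2 * ‖k‖ ^ 2 : ℝ) : ℂ) • X.1 - (γ * Complex.I * X.2.2.1) • vecC k,
        X.2.2.2 - (δ * ‖k‖ ^ 2 : ℝ) * X.2.2.1 - γ * Complex.I * dotC k X.2.1,
        -(((κ * ‖k‖ ^ 2 : ℝ) : ℂ) * X.2.2.1))
      map_add' := fun X Y => by
        ext1
        · simp
        · ext1
          · simp only [Prod.snd_add, Prod.fst_add]; module
          · ext1
            · simp only [Prod.snd_add, Prod.fst_add, map_add]; ring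
            · simp only [Prod.snd_add, Prod.fst_add]; ring
      map_smul' := fun c X => by
        ext1
        · simp
        · ext1
          · simp only [Prod.smul_snd, Prod.smul_fst, RingHom.id_apply, smul_eq_mul]; module
          · ext1
            · simp only [Prod.smul_snd, Prod.smul_fst, RingHom.id_apply, smul_eq_mul, map_smul]
              ring
            · simp only [Prod.smul_snd, Prod.smul_fst, RingHom.id_apply, smul_eq_mul]; ring }

lemma gen_apply (k : Space n) (X : Phase n) : gen b κ γ δ k X =
    (X.2.1, -((b ^ 2 * ‖k‖ ^ 2 : ℝ) : ℂ) • X.1 - (γ * Complex.I * X.2.2.1) • vecC k,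
        X.2.2.2 - (δ * ‖k‖ ^ 2 : ℝ) * X.2.2.1 - γ * Complex.I * dotC k X.2.1,
        -(((κ * ‖k‖ ^ 2 : ℝ) : ℂ) * X.2.2.1)) := rfl

lemma continuous_vecC : Continuous (vecC : Space n → EuclideanSpace ℂ (Fin n)) := by
  unfold vecC
  fun_prop

lemma continuous_dotC : Continuous fun p : Space n × EuclideanSpace ℂ (Fin n) => dotC p.1 p.2 := by
  simp only [dotC_apply]
  fun_prop

lemma continuous_gen : Continuous (gen b κ γ δ : Space n → Phase n →L[ℂ] Phase n) := by
  rw [continuous_clm_apply]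
  intro X
  simp only [gen_apply]
  have h1 := continuous_vecC (n := n)
  have h2 : Continuous fun k : Space n => dotC k X.2.1 :=
    continuous_dotC.comp (continuous_id.prodMk continuous_const)
  fun_prop

/-- The evolution at the wave vector `k`. -/
noncomputable def flow (b κ γ δ : ℝ) (k : Space n) (t : ℝ) : Phase n →L[ℂ] Phase n :=
  NormedSpace.exp (t • gen b κ γ δ k)

lemma flow_zero (k : Space n) : flow b κ γ δ k 0 = 1 := by
  let _ : NormedAlgebra ℚ (Phase n →L[ℂ] Phase n) := NormedAlgebra.restrictScalars ℚ ℝ _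
  have h : (0 : ℝ) • gen b κ γ δ k = 0 :=
    ContinuousLinearMap.ext fun X => zero_smul ℝ (gen b κ γ δ k X)
  rw [flow, h, NormedSpace.exp_zero]

lemma continuous_flow (t : ℝ) :
    Continuous fun k : Space n => flow b κ γ δ k t := by
  let _ : NormedAlgebra ℚ (Phase n →L[ℂ] Phase n) := NormedAlgebra.restrictScalars ℚ ℝ _
  unfold flow
  exact (NormedSpace.exp_continuous).comp (continuous_gen.const_smul t)

lemma hasDerivAt_flow (k : Space n) (X : Phase n) (t : ℝ) :
    HasDerivAt (fun t => flow b κ γ δ k t X) (gen b κ γ δ k (flow b κ γ δ k t X)) t := by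
  have h := hasDerivAt_exp_smul_const' (𝕂 := ℝ) (gen b κ γ δ k) t
  exact ((ContinuousLinearMap.apply ℂ (Phase n) X).restrictScalars ℝ).hasFDerivAt.comp_hasDerivAt t h

/-- Crude growth bound for solutions at one frequency. -/
lemma norm_le_of_hasDerivAt_gen {k : Space n} {X : ℝ → Phase n}
    (hX : ∀ t, HasDerivAt X (gen b κ γ δ k (X t)) t) {t : ℝ} (ht : 0 ≤ t) :
    ‖X t‖ ≤ ‖X 0‖ * Real.exp (‖gen b κ γ δ k‖ * t) := by
  have h := norm_le_gronwallBound_of_norm_deriv_right_le (f := X)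
    (f' := fun t => gen b κ γ δ k (X t)) (δ := ‖X 0‖) (K := ‖gen b κ γ δ k‖) (ε := 0) (a := 0)
    (b := t) (fun s _ => (hX s).continuousAt.continuousWithinAt)
    (fun s _ => (hX s).hasDerivWithinAt) le_rfl
    (fun s _ => by rw [add_zero]; exact ContinuousLinearMap.le_opNorm _ _) t ⟨ht, le_rfl⟩
  rwa [gronwallBound_ε0, sub_zero] at h

/-- The energy at the wave vector `k`, written for the state `(û, û_t, θ̂, q̂)`. -/
noncomputable def phaseEnergy (b κ : ℝ) (k : Space n) (X : Phase n) : ℝ :=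
  ‖X.2.1‖ ^ 2 + b ^ 2 * ‖k‖ ^ 2 * ‖X.1‖ ^ 2 + ‖X.2.2.1‖ ^ 2 + ‖X.2.2.2‖ ^ 2 / (κ * ‖k‖ ^ 2)

/-- The energy is dissipated at the rate `2 δ |k|² |θ̂|²`. -/
lemma antitone_phaseEnergy (hκ : 0 < κ) (hδ : 0 < δ) {k : Space n} (hk : k ≠ 0) {X : ℝ → Phase n}
    (hX : ∀ t, HasDerivAt X (gen b κ γ δ k (X t)) t) :
    Antitone fun t => phaseEnergy b κ k (X t) := by
  have hk' : 0 < ‖k‖ := norm_pos_iff.2 hk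
  have h1 : ∀ t, HasDerivAt (fun t => (X t).1) (X t).2.1 t := fun t => (hX t).fst
  have h2 : ∀ t, HasDerivAt (fun t => (X t).2.1) (gen b κ γ δ k (X t)).2.1 t :=
    fun t => (hX t).snd.fst
  have h3 : ∀ t, HasDerivAt (fun t => (X t).2.2.1) (gen b κ γ δ k (X t)).2.2.1 t :=
    fun t => (hX t).snd.snd.fst
  have h4 : ∀ t, HasDerivAt (fun t => (X t).2.2.2) (gen b κ γ δ k (X t)).2.2.2 t :=
    fun t => (hX t).snd.snd.snd
  have hd := fun t => (((h2 t).norm_sq.add ((h1 t).norm_sq.const_mul (b ^ 2 * ‖k‖ ^ 2))).add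
    (h3 t).norm_sq).add ((h4 t).norm_sq.div_const (κ * ‖k‖ ^ 2))
  refine antitone_of_hasDerivAt_nonpos hd fun t => ?_
  obtain ⟨u, p, θ, q⟩ := X t
  simp only [gen_apply, Pi.zero_apply]
  have e0 : inner ℝ p (-((b ^ 2 * ‖k‖ ^ 2 : ℝ) : ℂ) • u - (γ * Complex.I * θ) • vecC k)
      = -(b ^ 2 * ‖k‖ ^ 2) * inner ℝ u p - ((γ * Complex.I * θ) * (starRingEnd ℂ) (dotC k p)).re := by
    rw [inner_real_eq_re, inner_sub_right, inner_smul_right, inner_smul_right,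
      ← inner_conj_symm p (vecC k), inner_vecC, inner_real_eq_re, ← inner_conj_symm u p]
    simp only [Complex.sub_re, ← Complex.ofReal_neg, Complex.re_ofReal_mul, Complex.conj_re]
  have e1 : inner ℝ q (-(((κ * ‖k‖ ^ 2 : ℝ) : ℂ) * θ)) = -(κ * ‖k‖ ^ 2) * inner ℝ θ q := by
    have : -(((κ * ‖k‖ ^ 2 : ℝ) : ℂ) * θ) = (-(κ * ‖k‖ ^ 2) : ℝ) • θ := by
      rw [Complex.real_smul]; push_cast; ring
    rw [this, real_inner_smul_right, real_inner_comm]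
  have e2 : inner ℝ θ (q - (δ * ‖k‖ ^ 2 : ℝ) * θ - γ * Complex.I * dotC k p)
      = inner ℝ θ q - δ * ‖k‖ ^ 2 * ‖θ‖ ^ 2
        + ((γ * Complex.I * θ) * (starRingEnd ℂ) (dotC k p)).re := by
    rw [inner_sub_right, inner_sub_right]
    have : inner ℝ θ (((δ * ‖k‖ ^ 2 : ℝ) : ℂ) * θ) = δ * ‖k‖ ^ 2 * ‖θ‖ ^ 2 := by
      rw [← Complex.real_smul, real_inner_smul_right, real_inner_self_eq_norm_sq]
    rw [this, Complex.inner θ (γ * Complex.I * dotC k p)]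
    simp [Complex.mul_re, Complex.mul_im]
    ring
  rw [e0, e1, e2]
  have e3 : (2 * (-(κ * ‖k‖ ^ 2) * inner ℝ θ q)) / (κ * ‖k‖ ^ 2) = -2 * inner ℝ θ q := by
    field_simp
  rw [e3]
  have : 0 ≤ δ * ‖k‖ ^ 2 * ‖θ‖ ^ 2 := by positivity
  linarith

/-- Bounds on all components at a nonzero frequency by the initial energy. -/
lemma energy_bounds (hb : 0 < b) (hκ : 0 < κ) (hδ : 0 < δ) {k : Space n} (hk : k ≠ 0)
    {X : ℝ → Phase n} (hX : ∀ t, HasDerivAt X (gen b κ γ δ k (X t)) t) {e : ℝ} (he : 0 ≤ e)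
    (h0 : phaseEnergy b κ k (X 0) ≤ e ^ 2) {t : ℝ} (ht : 0 ≤ t) :
    ‖(X t).2.1‖ ≤ e ∧ b * ‖k‖ * ‖(X t).1‖ ≤ e ∧ ‖(X t).2.2.1‖ ≤ e
      ∧ ‖(X t).2.2.2‖ ≤ √κ * ‖k‖ * e := by
  have h := (antitone_phaseEnergy hκ hδ hk hX ht).trans h0
  have hk' : 0 < ‖k‖ := norm_pos_iff.2 hk
  simp only [phaseEnergy] at h
  have p1 : 0 ≤ ‖(X t).2.1‖ ^ 2 := by positivity
  have p2 : 0 ≤ b ^ 2 * ‖k‖ ^ 2 * ‖(X t).1‖ ^ 2 := by positivity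
  have p3 : 0 ≤ ‖(X t).2.2.1‖ ^ 2 := by positivity
  have p4 : 0 ≤ ‖(X t).2.2.2‖ ^ 2 / (κ * ‖k‖ ^ 2) := by positivity
  refine ⟨?_, ?_, ?_, ?_⟩
  · exact (abs_le_of_sq_le_sq' (by linarith) he).2
  · exact (abs_le_of_sq_le_sq' (by rw [mul_pow, mul_pow]; linarith) he).2
  · exact (abs_le_of_sq_le_sq' (by linarith) he).2
  · refine (abs_le_of_sq_le_sq' ?_ (by positivity)).2
    have p5 : ‖(X t).2.2.2‖ ^ 2 / (κ * ‖k‖ ^ 2) ≤ e ^ 2 := by linarith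
    rw [div_le_iff₀ (by positivity)] at p5
    rw [mul_pow, mul_pow, Real.sq_sqrt hκ.le]
    linarith

end Generator

/-! ### Decay at one frequency -/

section ComplexModes

variable {n : ℕ} {b κ γ δ : ℝ}

/-- The longitudinal velocity, with the factor `-i` that makes the mode equations real. -/
noncomputable def modeA (k : Space n) (X : Phase n) : ℂ := -Complex.I * dotC k X.2.1 / ‖k‖

/-- The longitudinal strain, with the same factor `-i`, in the units of a velocity. -/
noncomputable def modeZ (b : ℝ) (k : Space n) (X : Phase n) : ℂ := -Complex.I * b * dotC k X.1

/-- The component `q̂`, in the units of the temperature. -/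
noncomputable def modeS (κ : ℝ) (k : Space n) (X : Phase n) : ℂ := X.2.2.2 / (√κ * ‖k‖)

/-- Real parts of the longitudinal variables satisfy the real mode system. -/
lemma modeSystem_re (hκ : 0 < κ) {k : Space n} (hk : k ≠ 0) {X : ℝ → Phase n}
    (hX : ∀ t, HasDerivAt X (gen b κ γ δ k (X t)) t) :
    ModeSystem b κ γ δ ‖k‖ (fun t => (modeA k (X t)).re) (fun t => (modeZ b k (X t)).re)
      (fun t => (X t).2.2.1.re) (fun t => (modeS κ k (X t)).re) := by
  have hk' : (‖k‖ : ℂ) ≠ 0 := by exact_mod_cast (norm_pos_iff.2 hk).ne'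
  have hκ' : ((√κ : ℝ) : ℂ) ≠ 0 := by exact_mod_cast (Real.sqrt_pos.2 hκ).ne'
  have hsq : ((√κ : ℝ) : ℂ) * ((√κ : ℝ) : ℂ) = (κ : ℂ) := by exact_mod_cast Real.mul_self_sqrt hκ.le
  have hdot : ∀ {f : ℝ → EuclideanSpace ℂ (Fin n)} {f' : EuclideanSpace ℂ (Fin n)} {t : ℝ},
      HasDerivAt f f' t → HasDerivAt (fun t => dotC k (f t)) (dotC k f') t := fun h =>
    (((dotC k).toContinuousLinearMap).restrictScalars ℝ).hasFDerivAt.comp_hasDerivAt _ h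
  have hre : ∀ {f : ℝ → ℂ} {f' : ℂ} {t : ℝ},
      HasDerivAt f f' t → HasDerivAt (fun t => (f t).re) f'.re t := fun h =>
    Complex.reCLM.hasFDerivAt.comp_hasDerivAt _ h
  have h1 : ∀ t, HasDerivAt (fun t => (X t).1) (X t).2.1 t := fun t => (hX t).fst
  have h2 : ∀ t, HasDerivAt (fun t => (X t).2.1) (gen b κ γ δ k (X t)).2.1 t :=
    fun t => (hX t).snd.fst
  have h3 : ∀ t, HasDerivAt (fun t => (X t).2.2.1) (gen b κ γ δ k (X t)).2.2.1 t :=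
    fun t => (hX t).snd.snd.fst
  have h4 : ∀ t, HasDerivAt (fun t => (X t).2.2.2) (gen b κ γ δ k (X t)).2.2.2 t :=
    fun t => (hX t).snd.snd.snd
  constructor
  · intro t
    refine (hre (((hdot (h2 t)).const_mul (-Complex.I)).div_const _)).congr_deriv ?_
    have : -Complex.I * dotC k (gen b κ γ δ k (X t)).2.1 / ‖k‖
        = ((‖k‖ : ℝ) : ℂ) * (((-b : ℝ) : ℂ) * modeZ b k (X t) - (γ : ℂ) * (X t).2.2.1) := by
      simp only [gen_apply, map_sub, map_smul, smul_eq_mul, dotC_vecC, modeZ]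
      field_simp
      push_cast
      linear_combination (γ * (X t).2.2.1 * ‖k‖ ^ 2) * Complex.I_sq
    rw [this]
    simp only [Complex.re_ofReal_mul, Complex.sub_re]
  · intro t
    refine (hre ((hdot (h1 t)).const_mul (-Complex.I * b))).congr_deriv ?_
    have : -Complex.I * b * dotC k (X t).2.1 = ((‖k‖ : ℝ) : ℂ) * ((b : ℂ) * modeA k (X t)) := by
      simp only [modeA]; field_simp
    rw [this]
    simp only [Complex.re_ofReal_mul]
  · intro t
    refine (hre (h3 t)).congr_deriv ?_
    have : (gen b κ γ δ k (X t)).2.2.1 = ((‖k‖ : ℝ) : ℂ) * ((γ : ℂ) * modeA k (X t)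
        + ((√κ : ℝ) : ℂ) * modeS κ k (X t)) - ((δ * ‖k‖ ^ 2 : ℝ) : ℂ) * (X t).2.2.1 := by
      simp only [gen_apply, modeA, modeS]
      field_simp
      ring
    rw [this]
    simp only [Complex.re_ofReal_mul, Complex.sub_re, Complex.add_re]
  · intro t
    refine (hre ((h4 t).div_const _)).congr_deriv ?_
    have : (gen b κ γ δ k (X t)).2.2.2 / (√κ * ‖k‖)
        = -(((‖k‖ : ℝ) : ℂ) * (((√κ : ℝ) : ℂ) * (X t).2.2.1)) := by
      simp only [gen_apply]
      rw [div_eq_iff (mul_ne_zero hκ' hk')]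
      push_cast
      linear_combination (-(‖k‖ ^ 2 * (X t).2.2.1) : ℂ) * (-hsq)
    rw [this]
    simp only [Complex.neg_re, Complex.re_ofReal_mul]

/-- The squared size of the longitudinal variables. -/
noncomputable def modeSq (b κ : ℝ) (k : Space n) (X : Phase n) : ℝ :=
  ‖modeA k X‖ ^ 2 + ‖modeZ b k X‖ ^ 2 + ‖X.2.2.1‖ ^ 2 + ‖modeS κ k X‖ ^ 2

lemma hasDerivAt_neg_I_smul {k : Space n} {X : ℝ → Phase n}
    (hX : ∀ t, HasDerivAt X (gen b κ γ δ k (X t)) t) (t : ℝ) :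
    HasDerivAt (fun t => (-Complex.I) • X t) (gen b κ γ δ k ((-Complex.I) • X t)) t := by
  rw [map_smul]; exact (hX t).const_smul (-Complex.I)

lemma modeA_neg_I (k : Space n) (X : Phase n) :
    (modeA k ((-Complex.I) • X)).re = (modeA k X).im := by
  have : modeA k ((-Complex.I) • X) = -Complex.I * modeA k X := by
    simp only [modeA, Prod.smul_snd, Prod.smul_fst, map_smul, smul_eq_mul]; ring
  rw [this]; simp

lemma modeZ_neg_I (k : Space n) (X : Phase n) :
    (modeZ b k ((-Complex.I) • X)).re = (modeZ b k X).im := by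
  have : modeZ b k ((-Complex.I) • X) = -Complex.I * modeZ b k X := by
    simp only [modeZ, Prod.smul_fst, map_smul, smul_eq_mul]; ring
  rw [this]; simp

lemma modeS_neg_I (k : Space n) (X : Phase n) :
    (modeS κ k ((-Complex.I) • X)).re = (modeS κ k X).im := by
  have : modeS κ k ((-Complex.I) • X) = -Complex.I * modeS κ k X := by
    simp only [modeS, Prod.smul_snd, smul_eq_mul]; ring
  rw [this]; simp

lemma theta_neg_I (X : Phase n) : ((-Complex.I) • X).2.2.1.re = X.2.2.1.im := by
  simp

/-- Decay of the longitudinal variables. The real mode system governs their real parts, and also their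
imaginary parts, which are the real parts for the solution `-i X`. -/
lemma exists_modeSq_decay (hb : 0 < b) (hκ : 0 < κ) (hγ : γ ≠ 0) (hδ : 0 < δ) :
    ∃ C c : ℝ, 0 < C ∧ 0 < c ∧ ∀ (n : ℕ) (k : Space n), k ≠ 0 → ∀ X : ℝ → Phase n,
      (∀ t, HasDerivAt X (gen b κ γ δ k (X t)) t) → ∀ t, 0 ≤ t → ∀ e, 0 ≤ e →
      modeSq b κ k (X 0) ≤ e ^ 2 →
      modeSq b κ k (X t) ≤ (C * Real.exp (-(c * (‖k‖ ^ 2 / (1 + ‖k‖ ^ 2)) * t)) * e) ^ 2 := by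
  obtain ⟨C, c, hC, hc, h⟩ := exists_mode_decay hb hκ hγ hδ
  refine ⟨√C, c / 2, by positivity, by positivity, ?_⟩
  intro n k hk X hX t ht e he h0
  have h1 := h _ _ _ _ _ (modeSystem_re hκ hk hX) t ht
  have h2 := h _ _ _ _ _ (modeSystem_re hκ hk (hasDerivAt_neg_I_smul hX)) t ht
  simp only [modeA_neg_I, modeZ_neg_I, modeS_neg_I, theta_neg_I] at h2
  have hsq : ∀ z : ℂ, ‖z‖ ^ 2 = z.re ^ 2 + z.im ^ 2 := fun z => by
    rw [← Complex.normSq_eq_norm_sq, Complex.normSq_apply]; ring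
  set E := Real.exp (-(c * (‖k‖ ^ 2 / (1 + ‖k‖ ^ 2)) * t)) with hE
  have hE2 : Real.exp (-(c / 2 * (‖k‖ ^ 2 / (1 + ‖k‖ ^ 2)) * t)) ^ 2 = E := by
    rw [← Real.exp_nat_mul, hE]; congr 1; push_cast; ring
  rw [mul_pow, mul_pow, hE2, Real.sq_sqrt hC.le]
  have h3 : C * E * modeSq b κ k (X 0) ≤ C * E * e ^ 2 := by gcongr
  simp only [modeSq, hsq] at h3 ⊢
  linarith

lemma sqrt_bounds_of_modeSq {k : Space n} {X : Phase n} {e : ℝ} (he : 0 ≤ e)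
    (h : modeSq b κ k X ≤ e ^ 2) : ‖modeA k X‖ ≤ e ∧ ‖X.2.2.1‖ ≤ e ∧ ‖modeS κ k X‖ ≤ e := by
  simp only [modeSq] at h
  have p1 := sq_nonneg ‖modeA k X‖
  have p2 := sq_nonneg ‖modeZ b k X‖
  have p3 := sq_nonneg ‖X.2.2.1‖
  have p4 := sq_nonneg ‖modeS κ k X‖
  exact ⟨(abs_le_of_sq_le_sq' (by linarith) he).2, (abs_le_of_sq_le_sq' (by linarith) he).2,
    (abs_le_of_sq_le_sq' (by linarith) he).2⟩

/-- `θ_t` without its damping term, in terms of the modes. -/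
lemma heat_flux_eq (hκ : 0 < κ) {k : Space n} (hk : k ≠ 0) (X : Phase n) :
    X.2.2.2 - γ * Complex.I * dotC k X.2.1
      = ((‖k‖ : ℝ) : ℂ) * ((γ : ℂ) * modeA k X + ((√κ : ℝ) : ℂ) * modeS κ k X) := by
  have hk' : (‖k‖ : ℂ) ≠ 0 := by exact_mod_cast (norm_pos_iff.2 hk).ne'
  have hκ' : ((√κ : ℝ) : ℂ) ≠ 0 := by exact_mod_cast (Real.sqrt_pos.2 hκ).ne'
  simp only [modeA, modeS]
  field_simp
  ring

/-- The bound gains a factor `|k|`: it compensates the loss of `1 / |k|` for data in the component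
`q̂`. -/
lemma norm_heat_flux_le (hκ : 0 < κ) {k : Space n} (hk : k ≠ 0) {X : Phase n} {e : ℝ} (he : 0 ≤ e)
    (h : modeSq b κ k X ≤ e ^ 2) :
    ‖X.2.2.2 - γ * Complex.I * dotC k X.2.1‖ ≤ (|γ| + √κ) * ‖k‖ * e := by
  obtain ⟨h1, -, h2⟩ := sqrt_bounds_of_modeSq he h
  rw [heat_flux_eq (γ := γ) hκ hk, norm_mul, Complex.norm_real, norm_norm]
  calc _ ≤ ‖k‖ * (‖(γ : ℂ) * modeA k X‖ + ‖((√κ : ℝ) : ℂ) * modeS κ k X‖) := by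
        gcongr; exact norm_add_le _ _
    _ ≤ ‖k‖ * (|γ| * e + √κ * e) := by
        rw [norm_mul, norm_mul, Complex.norm_real, Complex.norm_real, Real.norm_eq_abs,
          Real.norm_of_nonneg (Real.sqrt_nonneg κ)]
        gcongr
    _ = _ := by ring

end ComplexModes

section Propagators

variable {n : ℕ} {b κ γ δ : ℝ}

/-- The solution operator at the wave vector `k`, applied to the data `(û₀, û₁, θ̂₀, θ̂₁)`. The part
of `θ̂₀` is obtained by applying `∂_t + δ |k|²` to the solution with `θ_t(0) = θ̂₀`: this is what
gives it a bound without loss at high frequencies. -/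
noncomputable def sol (b κ γ δ : ℝ) (k : Space n) (t : ℝ) (u₀ u₁ : EuclideanSpace ℂ (Fin n))
    (θ₀ θ₁ : ℂ) : Phase n :=
  flow b κ γ δ k t (u₀, u₁, 0, θ₁ + γ * Complex.I * dotC k u₁)
    + (gen b κ γ δ k (flow b κ γ δ k t (0, 0, 0, θ₀))
      + ((δ * ‖k‖ ^ 2 : ℝ) : ℂ) • flow b κ γ δ k t (0, 0, 0, θ₀))

lemma sol_zero (k : Space n) (u₀ u₁ : EuclideanSpace ℂ (Fin n)) (θ₀ θ₁ : ℂ) :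
    sol b κ γ δ k 0 u₀ u₁ θ₀ θ₁
      = (u₀, u₁, θ₀, θ₁ + γ * Complex.I * dotC k u₁ + (δ * ‖k‖ ^ 2 : ℝ) * θ₀) := by
  simp only [sol, flow_zero, one_apply_eq_self, gen_apply]
  ext1
  · simp
  · ext1
    · simp
    · ext1
      · simp
      · simp

lemma hasDerivAt_sol (k : Space n) (u₀ u₁ : EuclideanSpace ℂ (Fin n)) (θ₀ θ₁ : ℂ) (t : ℝ) :
    HasDerivAt (fun t => sol b κ γ δ k t u₀ u₁ θ₀ θ₁)
      (gen b κ γ δ k (sol b κ γ δ k t u₀ u₁ θ₀ θ₁)) t := by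
  have h1 := hasDerivAt_flow (b := b) (κ := κ) (γ := γ) (δ := δ) k
    (u₀, u₁, 0, θ₁ + γ * Complex.I * dotC k u₁) t
  have h2 := hasDerivAt_flow (b := b) (κ := κ) (γ := γ) (δ := δ) k
    ((0, 0, 0, θ₀) : Phase n) t
  have h3 := ((gen b κ γ δ k).restrictScalars ℝ).hasFDerivAt.comp_hasDerivAt t h2
  refine (h1.add (h3.add (h2.const_smul ((δ * ‖k‖ ^ 2 : ℝ) : ℂ)))).congr_deriv ?_
  simp only [sol, map_add, map_smul]
  rfl

/-- The temperature at time `t` produced by the initial value `θ_t(0) = 1`. -/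
noncomputable def heatKernel (b κ γ δ : ℝ) (k : Space n) (t : ℝ) : ℂ :=
  (flow b κ γ δ k t (0, 0, 0, 1)).2.2.1

/-- The temperature produced by the data other than `θ_t(0)`. -/
noncomputable def thetaRest (b κ γ δ : ℝ) (k : Space n) (t : ℝ)
    (u₀ u₁ : EuclideanSpace ℂ (Fin n)) (θ₀ : ℂ) : ℂ :=
  (sol b κ γ δ k t u₀ u₁ θ₀ 0).2.2.1

/-- The datum `θ̂₁` enters the temperature through the multiplier `heatKernel`. -/
lemma theta_sol_eq (k : Space n) (t : ℝ) (u₀ u₁ : EuclideanSpace ℂ (Fin n)) (θ₀ θ₁ : ℂ) :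
    (sol b κ γ δ k t u₀ u₁ θ₀ θ₁).2.2.1
      = thetaRest b κ γ δ k t u₀ u₁ θ₀ + θ₁ * heatKernel b κ γ δ k t := by
  have h : ((u₀, u₁, 0, θ₁ + γ * Complex.I * dotC k u₁) : Phase n)
      = (u₀, u₁, 0, 0 + γ * Complex.I * dotC k u₁) + θ₁ • (0, 0, 0, 1) := by
    ext1
    · simp
    · ext1
      · simp
      · ext1
        · simp
        · simp [add_comm]
  simp only [sol, thetaRest, heatKernel]
  rw [h, map_add, map_smul]
  simp only [Prod.snd_add, Prod.fst_add, Prod.smul_snd, Prod.smul_fst, smul_eq_mul]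
  ring

/-- Decay of the temperature produced by the data other than `θ_t(0)`. -/
lemma exists_thetaRest_le (hb : 0 < b) (hκ : 0 < κ) (hγ : γ ≠ 0) (hδ : 0 < δ) :
    ∃ C c : ℝ, 0 < C ∧ 0 < c ∧ ∀ (n : ℕ) (k : Space n), k ≠ 0 → ∀ t, 0 ≤ t →
      ∀ (u₀ u₁ : EuclideanSpace ℂ (Fin n)) (θ₀ : ℂ),
      ‖thetaRest b κ γ δ k t u₀ u₁ θ₀‖
        ≤ C * Real.exp (-(c * (‖k‖ ^ 2 / (1 + ‖k‖ ^ 2)) * t))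
          * (‖k‖ * ‖u₀‖ + ‖u₁‖ + ‖θ₀‖) := by
  obtain ⟨C, c, hC, hc, h⟩ := exists_modeSq_decay hb hκ hγ hδ
  refine ⟨C * (b + 1 + |γ| / √κ) + (|γ| + √κ) * C / √κ, c, by positivity, hc, ?_⟩
  intro n k hk t ht u₀ u₁ θ₀
  have hk' : 0 < ‖k‖ := norm_pos_iff.2 hk
  have hsκ : 0 < √κ := Real.sqrt_pos.2 hκ
  set E := Real.exp (-(c * (‖k‖ ^ 2 / (1 + ‖k‖ ^ 2)) * t)) with hE
  set e₁ := (b + 1 + |γ| / √κ) * (‖k‖ * ‖u₀‖ + ‖u₁‖) with he₁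
  have he₁0 : 0 ≤ e₁ := by positivity
  have hA : modeSq b κ k (flow b κ γ δ k 0 (u₀, u₁, 0, 0 + γ * Complex.I * dotC k u₁)) ≤ e₁ ^ 2 := by
    rw [flow_zero, one_apply_eq_self, zero_add]
    simp only [modeSq, modeA, modeZ, modeS]
    have d1 := norm_dotC_le k u₁
    have d0 := norm_dotC_le k u₀
    have n1 : ‖-Complex.I * dotC k u₁ / ‖k‖‖ ≤ ‖u₁‖ := by
      rw [norm_div, norm_mul, norm_neg, Complex.norm_I, one_mul, Complex.norm_real, norm_norm,
        div_le_iff₀ hk']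
      linarith
    have n2 : ‖-Complex.I * b * dotC k u₀‖ ≤ b * (‖k‖ * ‖u₀‖) := by
      rw [norm_mul, norm_mul, norm_neg, Complex.norm_I, one_mul, Complex.norm_real,
        Real.norm_of_nonneg hb.le]
      gcongr
    have n3 : ‖γ * Complex.I * dotC k u₁ / (√κ * ‖k‖)‖ ≤ |γ| / √κ * ‖u₁‖ := by
      rw [norm_div, norm_mul, norm_mul, norm_mul, Complex.norm_I, mul_one, Complex.norm_real,
        Complex.norm_real, Complex.norm_real, norm_norm, Real.norm_of_nonneg hsκ.le,
        Real.norm_eq_abs, div_le_iff₀ (by positivity)]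
      calc |γ| * ‖dotC k u₁‖ ≤ |γ| * (‖k‖ * ‖u₁‖) := by gcongr
        _ = _ := by field_simp
    have q1 := pow_le_pow_left₀ (norm_nonneg _) n1 2
    have q2 := pow_le_pow_left₀ (norm_nonneg _) n2 2
    have q3 := pow_le_pow_left₀ (norm_nonneg _) n3 2
    have hx : 0 ≤ ‖k‖ * ‖u₀‖ := by positivity
    have hy : 0 ≤ ‖u₁‖ := norm_nonneg _
    have hg : 0 ≤ |γ| / √κ := by positivity
    have key : ‖u₁‖ ^ 2 + (b * (‖k‖ * ‖u₀‖)) ^ 2 + (|γ| / √κ * ‖u₁‖) ^ 2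
        ≤ (‖u₁‖ + b * (‖k‖ * ‖u₀‖) + |γ| / √κ * ‖u₁‖) ^ 2 := by
      have m1 : 0 ≤ ‖u₁‖ * (b * (‖k‖ * ‖u₀‖)) := by positivity
      have m2 : 0 ≤ ‖u₁‖ * (|γ| / √κ * ‖u₁‖) := by positivity
      have m3 : 0 ≤ (b * (‖k‖ * ‖u₀‖)) * (|γ| / √κ * ‖u₁‖) := by positivity
      linarith
    have key2 : ‖u₁‖ + b * (‖k‖ * ‖u₀‖) + |γ| / √κ * ‖u₁‖ ≤ e₁ := by
      rw [he₁]
      have m1 : 0 ≤ b * ‖u₁‖ := by positivity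
      have m2 : 0 ≤ |γ| / √κ * (‖k‖ * ‖u₀‖) := by positivity
      linarith
    have key3 := pow_le_pow_left₀ (by positivity) key2 2
    simp only [norm_zero]
    linarith
  have h1 := h n k hk _ (hasDerivAt_flow k _) t ht e₁ he₁0 hA
  have b1 := (sqrt_bounds_of_modeSq (by positivity) h1).2.1
  have hB : modeSq b κ k (flow b κ γ δ k 0 (0, 0, 0, θ₀)) ≤ (‖θ₀‖ / (√κ * ‖k‖)) ^ 2 := by
    rw [flow_zero, one_apply_eq_self]
    simp only [modeSq, modeA, modeZ, modeS]
    simp [Real.norm_of_nonneg hsκ.le]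
  have h2 := h n k hk _ (hasDerivAt_flow k _) t ht _ (by positivity) hB
  have b2 := norm_heat_flux_le (γ := γ) hκ hk (by positivity) h2
  have e3 : thetaRest b κ γ δ k t u₀ u₁ θ₀
      = (flow b κ γ δ k t (u₀, u₁, 0, 0 + γ * Complex.I * dotC k u₁)).2.2.1
        + ((flow b κ γ δ k t (0, 0, 0, θ₀)).2.2.2
          - γ * Complex.I * dotC k (flow b κ γ δ k t (0, 0, 0, θ₀)).2.1) := by
    simp only [thetaRest, sol, gen_apply, Prod.snd_add, Prod.fst_add, Prod.smul_snd,
      Prod.smul_fst, smul_eq_mul]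
    ring
  rw [e3]
  refine (norm_add_le_of_le b1 b2).trans ?_
  have e4 : (|γ| + √κ) * ‖k‖ * (C * E * (‖θ₀‖ / (√κ * ‖k‖))) = (|γ| + √κ) * C / √κ * E * ‖θ₀‖ := by
    field_simp
  rw [e4, he₁]
  have m1 : 0 ≤ C * (b + 1 + |γ| / √κ) * E * ‖θ₀‖ := by positivity
  have m2 : 0 ≤ (|γ| + √κ) * C / √κ * E * (‖k‖ * ‖u₀‖ + ‖u₁‖) := by positivity
  linarith

/-- Bounds of the temperature produced by `θ_t(0) = 1`: decay, linear growth at low frequencies, and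
comparison with the profile. -/
lemma exists_heatKernel_bounds (hb : 0 < b) (hκ : 0 < κ) (hγ : γ ≠ 0) (hδ : 0 < δ) :
    ∃ C c : ℝ, 0 < C ∧ 0 < c ∧ ∀ (n : ℕ) (k : Space n), k ≠ 0 → ∀ t, 0 ≤ t →
      ‖heatKernel b κ γ δ k t‖
          ≤ C * Real.exp (-(c * (‖k‖ ^ 2 / (1 + ‖k‖ ^ 2)) * t)) / ‖k‖ ∧
      (‖k‖ ≤ 1 → ‖heatKernel b κ γ δ k t‖ ≤ C * t) ∧
      (‖k‖ ≤ 1 → ‖heatKernel b κ γ δ k t - profileSymbol b κ γ δ t ‖k‖‖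
          ≤ C * Real.exp (-(c * ‖k‖ ^ 2 * t))) := by
  obtain ⟨C, c, hC, hc, h⟩ := exists_modeSq_decay hb hκ hγ hδ
  obtain ⟨C₁, c₁', hC₁, hc₁, hp⟩ := exists_mode_profile hb hκ hγ hδ
  have hsκ : 0 < √κ := Real.sqrt_pos.2 hκ
  set M : ℝ := C / √κ + (|γ| + √κ) * (C / √κ) + δ * (C / √κ) + C₁ / √κ with hM
  have m1 : 0 < C / √κ := by positivity
  have m2 : 0 < (|γ| + √κ) * (C / √κ) := by positivity
  have m3 : 0 < δ * (C / √κ) := by positivity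
  have m4 : 0 < C₁ / √κ := by positivity
  refine ⟨M, min c c₁', by positivity, lt_min hc hc₁, ?_⟩
  intro n k hk t ht
  have hk' : 0 < ‖k‖ := norm_pos_iff.2 hk
  set X : ℝ → Phase n := fun t => flow b κ γ δ k t (0, 0, 0, 1) with hX
  have hXd : ∀ t, HasDerivAt X (gen b κ γ δ k (X t)) t := hasDerivAt_flow k _
  have hX0 : X 0 = (0, 0, 0, 1) := by
    simp only [hX]; rw [flow_zero, one_apply_eq_self]
  have h0 : modeSq b κ k (X 0) ≤ (1 / (√κ * ‖k‖)) ^ 2 := by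
    rw [hX0]
    simp only [modeSq, modeA, modeZ, modeS]
    simp [abs_of_pos hsκ]
  have hdec := fun t ht => h n k hk X hXd t ht _ (by positivity) h0
  have hE : ∀ t, 0 ≤ t → Real.exp (-(c * (‖k‖ ^ 2 / (1 + ‖k‖ ^ 2)) * t)) ≤ 1 := fun t ht =>
    Real.exp_le_one_iff.2 (neg_nonpos.2 (by positivity))
  have hE' : Real.exp (-(c * (‖k‖ ^ 2 / (1 + ‖k‖ ^ 2)) * t))
      ≤ Real.exp (-(min c c₁' * (‖k‖ ^ 2 / (1 + ‖k‖ ^ 2)) * t)) := by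
    gcongr; exact min_le_left _ _
  refine ⟨?_, ?_, ?_⟩
  · refine ((sqrt_bounds_of_modeSq (by positivity) (hdec t ht)).2.1).trans ?_
    set E' := Real.exp (-(min c c₁' * (‖k‖ ^ 2 / (1 + ‖k‖ ^ 2)) * t))
    calc _ = C / √κ * Real.exp (-(c * (‖k‖ ^ 2 / (1 + ‖k‖ ^ 2)) * t)) / ‖k‖ := by field_simp
      _ ≤ M * E' / ‖k‖ := by
        gcongr
        rw [hM]; linarith
  · intro hk1
    have hd : ∀ s, HasDerivAt (fun t => (X t).2.2.1) (gen b κ γ δ k (X s)).2.2.1 s :=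
      fun t => (hXd t).snd.snd.fst
    have hbd : ∀ s ∈ Ico 0 t, ‖(gen b κ γ δ k (X s)).2.2.1‖
        ≤ (|γ| + √κ) * (C / √κ) + δ * (C / √κ) := by
      intro s hs
      have hs0 := hdec s hs.1
      have b1 := norm_heat_flux_le (γ := γ) hκ hk (by positivity) hs0
      have b2 := (sqrt_bounds_of_modeSq (by positivity) hs0).2.1
      have hEs := hE s hs.1
      set Es := Real.exp (-(c * (‖k‖ ^ 2 / (1 + ‖k‖ ^ 2)) * s))
      have e1 : (gen b κ γ δ k (X s)).2.2.1 = ((X s).2.2.2 - γ * Complex.I * dotC k (X s).2.1)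
          - ((δ * ‖k‖ ^ 2 : ℝ) : ℂ) * (X s).2.2.1 := by
        simp only [gen_apply]; ring
      rw [e1]
      refine (norm_sub_le_of_le b1 (le_of_eq (norm_mul _ _))).trans ?_
      rw [Complex.norm_real, Real.norm_of_nonneg (by positivity)]
      have f1 : (|γ| + √κ) * ‖k‖ * (C * Es * (1 / (√κ * ‖k‖))) = (|γ| + √κ) * (C / √κ) * Es := by
        field_simp
      have f2 : δ * ‖k‖ ^ 2 * (C * Es * (1 / (√κ * ‖k‖))) = δ * (C / √κ) * (Es * ‖k‖) := by
        field_simp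
      have f3 : (|γ| + √κ) * (C / √κ) * Es ≤ (|γ| + √κ) * (C / √κ) * 1 := by gcongr
      have f4 : δ * (C / √κ) * (Es * ‖k‖) ≤ δ * (C / √κ) * (1 * 1) := by gcongr
      have f5 : δ * ‖k‖ ^ 2 * ‖(X s).2.2.1‖ ≤ δ * ‖k‖ ^ 2 * (C * Es * (1 / (√κ * ‖k‖))) := by gcongr
      linarith
    have h2 := norm_image_sub_le_of_norm_deriv_le_segment' (fun s _ => (hd s).hasDerivWithinAt) hbd t
      ⟨ht, le_rfl⟩
    simp only [hX0, sub_zero] at h2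
    refine h2.trans ?_
    gcongr
    rw [hM]; linarith
  · intro hk1
    have hre := hp ‖k‖ _ _ _ _ hk' hk1 (modeSystem_re hκ hk hXd)
      (by simp [hX0, modeA]) (by simp [hX0, modeZ]) (by simp [hX0]) t ht
    have hs0 : (modeS κ k (X 0)).re = 1 / (√κ * ‖k‖) := by
      rw [hX0]; simp only [modeS]
      rw [← Complex.ofReal_mul, ← Complex.ofReal_one, ← Complex.ofReal_div, Complex.ofReal_re]
    have hs0' : (modeS κ k (X 0)).im = 0 := by
      rw [hX0]; simp only [modeS]
      rw [← Complex.ofReal_mul, ← Complex.ofReal_one, ← Complex.ofReal_div, Complex.ofReal_im]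
    -- the imaginary part solves the real system with zero data
    have him := hp ‖k‖ _ _ _ _ hk' hk1 (modeSystem_re hκ hk (hasDerivAt_neg_I_smul hXd))
      (by simp [hX0, modeA]) (by simp [hX0, modeZ]) (by simp [hX0]) t ht
    simp only [modeS_neg_I, theta_neg_I, hs0', mul_zero, zero_mul, abs_zero, sub_zero] at him
    have him0 : (X t).2.2.1.im = 0 := abs_nonpos_iff.1 him
    rw [hs0] at hre
    have e1 : √κ * ‖k‖ * (1 / (√κ * ‖k‖)) = 1 := by field_simp
    rw [e1, one_mul, abs_of_pos (show 0 < 1 / (√κ * ‖k‖) by positivity)] at hre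
    have e2 : heatKernel b κ γ δ k t - profileSymbol b κ γ δ t ‖k‖
        = (((X t).2.2.1.re - profileSymbol b κ γ δ t ‖k‖ : ℝ) : ℂ) := by
      apply Complex.ext
      · simp [heatKernel, hX]
      · simp only [heatKernel, Complex.sub_im, Complex.ofReal_im, sub_zero]
        exact him0
    rw [e2, Complex.norm_real, Real.norm_eq_abs]
    refine hre.trans ?_
    have e3 : C₁ * ‖k‖ * Real.exp (-(c₁' * ‖k‖ ^ 2 * t)) * (1 / (√κ * ‖k‖))
        = C₁ / √κ * Real.exp (-(c₁' * ‖k‖ ^ 2 * t)) := by field_simp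
    rw [e3]
    gcongr
    · rw [hM]; linarith
    · exact min_le_right _ _

set_option maxHeartbeats 1000000 in
/-- Bounds of the solution operator on bounded time intervals: `û` and `θ̂` without loss of powers
of `k`, all components with the loss of two powers. -/
lemma exists_sol_bounds (hb : 0 < b) (hκ : 0 < κ) (hδ : 0 < δ) (n : ℕ) (T : ℝ) :
    ∃ C : ℝ, 0 < C ∧ ∀ (k : Space n) (t : ℝ), 0 ≤ t → t ≤ T →
      ∀ (u₀ u₁ : EuclideanSpace ℂ (Fin n)) (θ₀ θ₁ : ℂ),
      ‖(sol b κ γ δ k t u₀ u₁ θ₀ θ₁).1‖ ≤ C * ((1 + ‖k‖) * ‖u₀‖ + ‖u₁‖ + ‖θ₀‖ + ‖θ₁‖) ∧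
      ‖(sol b κ γ δ k t u₀ u₁ θ₀ θ₁).2.2.1‖ ≤ C * ((1 + ‖k‖) * ‖u₀‖ + ‖u₁‖ + ‖θ₀‖ + ‖θ₁‖) ∧
      ‖sol b κ γ δ k t u₀ u₁ θ₀ θ₁‖
        ≤ C * (1 + ‖k‖ ^ 2) * ((1 + ‖k‖) * ‖u₀‖ + ‖u₁‖ + ‖θ₀‖ + ‖θ₁‖) := by
  have hsκ : 0 < √κ := Real.sqrt_pos.2 hκ
  obtain ⟨M, hM⟩ := (isCompact_closedBall (0 : Space n) 1).exists_bound_of_continuousOn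
    (continuous_gen (n := n) (b := b) (κ := κ) (γ := γ) (δ := δ)).continuousOn
  have hM0 : 0 ≤ M := (norm_nonneg _).trans (hM 0 (by simp))
  set C₁ : ℝ := (1 + |γ| + M + δ) * Real.exp (M * T) with hC₁
  have hC₁0 : 0 ≤ C₁ := by positivity
  set a : ℝ := 1 + b + (1 + |γ|) / √κ with ha
  have ha0 : 0 < a := by positivity
  set C₂ : ℝ := a + a / b + √κ * a + 1 / √κ * (1 + δ / b + b + |γ| + δ) + 1 + |γ| / √κ + √κ + δ
    with hC₂
  have hC₂0 : 0 < C₂ := by positivity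
  refine ⟨C₁ + C₂, by positivity, ?_⟩
  intro k t ht htT u₀ u₁ θ₀ θ₁
  set D : ℝ := (1 + ‖k‖) * ‖u₀‖ + ‖u₁‖ + ‖θ₀‖ + ‖θ₁‖ with hD
  have hD0 : 0 ≤ D := by positivity
  have hku : 0 ≤ ‖k‖ * ‖u₀‖ := by positivity
  have hDu₀ : ‖u₀‖ ≤ D := by
    rw [hD]; linarith [norm_nonneg u₁, norm_nonneg θ₀, norm_nonneg θ₁]
  have hDku₀ : ‖k‖ * ‖u₀‖ ≤ D := by
    rw [hD]; linarith [norm_nonneg u₁, norm_nonneg θ₀, norm_nonneg θ₁, norm_nonneg u₀]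
  have hDu₁ : ‖u₁‖ ≤ D := by
    rw [hD]; linarith [norm_nonneg u₀, norm_nonneg θ₀, norm_nonneg θ₁]
  have hDθ₀ : ‖θ₀‖ ≤ D := by
    rw [hD]; linarith [norm_nonneg u₁, norm_nonneg u₀, norm_nonneg θ₁]
  have hDθ₁ : ‖θ₁‖ ≤ D := by
    rw [hD]; linarith [norm_nonneg u₁, norm_nonneg θ₀, norm_nonneg u₀]
  set xa : Phase n := (u₀, u₁, 0, θ₁ + γ * Complex.I * dotC k u₁) with hxa
  set xb : Phase n := (0, 0, 0, θ₀) with hxb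
  have hq : ‖θ₁ + γ * Complex.I * dotC k u₁‖ ≤ ‖θ₁‖ + |γ| * (‖k‖ * ‖u₁‖) := by
    refine (norm_add_le _ _).trans ?_
    rw [norm_mul, norm_mul, Complex.norm_I, mul_one, Complex.norm_real, Real.norm_eq_abs]
    gcongr; exact norm_dotC_le _ _
  rcases le_total ‖k‖ 1 with hk1 | hk1
  · have hMk : ‖gen b κ γ δ k‖ ≤ M := hM k (by simpa using hk1)
    have hflow : ∀ x : Phase n, ‖flow b κ γ δ k t x‖ ≤ ‖x‖ * Real.exp (M * T) := by
      intro x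
      have := norm_le_of_hasDerivAt_gen (hasDerivAt_flow (b := b) (κ := κ) (γ := γ) (δ := δ) k x) ht
      rw [flow_zero, one_apply_eq_self] at this
      refine this.trans ?_
      gcongr
    have hxan : ‖xa‖ ≤ (1 + |γ|) * D := by
      have h1 : 0 ≤ |γ| * D := by positivity
      have h2 : |γ| * (‖k‖ * ‖u₁‖) ≤ |γ| * (1 * D) := by gcongr
      rw [hxa, norm_prod_le_iff, norm_prod_le_iff, norm_prod_le_iff]
      refine ⟨by linarith, by linarith, by simpa using by positivity, hq.trans ?_⟩
      linarith
    have hxbn : ‖xb‖ ≤ D := by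
      rw [hxb, norm_prod_le_iff, norm_prod_le_iff, norm_prod_le_iff]
      simpa using ⟨hD0, hDθ₀⟩
    have hsol : ‖sol b κ γ δ k t u₀ u₁ θ₀ θ₁‖ ≤ C₁ * D := by
      have h1 := hflow xa
      have h2 := hflow xb
      have h3 : ‖gen b κ γ δ k (flow b κ γ δ k t xb)‖ ≤ M * (‖xb‖ * Real.exp (M * T)) :=
        (ContinuousLinearMap.le_opNorm _ _).trans (by gcongr)
      have h4 : ‖((δ * ‖k‖ ^ 2 : ℝ) : ℂ) • flow b κ γ δ k t xb‖
          ≤ δ * (‖xb‖ * Real.exp (M * T)) := by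
        rw [norm_smul, Complex.norm_real, Real.norm_of_nonneg (by positivity)]
        gcongr
        have : ‖k‖ ^ 2 ≤ 1 := pow_le_one₀ (norm_nonneg _) hk1
        exact mul_le_of_le_one_right hδ.le this
      refine (norm_add_le_of_le h1 (norm_add_le_of_le h3 h4)).trans ?_
      calc _ ≤ (1 + |γ|) * D * Real.exp (M * T)
            + (M * (D * Real.exp (M * T)) + δ * (D * Real.exp (M * T))) := by gcongr
        _ = C₁ * D := by rw [hC₁]; ring
    have hsol' : ‖sol b κ γ δ k t u₀ u₁ θ₀ θ₁‖ ≤ (C₁ + C₂) * D :=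
      hsol.trans (by gcongr; linarith)
    refine ⟨(norm_fst_le _).trans hsol',
      ((norm_fst_le _).trans ((norm_snd_le _).trans (norm_snd_le _))).trans hsol', hsol'.trans ?_⟩
    have : 0 ≤ (C₁ + C₂) * ‖k‖ ^ 2 * D := by positivity
    linarith
  · have hk' : 0 < ‖k‖ := by linarith
    have hk : k ≠ 0 := norm_pos_iff.1 hk'
    have hEa : phaseEnergy b κ k (flow b κ γ δ k 0 xa) ≤ (a * D) ^ 2 := by
      rw [flow_zero, one_apply_eq_self]
      have h1 : ‖θ₁ + γ * Complex.I * dotC k u₁‖ ≤ (1 + |γ|) * ‖k‖ * D := by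
        have h2 : 1 * ‖θ₁‖ ≤ ‖k‖ * D := by gcongr
        have h3 : |γ| * (‖k‖ * ‖u₁‖) ≤ |γ| * (‖k‖ * D) := by gcongr
        linarith
      have h2 : ‖θ₁ + γ * Complex.I * dotC k u₁‖ ^ 2 / (κ * ‖k‖ ^ 2) ≤ ((1 + |γ|) / √κ * D) ^ 2 := by
        rw [div_le_iff₀ (by positivity)]
        refine (pow_le_pow_left₀ (norm_nonneg _) h1 2).trans (le_of_eq ?_)
        rw [mul_pow ((1 + |γ|) / √κ) D, div_pow, Real.sq_sqrt hκ.le]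
        field_simp
      have h3 : ‖u₁‖ ^ 2 ≤ D ^ 2 := by gcongr
      have h4 : (‖k‖ * ‖u₀‖) ^ 2 ≤ D ^ 2 := by gcongr
      have h5 : b ^ 2 * (‖k‖ * ‖u₀‖) ^ 2 ≤ b ^ 2 * D ^ 2 := by gcongr
      set g := (1 + |γ|) / √κ with hg
      have hg0 : 0 < g := by positivity
      have h6 : (a * D) ^ 2 = D ^ 2 + b ^ 2 * D ^ 2 + (g * D) ^ 2
          + (2 * b + 2 * g + 2 * b * g) * D ^ 2 := by rw [ha]; ring
      have h7 : 0 ≤ (2 * b + 2 * g + 2 * b * g) * D ^ 2 := by positivity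
      simp only [phaseEnergy, hxa, norm_zero]
      rw [h6]
      linarith
    have hEb : phaseEnergy b κ k (flow b κ γ δ k 0 xb) ≤ (‖θ₀‖ / (√κ * ‖k‖)) ^ 2 := by
      rw [flow_zero, one_apply_eq_self]
      simp only [phaseEnergy, hxb, norm_zero]
      rw [div_pow, mul_pow, Real.sq_sqrt hκ.le]
      simp
    obtain ⟨pa, ua, θa, qa⟩ := energy_bounds hb hκ hδ hk
      (hasDerivAt_flow (b := b) (κ := κ) (γ := γ) (δ := δ) k xa) (by positivity) hEa ht
    obtain ⟨pb, ub, θb, qb⟩ := energy_bounds hb hκ hδ hk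
      (hasDerivAt_flow (b := b) (κ := κ) (γ := γ) (δ := δ) k xb) (by positivity) hEb ht
    set Xa := flow b κ γ δ k t xa with hXa
    set Xb := flow b κ γ δ k t xb with hXb
    have hsol : sol b κ γ δ k t u₀ u₁ θ₀ θ₁
        = Xa + (gen b κ γ δ k Xb + ((δ * ‖k‖ ^ 2 : ℝ) : ℂ) • Xb) := rfl
    set r := ‖k‖ with hr
    have hr2 : r ≤ r ^ 2 := by nlinarith
    -- bounds in terms of `f = ‖θ₀‖ / √κ`
    set f : ℝ := ‖θ₀‖ / √κ with hf
    have hf0 : 0 ≤ f := by positivity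
    have hfe : ‖θ₀‖ / (√κ * r) = f / r := by rw [hf]; field_simp
    have hfD : f ≤ 1 / √κ * D := by rw [hf, div_eq_inv_mul, one_div]; gcongr
    have hfκ : √κ * f = ‖θ₀‖ := by rw [hf]; field_simp
    have hκκ : κ = √κ * √κ := (Real.mul_self_sqrt hκ.le).symm
    have hfr : f / r ≤ f := div_le_self hf0 hk1
    rw [hfe] at pb ub θb qb
    have rfr : r * (f / r) = f := by field_simp
    have qb' : ‖Xb.2.2.2‖ ≤ ‖θ₀‖ := by
      rw [mul_assoc, rfr, hfκ] at qb; exact qb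
    have ub' : r ^ 2 * ‖Xb.1‖ ≤ f / b := by
      rw [le_div_iff₀ hb]
      calc r ^ 2 * ‖Xb.1‖ * b = r * (b * r * ‖Xb.1‖) := by ring
        _ ≤ r * (f / r) := by gcongr
        _ = f := rfr
    have ua' : ‖Xa.1‖ ≤ a / b * D := by
      rw [div_mul_eq_mul_div, le_div_iff₀ hb]
      calc ‖Xa.1‖ * b ≤ r * (‖Xa.1‖ * b) := le_mul_of_one_le_left (by positivity) hk1
        _ = b * r * ‖Xa.1‖ := by ring
        _ ≤ _ := ua
    have rθb : r * ‖Xb.2.2.1‖ ≤ f := by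
      calc r * ‖Xb.2.2.1‖ ≤ r * (f / r) := by gcongr
        _ = f := rfr
    have rpb : r * ‖Xb.2.1‖ ≤ f := by
      calc r * ‖Xb.2.1‖ ≤ r * (f / r) := by gcongr
        _ = f := rfr
    have cδ : ‖((δ * r ^ 2 : ℝ) : ℂ)‖ = δ * r ^ 2 := by
      rw [Complex.norm_real, Real.norm_of_nonneg (by positivity)]
    -- the four components
    have N1 : ‖(sol b κ γ δ k t u₀ u₁ θ₀ θ₁).1‖ ≤ a / b * D + (f + δ * (f / b)) := by
      rw [hsol]
      simp only [Prod.fst_add, Prod.smul_fst, gen_apply]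
      refine norm_add_le_of_le ua' (norm_add_le_of_le (pb.trans hfr) ?_)
      rw [norm_smul, cδ, mul_assoc]; gcongr
    have N3 : ‖(sol b κ γ δ k t u₀ u₁ θ₀ θ₁).2.2.1‖ ≤ a * D + (‖θ₀‖ + |γ| * f) := by
      have e1 : (sol b κ γ δ k t u₀ u₁ θ₀ θ₁).2.2.1
          = Xa.2.2.1 + (Xb.2.2.2 - γ * Complex.I * dotC k Xb.2.1) := by
        rw [hsol]
        simp only [Prod.fst_add, Prod.snd_add, Prod.smul_fst, Prod.smul_snd, gen_apply, smul_eq_mul]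
        ring
      rw [e1]
      refine norm_add_le_of_le θa (norm_sub_le_of_le qb' ?_)
      rw [norm_mul, norm_mul, Complex.norm_I, mul_one, Complex.norm_real, Real.norm_eq_abs]
      gcongr
      exact (norm_dotC_le _ _).trans rpb
    have N2 : ‖(sol b κ γ δ k t u₀ u₁ θ₀ θ₁).2.1‖
        ≤ a * D + (b * f + |γ| * f + δ * (r ^ 2 * f)) := by
      rw [hsol]
      simp only [Prod.fst_add, Prod.snd_add, Prod.smul_fst, Prod.smul_snd, gen_apply]
      refine norm_add_le_of_le pa (norm_add_le_of_le (norm_sub_le_of_le ?_ ?_) ?_)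
      · rw [norm_smul, norm_neg, Complex.norm_real, Real.norm_of_nonneg (by positivity)]
        calc b ^ 2 * r ^ 2 * ‖Xb.1‖ = b ^ 2 * (r ^ 2 * ‖Xb.1‖) := by ring
          _ ≤ b ^ 2 * (f / b) := by gcongr
          _ = b * f := by field_simp
      · rw [norm_smul, norm_vecC, norm_mul, norm_mul, Complex.norm_I, mul_one, Complex.norm_real,
          Real.norm_eq_abs, mul_assoc, mul_comm _ ‖k‖]
        gcongr
      · rw [norm_smul, cδ, mul_assoc]
        gcongr
        exact pb.trans hfr
    have N4 : ‖(sol b κ γ δ k t u₀ u₁ θ₀ θ₁).2.2.2‖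
        ≤ √κ * r * (a * D) + (√κ * (r * ‖θ₀‖) + δ * r ^ 2 * ‖θ₀‖) := by
      rw [hsol]
      simp only [Prod.snd_add, Prod.smul_snd, gen_apply]
      refine norm_add_le_of_le qa (norm_add_le_of_le ?_ ?_)
      · rw [norm_neg, norm_mul, Complex.norm_real, Real.norm_of_nonneg (by positivity)]
        calc κ * r ^ 2 * ‖Xb.2.2.1‖ = √κ * (r * (√κ * (r * ‖Xb.2.2.1‖))) := by
              rw [hκκ, Real.sqrt_mul_self hsκ.le]; ring
          _ ≤ √κ * (r * (√κ * f)) := by gcongr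
          _ = _ := by rw [hfκ]
      · rw [norm_smul, cδ]
        gcongr
    have R1 : 1 ≤ 1 + r ^ 2 := by linarith [sq_nonneg r]
    have hκD : 0 ≤ √κ * a * D := by positivity
    have hκf := mul_le_mul_of_nonneg_left hfD (show 0 ≤ 1 + δ / b + b + |γ| + δ by positivity)
    have hγf := mul_le_mul_of_nonneg_left hfD (abs_nonneg γ)
    have hbD : 0 ≤ 1 / √κ * D * (b + |γ| + δ) := by positivity
    have hbD2 : 0 ≤ 1 / √κ * D * (1 + δ / b + b + δ) := by positivity
    have habD : 0 ≤ a / b * D := by positivity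
    have haD : 0 ≤ a * D := by positivity
    have hC₂D : C₂ * D = a * D + a / b * D + √κ * a * D
        + (1 + δ / b + b + |γ| + δ) * (1 / √κ * D) + D + |γ| * (1 / √κ * D) + √κ * D + δ * D := by
      rw [hC₂]; ring
    have hδD : 0 ≤ δ * D := by positivity
    have hκD' : 0 ≤ √κ * D := by positivity
    have hγD : 0 ≤ |γ| * (1 / √κ * D) := by positivity
    have hC₁D : 0 ≤ C₁ * D := by positivity
    have hr2D : 0 ≤ (C₁ + C₂) * r ^ 2 * D := by positivity
    have f1 : 0 ≤ b * f := by positivity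
    have f2 : 0 ≤ |γ| * f := by positivity
    have f3 : 0 ≤ δ * f := by positivity
    have f4 : 0 ≤ δ / b * f := by positivity
    have f5 : δ * (f / b) = δ / b * f := by ring
    have B1 : ‖(sol b κ γ δ k t u₀ u₁ θ₀ θ₁).1‖ ≤ (C₁ + C₂) * D := by
      rw [f5] at N1; linarith
    have B3 : ‖(sol b κ γ δ k t u₀ u₁ θ₀ θ₁).2.2.1‖ ≤ (C₁ + C₂) * D := by linarith
    have B1' : (C₁ + C₂) * D ≤ (C₁ + C₂) * (1 + r ^ 2) * D := by linarith
    refine ⟨B1, B3, ?_⟩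
    rw [norm_prod_le_iff, norm_prod_le_iff, norm_prod_le_iff]
    refine ⟨B1.trans B1', ?_, B3.trans B1', ?_⟩
    · have g1 : a * D + (b * f + |γ| * f + δ * (r ^ 2 * f))
          ≤ (1 + r ^ 2) * (a * D + (b * f + |γ| * f + δ * f)) := by
        have : 0 ≤ r ^ 2 * (a * D + (b * f + |γ| * f)) := by positivity
        linarith
      have g2 : a * D + (b * f + |γ| * f + δ * f) ≤ (C₁ + C₂) * D := by linarith
      calc _ ≤ (1 + r ^ 2) * (a * D + (b * f + |γ| * f + δ * f)) := N2.trans g1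
        _ ≤ (1 + r ^ 2) * ((C₁ + C₂) * D) := by gcongr
        _ = _ := by ring
    · have g1 : √κ * r * (a * D) + (√κ * (r * ‖θ₀‖) + δ * r ^ 2 * ‖θ₀‖)
          ≤ r ^ 2 * (√κ * a * D + √κ * D + δ * D) := by
        have m1 : √κ * (a * D) * r ≤ √κ * (a * D) * r ^ 2 := by gcongr
        have m2 : √κ * (r * ‖θ₀‖) ≤ √κ * (r ^ 2 * D) := by gcongr
        have m3 : δ * r ^ 2 * ‖θ₀‖ ≤ δ * r ^ 2 * D := by gcongr
        linarith
      have g2 : √κ * a * D + √κ * D + δ * D ≤ (C₁ + C₂) * D := by linarith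
      calc _ ≤ r ^ 2 * (√κ * a * D + √κ * D + δ * D) := N4.trans g1
        _ ≤ r ^ 2 * ((C₁ + C₂) * D) := by gcongr
        _ ≤ (1 + r ^ 2) * ((C₁ + C₂) * D) := by gcongr; linarith
        _ = _ := by ring

end Propagators

/-! ### Test functions and the Fourier transform -/

section TestFunctions

open LineDeriv Laplacian

variable {n : ℕ}

/-- Composition of a Schwartz function with a real-linear map of its values. -/
noncomputable def postcompS {E F : Type*} [NormedAddCommGroup E] [NormedSpace ℝ E]
    [NormedAddCommGroup F] [NormedSpace ℝ F] (L : E →L[ℝ] F) :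
    𝓢(Space n, E) →L[ℝ] 𝓢(Space n, F) :=
  SchwartzMap.bilinLeftCLM (((ContinuousLinearMap.lsmul ℝ ℝ).flip).comp L)
    (Function.HasTemperateGrowth.const (1 : ℝ))

section

variable {E F : Type*} [NormedAddCommGroup E] [NormedSpace ℝ E]
    [NormedAddCommGroup F] [NormedSpace ℝ F] (L : E →L[ℝ] F)

@[simp]
lemma postcompS_apply (f : 𝓢(Space n, E)) (x : Space n) : postcompS L f x = L (f x) := by
  simp [postcompS]

lemma lineDeriv_postcompS (m : Space n) (f : 𝓢(Space n, E)) :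
    ∂_{m} (postcompS L f) = postcompS L (∂_{m} f) := by
  ext x
  rw [SchwartzMap.lineDerivOp_apply_eq_fderiv, postcompS_apply,
    SchwartzMap.lineDerivOp_apply_eq_fderiv]
  have h : HasFDerivAt (fun x => L (f x)) (L.comp (fderiv ℝ f x)) x :=
    L.hasFDerivAt.comp x f.differentiableAt.hasFDerivAt
  have h2 : ⇑(postcompS L f) = fun x => L (f x) := funext (postcompS_apply L f)
  rw [h2, h.fderiv]
  rfl

end

/-- A real test function as a complex one. -/
noncomputable abbrev toC (φ : 𝓢(Space n, ℝ)) : 𝓢(Space n, ℂ) := postcompS Complex.ofRealCLM φ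

/-- The real part of a complex test function. -/
noncomputable abbrev reS (φ : 𝓢(Space n, ℂ)) : 𝓢(Space n, ℝ) := postcompS Complex.reCLM φ

/-- Multiplication of a test function by the `j`-th coordinate. -/
noncomputable def coordMul (j : Fin n) : 𝓢(Space n, ℂ) →L[ℝ] 𝓢(Space n, ℂ) :=
  SchwartzMap.smulLeftCLM ℂ fun x : Space n => inner ℝ x (EuclideanSpace.single j (1 : ℝ))

@[simp]
lemma coordMul_apply (j : Fin n) (f : 𝓢(Space n, ℂ)) (x : Space n) :
    coordMul j f x = (x j : ℂ) * f x := by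
  have : (fun x : Space n => inner ℝ x (EuclideanSpace.single j (1 : ℝ))).HasTemperateGrowth := by
    fun_prop
  rw [coordMul, SchwartzMap.smulLeftCLM_apply_apply this, EuclideanSpace.inner_single_right]
  simp

lemma fourierInv_partialD (j : Fin n) (φ : 𝓢(Space n, ℝ)) (w : Space n) :
    (𝓕⁻ (toC (partialD j φ))) w = -(2 * Real.pi * Complex.I * w j) * (𝓕⁻ (toC φ)) w := by
  have h : toC (partialD j φ) = ∂_{EuclideanSpace.single j (1 : ℝ)} (toC φ) :=
    (lineDeriv_postcompS _ _ _).symm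
  rw [h, SchwartzMap.fourierInv_lineDerivOp_eq]
  have h2 := coordMul_apply j (𝓕⁻ (toC φ)) w
  rw [coordMul] at h2
  rw [smul_apply, h2, smul_eq_mul]
  ring

lemma fourierInv_lap (φ : 𝓢(Space n, ℝ)) (w : Space n) :
    (𝓕⁻ (toC (lap φ))) w = -(((2 * Real.pi * ‖w‖) ^ 2 : ℝ) : ℂ) * (𝓕⁻ (toC φ)) w := by
  have h : lap φ = ∑ j, partialD j (partialD j φ) := by
    simp only [lap, partialD]
    rw [SchwartzMap.laplacian_eq_sum (EuclideanSpace.basisFun (Fin n) ℝ)]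
    simp
  rw [h]
  have h2 : 𝓕⁻ (toC (∑ j, partialD j (partialD j φ)))
      = ∑ j, 𝓕⁻ (toC (partialD j (partialD j φ))) := by
    rw [toC, map_sum]
    exact map_sum (FourierTransform.fourierInvCLM ℂ 𝓢(Space n, ℂ)) _ _
  rw [h2, sum_apply]
  simp only [fourierInv_partialD]
  have h3 : ((‖w‖ ^ 2 : ℝ) : ℂ) = ∑ j, (w j : ℂ) ^ 2 := by
    rw [EuclideanSpace.real_norm_sq_eq]; push_cast; rfl
  have h4 : ((2 * Real.pi * ‖w‖) ^ 2 : ℝ) = (2 * Real.pi) ^ 2 * ‖w‖ ^ 2 := by ring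
  rw [h4]
  push_cast at h3 ⊢
  rw [h3, Finset.mul_sum, ← Finset.sum_neg_distrib, Finset.sum_mul]
  refine Finset.sum_congr rfl fun j _ => ?_
  linear_combination (2 * Real.pi * w j : ℂ) ^ 2 * 𝓕⁻ (toC φ) w * Complex.I_sq

lemma partialD_reS_fourierInv (j : Fin n) (g : 𝓢(Space n, ℂ)) :
    partialD j (reS (𝓕⁻ g)) = reS (𝓕⁻ ((2 * Real.pi * Complex.I) • coordMul j g)) := by
  rw [partialD, lineDeriv_postcompS, SchwartzMap.lineDerivOp_fourierInv_eq]
  rfl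

lemma lap_reS_fourierInv (g : 𝓢(Space n, ℂ)) :
    lap (reS (𝓕⁻ g)) = reS (𝓕⁻ (∑ j, (2 * Real.pi * Complex.I) • coordMul j
      ((2 * Real.pi * Complex.I) • coordMul j g))) := by
  have h : ∀ φ : 𝓢(Space n, ℝ), lap φ = ∑ j, partialD j (partialD j φ) := fun φ => by
    simp only [lap, partialD]
    rw [SchwartzMap.laplacian_eq_sum (EuclideanSpace.basisFun (Fin n) ℝ)]
    simp
  rw [h]
  simp only [partialD_reS_fourierInv]
  rw [reS, ← map_sum]
  congr 1
  exact (map_sum (FourierTransform.fourierInvCLM ℂ 𝓢(Space n, ℂ)) _ _).symm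

end TestFunctions

/-! ### The Fourier transform on `L¹ ∩ L²` -/

section Plancherel

variable {n : ℕ}

lemma integral_mul_fourier_Lp (F : Lp ℂ 2 (volume : Measure (Space n))) (g : 𝓢(Space n, ℂ)) :
    ∫ x, g x * (𝓕 F : Lp ℂ 2 (volume : Measure (Space n))) x = ∫ x, (𝓕 g) x * F x := by
  have h := congrArg (fun T => T g) (Lp.fourier_toTemperedDistribution_eq F)
  simp only [TemperedDistribution.fourier_apply, Lp.toTemperedDistribution_apply, smul_eq_mul] at h
  exact h.symm

lemma integral_mul_fourierInv_Lp (F : Lp ℂ 2 (volume : Measure (Space n))) (g : 𝓢(Space n, ℂ)) :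
    ∫ x, g x * (𝓕⁻ F : Lp ℂ 2 (volume : Measure (Space n))) x = ∫ x, (𝓕⁻ g) x * F x := by
  have h := congrArg (fun T => T g) (Lp.fourierInv_toTemperedDistribution_eq F)
  simp only [TemperedDistribution.fourierInv_apply, Lp.toTemperedDistribution_apply,
    smul_eq_mul] at h
  exact h.symm

lemma locallyIntegrable_Lp (F : Lp ℂ 2 (volume : Measure (Space n))) :
    LocallyIntegrable F volume :=
  (Lp.memLp F).locallyIntegrable (by norm_num)

/-- Two locally integrable functions with the same integrals against Schwartz functions agree. -/
lemma ae_eq_of_schwartz {f g : Space n → ℂ} (hf : LocallyIntegrable f volume)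
    (hg : LocallyIntegrable g volume)
    (h : ∀ φ : 𝓢(Space n, ℂ), HasCompactSupport φ → ∫ x, φ x * f x = ∫ x, φ x * g x) :
    f =ᵐ[volume] g := by
  refine ae_eq_of_integral_contDiff_smul_eq hf hg fun φ hφ hc => ?_
  have hc' : HasCompactSupport fun x => (φ x : ℂ) := hc.comp_left (g := Complex.ofReal) rfl
  have := h (hc'.toSchwartzMap (Complex.ofRealCLM.contDiff.comp hφ)) hc'
  simp only [Complex.real_smul]
  exact this

/-- The Fourier transform of an integrable and square-integrable function is square-integrable, and
is the Fourier transform in `L²`. -/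
lemma fourier_ae_eq_Lp {f : Space n → ℂ} (h1 : MemLp f 1 volume) (h2 : MemLp f 2 volume) :
    (𝓕 f) =ᵐ[volume] (𝓕 (h2.toLp f) : Lp ℂ 2 (volume : Measure (Space n))) := by
  have hint : Integrable f := memLp_one_iff_integrable.1 h1
  have hcont : Continuous (𝓕 f) :=
    VectorFourier.fourierIntegral_continuous Real.continuous_fourierChar continuous_inner hint
  refine ae_eq_of_schwartz hcont.locallyIntegrable (locallyIntegrable_Lp _) fun φ _ => ?_
  rw [integral_mul_fourier_Lp]
  have h := VectorFourier.integral_fourierIntegral_smul_eq_flip (μ := volume) (ν := volume)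
    (L := innerₗ (Space n)) (f := φ) (g := f) Real.continuous_fourierChar continuous_inner
    φ.integrable hint
  simp only [flip_innerₗ, smul_eq_mul] at h
  rw [SchwartzMap.fourier_coe]
  calc ∫ x, φ x * 𝓕 f x = ∫ x, 𝓕 (φ : Space n → ℂ) x * f x := h.symm
    _ = _ := by
      refine integral_congr_ae ?_
      filter_upwards [h2.coeFn_toLp] with x hx
      rw [hx]

/-- The inverse Fourier integral of a function in `L¹ ∩ L²` is its inverse Fourier transform in
`L²`. -/
lemma fourierInv_ae_eq_Lp {f : Space n → ℂ} (h1 : MemLp f 1 volume) (h2 : MemLp f 2 volume) :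
    (𝓕⁻ f) =ᵐ[volume] (𝓕⁻ (h2.toLp f) : Lp ℂ 2 (volume : Measure (Space n))) := by
  have hint : Integrable f := memLp_one_iff_integrable.1 h1
  have hcont : Continuous (𝓕⁻ f) := by
    have : Continuous (𝓕 f) :=
      VectorFourier.fourierIntegral_continuous Real.continuous_fourierChar continuous_inner hint
    have e : 𝓕⁻ f = fun x => 𝓕 f (-x) := funext fun x => Real.fourierInv_eq_fourier_neg f x
    rw [e]; exact this.comp continuous_neg
  refine ae_eq_of_schwartz hcont.locallyIntegrable (locallyIntegrable_Lp _) fun φ _ => ?_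
  rw [integral_mul_fourierInv_Lp]
  have h := VectorFourier.integral_fourierIntegral_smul_eq_flip (μ := volume) (ν := volume)
    (L := -innerₗ (Space n)) (f := φ) (g := f) Real.continuous_fourierChar continuous_inner.neg
    φ.integrable hint
  have hinv : ∀ g : Space n → ℂ, 𝓕⁻ g = VectorFourier.fourierIntegral Real.fourierChar volume
      (-innerₗ (Space n)) g := fun g => rfl
  have hflip : (-innerₗ (Space n)).flip = -innerₗ (Space n) := by
    ext x y; simp [real_inner_comm]
  rw [hflip, ← hinv, ← hinv] at h
  simp only [smul_eq_mul] at h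
  rw [SchwartzMap.fourierInv_coe]
  calc ∫ x, φ x * 𝓕⁻ f x = ∫ x, 𝓕⁻ (φ : Space n → ℂ) x * f x := h.symm
    _ = _ := by
      refine integral_congr_ae ?_
      filter_upwards [h2.coeFn_toLp] with x hx
      rw [hx]

lemma memLp_fourier {f : Space n → ℂ} (h1 : MemLp f 1 volume) (h2 : MemLp f 2 volume) :
    MemLp (𝓕 f) 2 volume :=
  (memLp_congr_ae (fourier_ae_eq_Lp h1 h2)).2 (Lp.memLp _)

lemma eLpNorm_fourier {f : Space n → ℂ} (h1 : MemLp f 1 volume) (h2 : MemLp f 2 volume) :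
    (eLpNorm (𝓕 f) 2 volume).toReal = (eLpNorm f 2 volume).toReal := by
  rw [eLpNorm_congr_ae (fourier_ae_eq_Lp h1 h2), ← Lp.norm_def, Lp.norm_fourier_eq,
    Lp.norm_toLp]

lemma memLp_fourierInv {f : Space n → ℂ} (h1 : MemLp f 1 volume) (h2 : MemLp f 2 volume) :
    MemLp (𝓕⁻ f) 2 volume :=
  (memLp_congr_ae (fourierInv_ae_eq_Lp h1 h2)).2 (Lp.memLp _)

lemma norm_fourier_le {f : Space n → ℂ} (h1 : MemLp f 1 volume) (w : Space n) :
    ‖𝓕 f w‖ ≤ (eLpNorm f 1 volume).toReal := by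
  refine (VectorFourier.norm_fourierIntegral_le_integral_norm _ _ _ _ _).trans ?_
  rw [eLpNorm_one_eq_lintegral_enorm, ← integral_norm_eq_lintegral_enorm h1.1]

lemma continuous_fourier_of_memLp {f : Space n → ℂ} (h1 : MemLp f 1 volume) : Continuous (𝓕 f) :=
  VectorFourier.fourierIntegral_continuous Real.continuous_fourierChar continuous_inner
    (memLp_one_iff_integrable.1 h1)

lemma memLp_ofReal {f : Space n → ℝ} {p : ENNReal} (hf : MemLp f p volume) :
    MemLp (fun x => (f x : ℂ)) p volume := hf.ofReal

/-- A complex pairing is determined by the real ones. -/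
lemma integral_mul_eq_pair {f : Space n → ℝ} (hf : MemLp f 2 volume) (φ : 𝓢(Space n, ℂ)) :
    ∫ x, φ x * (f x : ℂ)
      = (pair f (reS φ) : ℂ) + Complex.I * (pair f (reS (-Complex.I • φ)) : ℂ) := by
  have hint : ∀ ψ : 𝓢(Space n, ℝ), Integrable fun x => f x * ψ x := fun ψ =>
    hf.integrable_mul (ψ.memLp 2)
  have e : ∀ x, φ x * (f x : ℂ) = ((f x * reS φ x : ℝ) : ℂ)
      + Complex.I * ((f x * reS (-Complex.I • φ) x : ℝ) : ℂ) := by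
    intro x
    simp only [postcompS_apply, smul_apply, Complex.reCLM_apply, smul_eq_mul]
    have : (-Complex.I * φ x).re = (φ x).im := by simp
    rw [this]
    apply Complex.ext <;> simp [mul_comm]
  simp_rw [e]
  rw [integral_add ((hint _).ofReal) (((hint _).ofReal).const_mul _), integral_const_mul]
  simp only [pair]
  rw [integral_complex_ofReal, integral_complex_ofReal]

/-- The Fourier transform turns a weak partial derivative into multiplication by `2 π i wⱼ`. -/
lemma fourier_weak_partial {f D : Space n → ℝ} {j : Fin n} (h1 : MemLp f 1 volume)
    (h2 : MemLp f 2 volume) (hD : MemLp D 2 volume)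
    (h : ∀ φ : 𝓢(Space n, ℝ), pair f (partialD j φ) = -pair D φ) :
    (fun w => 2 * Real.pi * Complex.I * w j * 𝓕 (fun x => (f x : ℂ)) w) =ᵐ[volume]
      (𝓕 ((memLp_ofReal hD).toLp fun x => (D x : ℂ)) : Lp ℂ 2 (volume : Measure (Space n))) := by
  have hf1 : MemLp (fun x => (f x : ℂ)) 1 volume := h1.ofReal
  have hf2 : MemLp (fun x => (f x : ℂ)) 2 volume := h2.ofReal
  have hcont := continuous_fourier_of_memLp hf1
  refine ae_eq_of_schwartz (Continuous.locallyIntegrable (by fun_prop)) (locallyIntegrable_Lp _)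
    fun φ _ => ?_
  rw [integral_mul_fourier_Lp]
  have e1 : ∫ x, (𝓕 φ) x * ((memLp_ofReal hD).toLp fun x => (D x : ℂ)) x
      = ∫ x, (𝓕 φ) x * (D x : ℂ) := by
    refine integral_congr_ae ?_
    filter_upwards [(memLp_ofReal hD).coeFn_toLp] with x hx
    rw [hx]
  have hre : ∀ ψ : 𝓢(Space n, ℂ), pair D (reS ψ)
      = -pair f (reS (LineDeriv.lineDerivOp (EuclideanSpace.single j (1 : ℝ)) ψ)) := by
    intro ψ
    have : reS (LineDeriv.lineDerivOp (EuclideanSpace.single j (1 : ℝ)) ψ) = partialD j (reS ψ) :=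
      (lineDeriv_postcompS _ _ _).symm
    rw [this, h, neg_neg]
  rw [e1, integral_mul_eq_pair hD, hre, hre]
  have e2 := integral_mul_eq_pair h2
    (LineDeriv.lineDerivOp (EuclideanSpace.single j (1 : ℝ)) (𝓕 φ) : 𝓢(Space n, ℂ))
  have e3 : LineDeriv.lineDerivOp (EuclideanSpace.single j (1 : ℝ)) (-Complex.I • 𝓕 φ)
      = -Complex.I • (LineDeriv.lineDerivOp (EuclideanSpace.single j (1 : ℝ)) (𝓕 φ)
        : 𝓢(Space n, ℂ)) := LineDeriv.lineDerivOp_smul _ _ _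
  rw [e3]
  have e4 : ∀ a b : ℝ, ((-a : ℝ) : ℂ) + Complex.I * ((-b : ℝ) : ℂ) = -((a : ℂ) + Complex.I * b) :=
    fun a b => by push_cast; ring
  rw [e4, ← e2, SchwartzMap.lineDerivOp_fourier_eq]
  have e5 : ∫ x, (𝓕 (-(2 * Real.pi * Complex.I) • coordMul j φ)) x * (f x : ℂ)
      = ∫ x, (-(2 * Real.pi * Complex.I) • coordMul j φ) x * 𝓕 (fun x => (f x : ℂ)) x := by
    have a1 := integral_mul_fourier_Lp (hf2.toLp _) (-(2 * Real.pi * Complex.I) • coordMul j φ)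
    have a2 : ∫ x, (-(2 * Real.pi * Complex.I) • coordMul j φ) x
          * (𝓕 (hf2.toLp _) : Lp ℂ 2 (volume : Measure (Space n))) x
        = ∫ x, (-(2 * Real.pi * Complex.I) • coordMul j φ) x * 𝓕 (fun x => (f x : ℂ)) x := by
      refine integral_congr_ae ?_
      filter_upwards [fourier_ae_eq_Lp hf1 hf2] with x hx
      rw [hx]
    rw [← a2, a1]
    refine integral_congr_ae ?_
    filter_upwards [hf2.coeFn_toLp] with x hx
    rw [hx]
  have e6 : (SchwartzMap.smulLeftCLM ℂ fun x : Space n =>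
      inner ℝ x (EuclideanSpace.single j (1 : ℝ))) φ = coordMul j φ := rfl
  rw [e6, e5, ← integral_neg]
  refine integral_congr_ae (Eventually.of_forall fun x => ?_)
  simp only [smul_apply, coordMul_apply, smul_eq_mul]
  ring

end Plancherel

/-! ### Uniqueness -/

section Uniqueness

lemma hasDerivWithinAt_of_contDiffOn_two {f : ℝ → ℝ} (hf : ContDiffOn ℝ 2 f (Ici 0)) {t : ℝ}
    (ht : 0 ≤ t) :
    HasDerivWithinAt f (derivWithin f (Ici 0) t) (Ici 0) t ∧
    HasDerivWithinAt (derivWithin f (Ici 0)) (iteratedDerivWithin 2 f (Ici 0) t) (Ici 0) t := by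
  have hu : UniqueDiffOn ℝ (Ici (0 : ℝ)) := uniqueDiffOn_Ici 0
  refine ⟨(hf.differentiableOn (by norm_num) t ht).hasDerivWithinAt, ?_⟩
  have h2 : ContDiffOn ℝ 1 (derivWithin f (Ici 0)) (Ici 0) := hf.derivWithin hu (by norm_num)
  have h3 := (h2.differentiableOn (by norm_num) t ht).hasDerivWithinAt
  have h4 : iteratedDerivWithin 1 f (Ici 0) = derivWithin f (Ici 0) :=
    iteratedDerivWithin_one
  rw [iteratedDerivWithin_succ, h4]
  exact h3

/-- Integration of a bound by a monomial in time. -/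
lemma abs_le_of_deriv_le_pow {f f' : ℝ → ℝ} {B K : ℝ} {m : ℕ} (hK : 0 < K)
    (hf : ∀ t, 0 ≤ t → HasDerivWithinAt f (f' t) (Ici 0) t) (h0 : f 0 = 0) {T : ℝ}
    (hb : ∀ t, 0 ≤ t → t ≤ T → |f' t| ≤ B * ((K * t) ^ m / m.factorial)) {t : ℝ} (ht : 0 ≤ t)
    (htT : t ≤ T) : |f t| ≤ B / K * ((K * t) ^ (m + 1) / (m + 1).factorial) := by
  have hB : ∀ s : ℝ, HasDerivAt (fun s => B / K * ((K * s) ^ (m + 1) / (m + 1).factorial))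
      (B * ((K * s) ^ m / m.factorial)) s := by
    intro s
    have := (((((hasDerivAt_id s).const_mul K).pow (m + 1)).div_const
      ((m + 1).factorial : ℝ)).const_mul (B / K))
    refine this.congr_deriv ?_
    have : ((m + 1).factorial : ℝ) = (m + 1) * m.factorial := by
      rw [Nat.factorial_succ]; push_cast; ring
    rw [this]
    have : (m.factorial : ℝ) ≠ 0 := by exact_mod_cast m.factorial_ne_zero
    have : (m : ℝ) + 1 ≠ 0 := by positivity
    simp only [id, Nat.add_sub_cancel]
    push_cast
    field_simp
  have := image_norm_le_of_norm_deriv_right_le_deriv_boundary (f := f) (f' := f') (a := 0) (b := t)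
    (fun s hs => ((hf s hs.1).continuousWithinAt).mono fun y hy => hy.1)
    (fun s hs => (hf s hs.1).mono fun y hy => hs.1.trans hy)
    (by simp [h0]) hB (fun s hs => hb s hs.1 (hs.2.le.trans htT)) (x := t) ⟨ht, le_rfl⟩
  exact this

/-- Integration of a bound which is monotone in time. -/
lemma abs_le_of_deriv_le_mono {f f' : ℝ → ℝ} {B K : ℝ} {m : ℕ} (hK : 0 < K) (hB : 0 ≤ B)
    (hf : ∀ t, 0 ≤ t → HasDerivWithinAt f (f' t) (Ici 0) t) (h0 : f 0 = 0) {T : ℝ}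
    (hb : ∀ t, 0 ≤ t → t ≤ T → |f' t| ≤ B * ((K * t) ^ m / m.factorial)) {t : ℝ} (ht : 0 ≤ t)
    (htT : t ≤ T) : |f t| ≤ T * B * ((K * t) ^ m / m.factorial) := by
  have := norm_image_sub_le_of_norm_deriv_right_le_segment (f := f) (f' := f') (a := 0) (b := t)
    (C := B * ((K * t) ^ m / m.factorial))
    (fun s hs => ((hf s hs.1).continuousWithinAt).mono fun y hy => hy.1)
    (fun s hs => (hf s hs.1).mono fun y hy => hs.1.trans hy)
    (fun s hs => by
      refine (hb s hs.1 (hs.2.le.trans htT)).trans ?_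
      have := hs.1
      have := hs.2.le
      gcongr) t ⟨ht, le_rfl⟩
  rw [h0, sub_zero, sub_zero, Real.norm_eq_abs] at this
  refine this.trans ?_
  calc _ = t * (B * ((K * t) ^ m / m.factorial)) := by ring
    _ ≤ T * (B * ((K * t) ^ m / m.factorial)) := by gcongr
    _ = _ := by ring

variable {n : ℕ}

/-- The symbol of `∂ⱼ`, acting on test functions on the Fourier side. -/
noncomputable def dF (j : Fin n) (g : 𝓢(Space n, ℂ)) : 𝓢(Space n, ℂ) :=
  (2 * Real.pi * Complex.I) • coordMul j g

/-- The symbol of `Δ`, acting on test functions on the Fourier side. -/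
noncomputable def lapF (g : 𝓢(Space n, ℂ)) : 𝓢(Space n, ℂ) := ∑ j, dF j (dF j g)

/-- Test functions whose Fourier transform lives in the ball of radius `R`. -/
def BandLimited (R : ℝ) (g : 𝓢(Space n, ℂ)) : Prop := ∀ w, g w ≠ 0 → ‖w‖ ≤ R

lemma BandLimited.dF {R : ℝ} {g : 𝓢(Space n, ℂ)} (hg : BandLimited R g) (j : Fin n) :
    BandLimited R (dF j g) := fun w hw => hg w fun h => hw (by simp [ThermoIII.dF, h])

lemma BandLimited.lapF {R : ℝ} {g : 𝓢(Space n, ℂ)} (hg : BandLimited R g) :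
    BandLimited R (lapF g) := fun w hw => hg w fun h => hw (by
      simp [ThermoIII.lapF, ThermoIII.dF, h])

lemma norm_toLp_dF_le {R : ℝ} {g : 𝓢(Space n, ℂ)} (hg : BandLimited R g) (j : Fin n) :
    ‖(dF j g).toLp 2 (volume : Measure (Space n))‖
      ≤ 2 * Real.pi * R * ‖g.toLp 2 (volume : Measure (Space n))‖ := by
  refine Lp.norm_le_mul_norm_of_ae_le_mul ?_
  filter_upwards [g.coeFn_toLp 2 volume, (dF j g).coeFn_toLp 2 volume] with w h1 h2
  rw [h1, h2]
  by_cases hw : g w = 0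
  · simp [dF, hw]
  · have h3 : ‖(w j : ℂ)‖ ≤ R := by
      rw [Complex.norm_real]
      exact (PiLp.norm_apply_le w j).trans (hg w hw)
    have h4 : ‖(2 * Real.pi * Complex.I : ℂ)‖ = 2 * Real.pi := by
      simp [abs_of_pos Real.pi_pos]
    simp only [dF, smul_apply, coordMul_apply, smul_eq_mul, norm_mul _ (_ * _)]
    rw [h4, norm_mul, mul_assoc, mul_assoc, mul_assoc]
    gcongr

lemma norm_toLp_lapF_le {R : ℝ} (hR : 0 ≤ R) {g : 𝓢(Space n, ℂ)} (hg : BandLimited R g) :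
    ‖(lapF g).toLp 2 (volume : Measure (Space n))‖
      ≤ n * (2 * Real.pi * R) ^ 2 * ‖g.toLp 2 (volume : Measure (Space n))‖ := by
  have h : (lapF g).toLp 2 (volume : Measure (Space n))
      = ∑ j, (dF j (dF j g)).toLp 2 (volume : Measure (Space n)) :=
    map_sum (SchwartzMap.toLpCLM ℂ (E := Space n) ℂ 2 volume) _ _
  rw [h]
  refine (norm_sum_le _ _).trans ?_
  have hb : ∀ j ∈ (Finset.univ : Finset (Fin n)),
      ‖(dF j (dF j g)).toLp 2 (volume : Measure (Space n))‖
        ≤ (2 * Real.pi * R) ^ 2 * ‖g.toLp 2 (volume : Measure (Space n))‖ := fun j _ => by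
    refine (norm_toLp_dF_le (hg.dF j) j).trans ?_
    rw [pow_two, mul_assoc (2 * Real.pi * R)]
    have := Real.pi_pos
    exact mul_le_mul_of_nonneg_left (norm_toLp_dF_le hg j) (by positivity)
  refine (Finset.sum_le_card_nsmul _ _ _ hb).trans (le_of_eq ?_)
  rw [Finset.card_univ, Fintype.card_fin, nsmul_eq_mul]
  ring

/-- Picard iteration for the system tested with band-limited functions: with vanishing data, all
pairings vanish. Here `U j g` and `Φ g` stand for the pairings of `u_j` and `θ` with a test function
whose Fourier transform is `g`; on band-limited functions the operators `d j = ∂ⱼ` and `L = Δ` are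
bounded with respect to the norm `N`. -/
lemma picard_vanish {G : Type*} {P : G → Prop} {d : Fin n → G → G} {L : G → G} {N : G → ℝ}
    {b κ γ δ ρ l T M : ℝ} (hκ : 0 ≤ κ) (hδ : 0 ≤ δ) (hρ0 : 0 ≤ ρ) (hl0 : 0 ≤ l) (hT : 0 ≤ T)
    (hM : 0 ≤ M) (hN0 : ∀ g, 0 ≤ N g) (Pd : ∀ j g, P g → P (d j g)) (PL : ∀ g, P g → P (L g))
    (nd : ∀ j g, P g → N (d j g) ≤ ρ * N g) (nl : ∀ g, P g → N (L g) ≤ l * N g)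
    {U V W : Fin n → G → ℝ → ℝ} {Φ Ψ Ω : G → ℝ → ℝ}
    (hU : ∀ j g t, 0 ≤ t → HasDerivWithinAt (U j g) (V j g t) (Ici 0) t)
    (hV : ∀ j g t, 0 ≤ t → HasDerivWithinAt (V j g) (W j g t) (Ici 0) t)
    (hΦ : ∀ g t, 0 ≤ t → HasDerivWithinAt (Φ g) (Ψ g t) (Ici 0) t)
    (hΨ : ∀ g t, 0 ≤ t → HasDerivWithinAt (Ψ g) (Ω g t) (Ici 0) t)
    (eU : ∀ j g t, 0 ≤ t → W j g t = b ^ 2 * U j (L g) t + γ * Φ (d j g) t)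
    (eΦ : ∀ g t, 0 ≤ t → Ω g t = κ * Φ (L g) t + δ * Ψ (L g) t + γ * ∑ j, W j (d j g) t)
    (U0 : ∀ j g, U j g 0 = 0) (V0 : ∀ j g, V j g 0 = 0) (Φ0 : ∀ g, Φ g 0 = 0)
    (Ψ0 : ∀ g, Ψ g 0 = 0)
    (bU : ∀ j g t, 0 ≤ t → t ≤ T → |U j g t| ≤ M * N g)
    (bΦ : ∀ g t, 0 ≤ t → t ≤ T → |Φ g t| ≤ M * N g)
    {g : G} (hg : P g) {t : ℝ} (ht : 0 ≤ t) (htT : t ≤ T) : Φ g t = 0 := by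
  obtain ⟨a₁, ha₁⟩ : ∃ x, x = T * (b ^ 2 * l + |γ| * ρ) := ⟨_, rfl⟩
  have ha₁0 : 0 ≤ a₁ := by rw [ha₁]; positivity
  obtain ⟨a₂, ha₂⟩ : ∃ x, x = T * (κ * l) + δ * l + |γ| * (n * (ρ * a₁)) := ⟨_, rfl⟩
  have ha₂0 : 0 ≤ a₂ := by rw [ha₂]; positivity
  obtain ⟨K, hK⟩ : ∃ x, x = a₁ + a₂ + 1 := ⟨_, rfl⟩
  have hK0 : 0 < K := by rw [hK]; positivity
  have main : ∀ m : ℕ, ∀ g, P g → ∀ t, 0 ≤ t → t ≤ T →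
      (∀ j, |U j g t| ≤ M * N g * ((K * t) ^ m / m.factorial)) ∧
        |Φ g t| ≤ M * N g * ((K * t) ^ m / m.factorial) := by
    intro m
    induction m with
    | zero =>
      intro g _ t ht htT
      simpa using ⟨fun j => bU j g t ht htT, bΦ g t ht htT⟩
    | succ m ih =>
      -- the bound for `U` at the next order, for every test function
      have stepU : ∀ g, P g → ∀ t, 0 ≤ t → t ≤ T → ∀ j,
          |U j g t| ≤ a₁ * (M * N g) / K * ((K * t) ^ (m + 1) / (m + 1).factorial) := by
        intro g hg t ht htT j
        have hW : ∀ s, 0 ≤ s → s ≤ T →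
            |W j g s| ≤ (b ^ 2 * l + |γ| * ρ) * (M * N g) * ((K * s) ^ m / m.factorial) := by
          intro s hs hsT
          have e0 : 0 ≤ (K * s) ^ m / m.factorial := by positivity
          have h1 := (ih _ (PL _ hg) s hs hsT).1 j
          have h2 := (ih _ (Pd j _ hg) s hs hsT).2
          rw [eU j g s hs]
          refine (abs_add_le _ _).trans ?_
          rw [abs_mul, abs_mul, abs_of_nonneg (sq_nonneg b)]
          calc _ ≤ b ^ 2 * (M * (l * N g) * ((K * s) ^ m / m.factorial))
                + |γ| * (M * (ρ * N g) * ((K * s) ^ m / m.factorial)) := by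
                gcongr
                · exact h1.trans (by gcongr; exact nl g hg)
                · exact h2.trans (by gcongr; exact nd j g hg)
            _ = _ := by ring
        have hVb := fun s hs hsT => abs_le_of_deriv_le_mono hK0
          (mul_nonneg (by positivity) (mul_nonneg hM (hN0 g))) (hV j g) (V0 j g) hW (t := s) hs hsT
        have := abs_le_of_deriv_le_pow hK0 (hU j g) (U0 j g) hVb ht htT
        calc _ ≤ _ := this
          _ = _ := by rw [ha₁]; ring
      intro g hg t ht htT
      have e1 : 0 ≤ (K * t) ^ (m + 1) / (m + 1).factorial := by positivity
      have hMN : 0 ≤ M * N g := mul_nonneg hM (hN0 g)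
      have hK1 : a₁ / K ≤ 1 := (div_le_one hK0).2 (by rw [hK]; linarith)
      have hK2 : a₂ / K ≤ 1 := (div_le_one hK0).2 (by rw [hK]; linarith)
      refine ⟨fun j => (stepU g hg t ht htT j).trans ?_, ?_⟩
      · calc _ = a₁ / K * (M * N g * ((K * t) ^ (m + 1) / (m + 1).factorial)) := by ring
          _ ≤ 1 * (M * N g * ((K * t) ^ (m + 1) / (m + 1).factorial)) := by gcongr
          _ = _ := one_mul _
      · set H : ℝ → ℝ := fun t => Φ g t - γ * ∑ j, U j (d j g) t with hH
        set Q : ℝ → ℝ := fun t => Ψ g t - γ * ∑ j, V j (d j g) t - δ * Φ (L g) t with hQ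
        have hHd : ∀ s, 0 ≤ s → HasDerivWithinAt H (Q s + δ * Φ (L g) s) (Ici 0) s := by
          intro s hs
          refine ((hΦ g s hs).sub ((HasDerivWithinAt.fun_sum fun j _ =>
            hU j (d j g) s hs).const_mul γ)).congr_deriv ?_
          simp only [hQ]; ring
        have hQd : ∀ s, 0 ≤ s → HasDerivWithinAt Q (κ * Φ (L g) s) (Ici 0) s := by
          intro s hs
          refine (((hΨ g s hs).sub ((HasDerivWithinAt.fun_sum fun j _ =>
            hV j (d j g) s hs).const_mul γ)).sub ((hΦ (L g) s hs).const_mul δ)).congr_deriv ?_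
          rw [eΦ g s hs]; ring
        have hH0 : H 0 = 0 := by simp [hH, Φ0, U0]
        have hQ0 : Q 0 = 0 := by simp [hQ, Φ0, V0, Ψ0]
        have hΦl : ∀ s, 0 ≤ s → s ≤ T →
            |Φ (L g) s| ≤ l * (M * N g) * ((K * s) ^ m / m.factorial) := by
          intro s hs hsT
          refine ((ih _ (PL _ hg) s hs hsT).2).trans ?_
          calc _ ≤ M * (l * N g) * ((K * s) ^ m / m.factorial) := by gcongr; exact nl g hg
            _ = _ := by ring
        have hQb : ∀ s, 0 ≤ s → s ≤ T →
            |Q s| ≤ T * (κ * l * (M * N g)) * ((K * s) ^ m / m.factorial) := fun s hs hsT =>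
          abs_le_of_deriv_le_mono hK0 (by positivity) hQd hQ0 (fun s hs hsT => by
            rw [abs_mul, abs_of_nonneg hκ, mul_assoc κ, mul_assoc κ]
            gcongr
            exact hΦl s hs hsT) hs hsT
        have hHb := abs_le_of_deriv_le_pow hK0 hHd hH0
          (B := T * (κ * l * (M * N g)) + δ * (l * (M * N g))) (m := m) (T := T)
          (fun s hs hsT => by
            refine (abs_add_le _ _).trans ?_
            rw [abs_mul, abs_of_nonneg hδ, add_mul, mul_assoc δ]
            gcongr
            · exact hQb s hs hsT
            · exact hΦl s hs hsT) ht htT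
        have hsum : |∑ j, U j (d j g) t|
            ≤ n * (ρ * (a₁ * (M * N g)) / K * ((K * t) ^ (m + 1) / (m + 1).factorial)) := by
          refine (Finset.abs_sum_le_sum_abs _ _).trans ?_
          have : ∀ j ∈ (Finset.univ : Finset (Fin n)), |U j (d j g) t|
              ≤ ρ * (a₁ * (M * N g)) / K * ((K * t) ^ (m + 1) / (m + 1).factorial) := fun j _ => by
            refine (stepU _ (Pd j _ hg) t ht htT j).trans ?_
            calc _ ≤ a₁ * (M * (ρ * N g)) / K * ((K * t) ^ (m + 1) / (m + 1).factorial) := by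
                  gcongr; exact nd j g hg
              _ = _ := by ring
          refine (Finset.sum_le_card_nsmul _ _ _ this).trans (le_of_eq ?_)
          rw [Finset.card_univ, Fintype.card_fin, nsmul_eq_mul]
        have hΦH : Φ g t = H t + γ * ∑ j, U j (d j g) t := by simp only [hH]; ring
        rw [hΦH]
        refine (abs_add_le _ _).trans ?_
        rw [abs_mul]
        calc _ ≤ (T * (κ * l * (M * N g)) + δ * (l * (M * N g))) / K
                * ((K * t) ^ (m + 1) / (m + 1).factorial)
              + |γ| * (n * (ρ * (a₁ * (M * N g)) / K * ((K * t) ^ (m + 1) / (m + 1).factorial))) := by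
              gcongr
          _ = a₂ / K * (M * N g * ((K * t) ^ (m + 1) / (m + 1).factorial)) := by rw [ha₂]; ring
          _ ≤ 1 * (M * N g * ((K * t) ^ (m + 1) / (m + 1).factorial)) := by gcongr
          _ = _ := one_mul _
  have hlim : Tendsto (fun m : ℕ => M * N g * ((K * t) ^ m / m.factorial)) atTop (nhds 0) := by
    simpa using (FloorSemiring.tendsto_pow_div_factorial_atTop (K * t)).const_mul (M * N g)
  have := ge_of_tendsto' hlim fun m => (main m g hg t ht htT).2
  exact abs_nonpos_iff.1 this

lemma pair_sub_of_memLp {f g : Space n → ℝ} (hf : MemLp f 2 volume) (hg : MemLp g 2 volume)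
    (φ : 𝓢(Space n, ℝ)) : pair f φ - pair g φ = pair (fun x => f x - g x) φ := by
  simp only [pair]
  have h1 : Integrable (fun x => f x * φ x) := hf.integrable_mul (φ.memLp 2)
  have h2 : Integrable (fun x => g x * φ x) := hg.integrable_mul (φ.memLp 2)
  rw [← integral_sub h1 h2]
  exact integral_congr_ae (Eventually.of_forall fun x => (sub_mul _ _ _).symm)

lemma abs_pair_reS_fourierInv_le {f : Space n → ℝ} (hf : MemLp f 2 volume) (g : 𝓢(Space n, ℂ)) :
    |pair f (reS (𝓕⁻ g))|
      ≤ (eLpNorm f 2 volume).toReal * ‖g.toLp 2 (volume : Measure (Space n))‖ := by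
  have h1 : pair f (reS (𝓕⁻ g)) = inner ℝ ((reS (𝓕⁻ g)).toLp 2 (volume : Measure (Space n)))
      (hf.toLp f) := by
    rw [L2.inner_def, pair]
    refine integral_congr_ae ?_
    filter_upwards [hf.coeFn_toLp, (reS (𝓕⁻ g)).coeFn_toLp 2 volume] with x h1 h2
    rw [h1, h2]; simp
  rw [h1]
  refine (abs_real_inner_le_norm _ _).trans ?_
  rw [mul_comm, Lp.norm_toLp]
  gcongr
  have h2 : ‖(𝓕⁻ g).toLp 2 (volume : Measure (Space n))‖
      = ‖g.toLp 2 (volume : Measure (Space n))‖ := by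
    rw [← SchwartzMap.toLp_fourierInv_eq, ← Lp.norm_fourier_eq, FourierTransform.fourier_fourierInv_eq]
  rw [← h2]
  refine Lp.norm_le_norm_of_ae_le ?_
  filter_upwards [(𝓕⁻ g).coeFn_toLp 2 volume, (reS (𝓕⁻ g)).coeFn_toLp 2 volume] with x h1 h2
  rw [h1, h2, postcompS_apply]
  exact Complex.abs_re_le_norm _

lemma memLp_component (f : Lp (Space n) 2 (volume : Measure (Space n))) (j : Fin n) :
    MemLp (fun x => f x j) 2 volume ∧
      (eLpNorm (fun x => f x j) 2 volume).toReal ≤ ‖f‖ := by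
  have hm : MemLp (fun x => f x j) 2 volume :=
    (Lp.memLp f).of_le ((EuclideanSpace.proj (𝕜 := ℝ) j).continuous.comp_aestronglyMeasurable
      (Lp.aestronglyMeasurable f)) (Eventually.of_forall fun x => PiLp.norm_apply_le (f x) j)
  refine ⟨hm, ?_⟩
  rw [Lp.norm_def]
  exact ENNReal.toReal_mono (Lp.eLpNorm_ne_top f)
    (eLpNorm_mono fun x => PiLp.norm_apply_le (f x) j)

/-- The temperature of a solution is determined by the data. -/
lemma IsSolution.theta_unique {b κ γ δ : ℝ} (hκ : 0 ≤ κ) (hδ : 0 ≤ δ)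
    {u₀ u₁ : Space n → Space n} {θ₀ θ₁ : Space n → ℝ}
    {u u' : ℝ → Lp (Space n) 2 (volume : Measure (Space n))}
    {θ θ' : ℝ → Lp ℝ 2 (volume : Measure (Space n))}
    (h : IsSolution b κ γ δ u₀ u₁ θ₀ θ₁ u θ) (h' : IsSolution b κ γ δ u₀ u₁ θ₀ θ₁ u' θ')
    {t : ℝ} (ht : 0 ≤ t) : θ t = θ' t := by
  -- bounds on the solutions on `[0, t]`
  have hbd : ∃ M, 0 ≤ M ∧ ∀ s, 0 ≤ s → s ≤ t →
      ‖u s‖ ≤ M ∧ ‖u' s‖ ≤ M ∧ ‖θ s‖ ≤ M ∧ ‖θ' s‖ ≤ M := by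
    have hsub : Icc 0 t ⊆ Ici 0 := fun x hx => hx.1
    obtain ⟨M₁, h₁⟩ := isCompact_Icc.exists_bound_of_continuousOn (h.continuous_u.mono hsub)
    obtain ⟨M₂, h₂⟩ := isCompact_Icc.exists_bound_of_continuousOn (h'.continuous_u.mono hsub)
    obtain ⟨M₃, h₃⟩ := isCompact_Icc.exists_bound_of_continuousOn (h.continuous_θ.mono hsub)
    obtain ⟨M₄, h₄⟩ := isCompact_Icc.exists_bound_of_continuousOn (h'.continuous_θ.mono hsub)
    have p := fun s (hs : 0 ≤ s) (hst : s ≤ t) =>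
      (⟨h₁ s ⟨hs, hst⟩, h₂ s ⟨hs, hst⟩, h₃ s ⟨hs, hst⟩, h₄ s ⟨hs, hst⟩⟩ :
        ‖u s‖ ≤ M₁ ∧ ‖u' s‖ ≤ M₂ ∧ ‖θ s‖ ≤ M₃ ∧ ‖θ' s‖ ≤ M₄)
    have q := p 0 le_rfl ht
    have n1 := (norm_nonneg _).trans q.1
    have n2 := (norm_nonneg _).trans q.2.1
    have n3 := (norm_nonneg _).trans q.2.2.1
    have n4 := (norm_nonneg _).trans q.2.2.2
    refine ⟨M₁ + M₂ + M₃ + M₄, by positivity, fun s hs hst => ?_⟩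
    obtain ⟨a1, a2, a3, a4⟩ := p s hs hst
    exact ⟨by linarith, by linarith, by linarith, by linarith⟩
  obtain ⟨M, hM, hbd⟩ := hbd
  have e1 : ∀ (j : Fin n) (g : 𝓢(Space n, ℂ)), partialD j (reS (𝓕⁻ g)) = reS (𝓕⁻ (dF j g)) :=
    partialD_reS_fourierInv
  have e2 : ∀ g : 𝓢(Space n, ℂ), lap (reS (𝓕⁻ g)) = reS (𝓕⁻ (lapF g)) := lap_reS_fourierInv
  have key : ∀ g : 𝓢(Space n, ℂ), HasCompactSupport g →
      pair (θ t) (reS (𝓕⁻ g)) = pair (θ' t) (reS (𝓕⁻ g)) := by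
    intro g hgc
    obtain ⟨R, hR⟩ := hgc.isCompact.isBounded.exists_norm_le
    have hR' : BandLimited (max R 0) g := fun w hw =>
      (hR w (subset_tsupport _ hw)).trans (le_max_left _ _)
    rw [← sub_eq_zero]
    refine picard_vanish (G := 𝓢(Space n, ℂ)) (P := BandLimited (max R 0)) (d := dF) (L := lapF)
      (N := fun g => ‖g.toLp 2 (volume : Measure (Space n))‖) (b := b) (κ := κ) (γ := γ) (δ := δ)
      (T := t) (M := M + M) hκ hδ
      (by positivity : 0 ≤ 2 * Real.pi * max R 0)
      (by positivity : 0 ≤ n * (2 * Real.pi * max R 0) ^ 2) ht (by positivity)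
      (fun g => norm_nonneg _) (fun j g h => h.dF j) (fun g h => h.lapF)
      (fun j g h => norm_toLp_dF_le h j) (fun g h => norm_toLp_lapF_le (le_max_right R 0) h)
      (U := fun j g s => pair (fun x => u s x j) (reS (𝓕⁻ g)) - pair (fun x => u' s x j) (reS (𝓕⁻ g)))
      (V := fun j g s => derivWithin (fun s => pair (fun x => u s x j) (reS (𝓕⁻ g))) (Ici 0) s
        - derivWithin (fun s => pair (fun x => u' s x j) (reS (𝓕⁻ g))) (Ici 0) s)
      (W := fun j g s => iteratedDerivWithin 2 (fun s => pair (fun x => u s x j) (reS (𝓕⁻ g))) (Ici 0) s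
        - iteratedDerivWithin 2 (fun s => pair (fun x => u' s x j) (reS (𝓕⁻ g))) (Ici 0) s)
      (Φ := fun g s => pair (θ s) (reS (𝓕⁻ g)) - pair (θ' s) (reS (𝓕⁻ g)))
      (Ψ := fun g s => derivWithin (fun s => pair (θ s) (reS (𝓕⁻ g))) (Ici 0) s
        - derivWithin (fun s => pair (θ' s) (reS (𝓕⁻ g))) (Ici 0) s)
      (Ω := fun g s => iteratedDerivWithin 2 (fun s => pair (θ s) (reS (𝓕⁻ g))) (Ici 0) s
        - iteratedDerivWithin 2 (fun s => pair (θ' s) (reS (𝓕⁻ g))) (Ici 0) s)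
      ?_ ?_ ?_ ?_ ?_ ?_ ?_ ?_ ?_ ?_ ?_ ?_ hR' ht le_rfl
    · exact fun j g s hs => (hasDerivWithinAt_of_contDiffOn_two (h.contDiff_u j _) hs).1.sub
        (hasDerivWithinAt_of_contDiffOn_two (h'.contDiff_u j _) hs).1
    · exact fun j g s hs => (hasDerivWithinAt_of_contDiffOn_two (h.contDiff_u j _) hs).2.sub
        (hasDerivWithinAt_of_contDiffOn_two (h'.contDiff_u j _) hs).2
    · exact fun g s hs => (hasDerivWithinAt_of_contDiffOn_two (h.contDiff_θ _) hs).1.sub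
        (hasDerivWithinAt_of_contDiffOn_two (h'.contDiff_θ _) hs).1
    · exact fun g s hs => (hasDerivWithinAt_of_contDiffOn_two (h.contDiff_θ _) hs).2.sub
        (hasDerivWithinAt_of_contDiffOn_two (h'.contDiff_θ _) hs).2
    · intro j g s hs
      have a1 := h.eq_u j (reS (𝓕⁻ g)) s hs
      have a2 := h'.eq_u j (reS (𝓕⁻ g)) s hs
      rw [e1, e2] at a1 a2
      linear_combination a1 - a2
    · intro g s hs
      have a1 := h.eq_θ (reS (𝓕⁻ g)) s hs
      have a2 := h'.eq_θ (reS (𝓕⁻ g)) s hs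
      simp only [e1, e2] at a1 a2
      rw [Finset.sum_sub_distrib]
      linear_combination a1 - a2
    · intro j g
      rw [sub_eq_zero]
      refine integral_congr_ae ?_
      filter_upwards [h.init_u, h'.init_u] with x h1 h2
      simp only [h1, h2]
    · intro j g
      simp only [h.init_ut, h'.init_ut, sub_self]
    · intro g
      rw [sub_eq_zero]
      refine integral_congr_ae ?_
      filter_upwards [h.init_θ, h'.init_θ] with x h1 h2
      simp only [h1, h2]
    · intro g
      simp only [h.init_θt, h'.init_θt, sub_self]
    · intro j g s hs hst
      obtain ⟨b1, b2, -, -⟩ := hbd s hs hst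
      have m1 := memLp_component (u s) j
      have m2 := memLp_component (u' s) j
      refine (abs_sub _ _).trans ?_
      rw [add_mul]
      refine add_le_add ((abs_pair_reS_fourierInv_le m1.1 g).trans ?_)
        ((abs_pair_reS_fourierInv_le m2.1 g).trans ?_)
      · gcongr; exact m1.2.trans b1
      · gcongr; exact m2.2.trans b2
    · intro g s hs hst
      obtain ⟨-, -, b1, b2⟩ := hbd s hs hst
      refine (abs_sub _ _).trans ?_
      rw [add_mul]
      refine add_le_add ((abs_pair_reS_fourierInv_le (Lp.memLp (θ s)) g).trans ?_)
        ((abs_pair_reS_fourierInv_le (Lp.memLp (θ' s)) g).trans ?_)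
      · rw [← Lp.norm_def]; gcongr
      · rw [← Lp.norm_def]; gcongr
  -- band-limited test functions separate points
  have hF : MemLp (fun x => θ t x - θ' t x) 2 volume := (Lp.memLp (θ t)).sub (Lp.memLp (θ' t))
  have hFC := memLp_ofReal hF
  have hz : (𝓕⁻ (hFC.toLp _) : Lp ℂ 2 (volume : Measure (Space n))) =ᵐ[volume] 0 := by
    refine ae_eq_of_schwartz (locallyIntegrable_Lp _)
      (continuous_const (y := (0 : ℂ))).locallyIntegrable fun φ hφ => ?_
    rw [integral_mul_fourierInv_Lp]
    have a1 : ∫ x, (𝓕⁻ φ) x * (hFC.toLp _) x = ∫ x, (𝓕⁻ φ) x * ((θ t x - θ' t x : ℝ) : ℂ) := by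
      refine integral_congr_ae ?_
      filter_upwards [hFC.coeFn_toLp] with x hx
      rw [hx]
    have a2 : -Complex.I • 𝓕⁻ φ = 𝓕⁻ (-Complex.I • φ) :=
      (map_smul (FourierTransform.fourierInvCLM ℂ 𝓢(Space n, ℂ)) (-Complex.I) φ).symm
    have a3 : HasCompactSupport (-Complex.I • φ : 𝓢(Space n, ℂ)) := by
      exact hφ.smul_left (f := fun _ => -Complex.I)
    rw [a1, integral_mul_eq_pair hF, a2, ← pair_sub_of_memLp (Lp.memLp (θ t)) (Lp.memLp (θ' t)),
      ← pair_sub_of_memLp (Lp.memLp (θ t)) (Lp.memLp (θ' t)), key φ hφ, key _ a3]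
    simp
  have hz2 : (𝓕⁻ (hFC.toLp _) : Lp ℂ 2 (volume : Measure (Space n))) = 0 :=
    (Lp.eq_zero_iff_ae_eq_zero).2 hz
  have hz3 : (hFC.toLp _ : Lp ℂ 2 (volume : Measure (Space n))) = 0 := by
    have h4 : 𝓕 (𝓕⁻ (hFC.toLp _) : Lp ℂ 2 (volume : Measure (Space n))) = hFC.toLp _ :=
      FourierTransform.fourier_fourierInv_eq _
    rw [← norm_eq_zero, ← h4, Lp.norm_fourier_eq, hz2, norm_zero]
  refine Lp.ext ?_
  filter_upwards [hFC.coeFn_toLp, (Lp.eq_zero_iff_ae_eq_zero).1 hz3] with x h1 h2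
  rw [h2] at h1
  have h3 : ((θ t x - θ' t x : ℝ) : ℂ) = 0 := h1.symm
  exact sub_eq_zero.1 (by exact_mod_cast h3)

end Uniqueness

/-! ### Square-integrable paths on the Fourier side -/

section Paths

lemma toReal_eLpNorm_two_sq {α F : Type*} [MeasurableSpace α] {μ : Measure α}
    [NormedAddCommGroup F] {f : α → F} (hf : MemLp f 2 μ) :
    (eLpNorm f 2 μ).toReal ^ 2 = ∫ x, ‖f x‖ ^ 2 ∂μ := by
  rw [hf.eLpNorm_eq_integral_rpow_norm (by norm_num) (by norm_num)]
  have h0 : 0 ≤ ∫ x, ‖f x‖ ^ 2 ∂μ := integral_nonneg fun x => by positivity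
  simp only [ENNReal.toReal_ofNat, Real.rpow_ofNat]
  rw [ENNReal.toReal_ofReal (by positivity), ← Real.rpow_natCast, ← Real.rpow_mul h0]
  norm_num

/-- Differentiation under the integral sign on the half-line, including at its end point. -/
lemma hasDerivWithinAt_integral_Ici {α E : Type*} [MeasurableSpace α] {μ : Measure α}
    [NormedAddCommGroup E] [NormedSpace ℝ E] {F F' : ℝ → α → E} {t : ℝ} (ht : 0 ≤ t)
    (hint : ∀ s, 0 ≤ s → Integrable (F s) μ) {bound : α → ℝ} (hb : Integrable bound μ)
    (hd : ∀ a s, 0 ≤ s → HasDerivWithinAt (fun s => F s a) (F' s a) (Ici 0) s)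
    (hbd : ∀ a s, 0 ≤ s → s ≤ t + 1 → ‖F' s a‖ ≤ bound a) :
    HasDerivWithinAt (fun s => ∫ a, F s a ∂μ) (∫ a, F' t a ∂μ) (Ici 0) t := by
  rw [hasDerivWithinAt_iff_tendsto_slope]
  have hmem : ∀ᶠ s in nhdsWithin t (Ici 0 \ {t}), s ∈ Icc 0 (t + 1) := by
    have h1 : ∀ᶠ s in nhdsWithin t (Ici 0 \ {t}), s ∈ Ici (0 : ℝ) \ {t} := self_mem_nhdsWithin
    have h2 : ∀ᶠ s in nhdsWithin t (Ici 0 \ {t}), s < t + 1 :=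
      nhdsWithin_le_nhds (Iio_mem_nhds (by linarith))
    filter_upwards [h1, h2] with s hs hs'
    exact ⟨hs.1, hs'.le⟩
  have heq : ∀ᶠ s in nhdsWithin t (Ici 0 \ {t}),
      ∫ a, slope (fun s => F s a) t s ∂μ = slope (fun s => ∫ a, F s a ∂μ) t s := by
    filter_upwards [hmem] with s hs
    simp only [slope, vsub_eq_sub]
    rw [integral_smul, integral_sub (hint s hs.1) (hint t ht)]
  refine Tendsto.congr' heq ?_
  refine tendsto_integral_filter_of_dominated_convergence bound ?_ ?_ hb ?_
  · filter_upwards [hmem] with s hs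
    exact (((hint s hs.1).sub (hint t ht)).smul (s - t)⁻¹).aestronglyMeasurable
  · filter_upwards [hmem] with s hs
    refine Eventually.of_forall fun a => ?_
    have h := Convex.norm_image_sub_le_of_norm_hasDerivWithin_le (f := fun s => F s a)
      (f' := fun s => F' s a) (s := Icc 0 (t + 1)) (C := bound a) (x := t) (y := s)
      (fun x hx => (hd a x hx.1).mono fun y hy => hy.1) (fun x hx => hbd a x hx.1 hx.2)
      (convex_Icc _ _) ⟨ht, by linarith⟩ hs
    have hb0 : 0 ≤ bound a := (norm_nonneg _).trans (hbd a t ht (by linarith))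
    simp only [slope, vsub_eq_sub]
    rw [norm_smul, norm_inv]
    rcases eq_or_ne s t with rfl | hne
    · simpa using hb0
    · rw [inv_mul_le_iff₀ (norm_pos_iff.2 (sub_ne_zero.2 hne)), mul_comm]
      exact h
  · exact Eventually.of_forall fun a => hasDerivWithinAt_iff_tendsto_slope.1 (hd a t ht)

variable {n : ℕ}

/-- Continuity in `L²` by dominated convergence. -/
lemma continuousOn_toLp_max {X : ℝ → Space n → ℂ} (hX : ∀ t, 0 ≤ t → MemLp (X t) 2 volume)
    (hc : ∀ w, Continuous fun t => X t w) {D : Space n → ℝ} (hD : MemLp D 2 volume)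
    (hb : ∀ T, ∃ C, ∀ w t, 0 ≤ t → t ≤ T → ‖X t w‖ ≤ C * D w) :
    ContinuousOn (fun t => (hX (max t 0) (le_max_right t 0)).toLp (X (max t 0))) (Ici 0) := by
  intro t ht
  have ht' : 0 ≤ t := ht
  obtain ⟨C, hC⟩ := hb (t + 1)
  rw [ContinuousWithinAt, tendsto_iff_norm_sub_tendsto_zero]
  have hmem : ∀ᶠ s in nhdsWithin t (Ici 0), s ∈ Icc 0 (t + 1) := by
    have h1 : ∀ᶠ s in nhdsWithin t (Ici 0), s ∈ Ici (0 : ℝ) := self_mem_nhdsWithin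
    have h2 : ∀ᶠ s in nhdsWithin t (Ici 0), s < t + 1 :=
      nhdsWithin_le_nhds (Iio_mem_nhds (by linarith))
    filter_upwards [h1, h2] with s hs hs'
    exact ⟨hs, hs'.le⟩
  have hsq : Tendsto (fun s => ∫ w, ‖X s w - X t w‖ ^ 2) (nhdsWithin t (Ici 0)) (nhds 0) := by
    have : (0 : ℝ) = ∫ w : Space n, ‖X t w - X t w‖ ^ 2 := by simp
    rw [show nhds (0 : ℝ) = nhds (∫ w : Space n, ‖X t w - X t w‖ ^ 2) by rw [← this]]
    refine tendsto_integral_filter_of_dominated_convergence (fun w => ‖(2 * C) • D w‖ ^ 2)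
      ?_ ?_ ?_ ?_
    · filter_upwards [hmem] with s hs
      exact (((hX s hs.1).sub (hX t ht)).norm.integrable_sq).aestronglyMeasurable
    · filter_upwards [hmem] with s hs
      refine Eventually.of_forall fun w => ?_
      rw [norm_pow, norm_norm]
      have h1 := hC w s hs.1 hs.2
      have h2 := hC w t ht (by linarith)
      have h3 := norm_sub_le (X s w) (X t w)
      have h4 : (2 * C) • D w = C * D w + C * D w := by rw [smul_eq_mul]; ring
      have h5 : ‖X s w - X t w‖ ≤ ‖(2 * C) • D w‖ := by
        rw [h4]; exact (by linarith : _ ≤ C * D w + C * D w).trans (le_abs_self _)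
      gcongr
    · exact ((hD.const_smul (2 * C)).norm).integrable_sq
    · refine Eventually.of_forall fun w => ?_
      exact ((((hc w).sub continuous_const).norm.pow 2).tendsto t).mono_left nhdsWithin_le_nhds
  have hsqrt := (Real.continuous_sqrt.tendsto 0).comp hsq
  rw [Real.sqrt_zero] at hsqrt
  refine hsqrt.congr' ?_
  filter_upwards [hmem] with s hs
  rw [← MemLp.toLp_sub, Lp.norm_toLp, Function.comp_apply]
  have h1 := toReal_eLpNorm_two_sq ((hX (max s 0) (le_max_right s 0)).sub
    (hX (max t 0) (le_max_right t 0)))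
  have h2 : ∫ w, ‖X s w - X t w‖ ^ 2 = ∫ w, ‖(X (max s 0) - X (max t 0)) w‖ ^ 2 := by
    rw [max_eq_left hs.1, max_eq_left ht']; rfl
  rw [h2, ← h1, Real.sqrt_sq ENNReal.toReal_nonneg]

lemma norm_fourierInv_Lp (F : Lp ℂ 2 (volume : Measure (Space n))) :
    ‖(𝓕⁻ F : Lp ℂ 2 (volume : Measure (Space n)))‖ = ‖F‖ := by
  have h : 𝓕 (𝓕⁻ F : Lp ℂ 2 (volume : Measure (Space n))) = F :=
    FourierTransform.fourier_fourierInv_eq _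
  rw [← Lp.norm_fourier_eq, h]

lemma integrable_schwartz_mul {F : Space n → ℂ} (hF : MemLp F 2 volume) (ψ : 𝓢(Space n, ℂ)) :
    Integrable fun x => ψ x * F x :=
  (ψ.memLp 2 volume).integrable_mul hF

/-- The real part of the inverse Fourier transform of a path in `L²`, frozen for negative times. -/
noncomputable def realPath (X : ℝ → Space n → ℂ) (hX : ∀ t, 0 ≤ t → MemLp (X t) 2 volume) (t : ℝ) :
    Lp ℝ 2 (volume : Measure (Space n)) :=
  Complex.reCLM.compLpL 2 volume
    (𝓕⁻ ((hX (max t 0) (le_max_right t 0)).toLp (X (max t 0))) : Lp ℂ 2 (volume : Measure (Space n)))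

variable {X : ℝ → Space n → ℂ} (hX : ∀ t, 0 ≤ t → MemLp (X t) 2 volume)

lemma realPath_ae (t : ℝ) (ht : 0 ≤ t) : realPath X hX t =ᵐ[volume]
    fun x => ((𝓕⁻ ((hX t ht).toLp (X t)) : Lp ℂ 2 (volume : Measure (Space n))) x).re := by
  have h := Complex.reCLM.coeFn_compLpL (𝓕⁻ ((hX (max t 0) (le_max_right t 0)).toLp (X (max t 0))) :
    Lp ℂ 2 (volume : Measure (Space n)))
  have h2 : (hX (max t 0) (le_max_right t 0)).toLp (X (max t 0)) = (hX t ht).toLp (X t) := by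
    congr 1; rw [max_eq_left ht]
  rw [h2] at h
  simp only [realPath]
  rw [h2]
  exact h

lemma continuousOn_realPath (hc : ∀ w, Continuous fun t => X t w) {D : Space n → ℝ}
    (hD : MemLp D 2 volume) (hb : ∀ T, ∃ C, ∀ w t, 0 ≤ t → t ≤ T → ‖X t w‖ ≤ C * D w) :
    ContinuousOn (realPath X hX) (Ici 0) := by
  have h1 := continuousOn_toLp_max hX hc hD hb
  have h2 : Continuous fun F : Lp ℂ 2 (volume : Measure (Space n)) =>
      (𝓕⁻ F : Lp ℂ 2 (volume : Measure (Space n))) :=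
    (FourierTransform.fourierInvCLM ℂ (Lp ℂ 2 (volume : Measure (Space n)))).continuous
  exact ((Complex.reCLM.compLpL 2 (volume : Measure (Space n))).continuous.comp h2).comp_continuousOn h1

lemma norm_realPath_le {t : ℝ} (ht : 0 ≤ t) :
    ‖realPath X hX t‖ ≤ (eLpNorm (X t) 2 volume).toReal := by
  have h : ‖(𝓕⁻ ((hX t ht).toLp (X t)) : Lp ℂ 2 (volume : Measure (Space n)))‖
      = (eLpNorm (X t) 2 volume).toReal := by
    rw [norm_fourierInv_Lp, Lp.norm_toLp]
  rw [← h]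
  refine Lp.norm_le_norm_of_ae_le ?_
  filter_upwards [realPath_ae hX t ht] with x hx
  rw [hx]
  exact Complex.abs_re_le_norm _

/-- Pairings of a path with test functions, on the Fourier side. -/
lemma pair_realPath {t : ℝ} (ht : 0 ≤ t) (φ : 𝓢(Space n, ℝ)) :
    pair (realPath X hX t) φ = (∫ w, (𝓕⁻ (toC φ)) w * X t w).re := by
  have h := integral_mul_fourierInv_Lp ((hX t ht).toLp (X t)) (toC φ)
  have h1 : ∫ w, (𝓕⁻ (toC φ)) w * (hX t ht).toLp (X t) w = ∫ w, (𝓕⁻ (toC φ)) w * X t w := by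
    refine integral_congr_ae ?_
    filter_upwards [(hX t ht).coeFn_toLp] with x hx
    rw [hx]
  rw [← h1, ← h]
  have hint : Integrable fun x => (toC φ) x *
      (𝓕⁻ ((hX t ht).toLp (X t)) : Lp ℂ 2 (volume : Measure (Space n))) x :=
    integrable_schwartz_mul (Lp.memLp _) _
  have h2 := Complex.reCLM.integral_comp_comm hint
  simp only [Complex.reCLM_apply] at h2
  rw [← h2, pair]
  refine integral_congr_ae ?_
  filter_upwards [realPath_ae hX t ht] with x hx
  rw [hx]
  simp [mul_comm]

/-- The path starts at `f` if the Fourier side starts at `𝓕 f`. -/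
lemma realPath_zero {f : Space n → ℝ} (h1 : MemLp f 1 volume) (h2 : MemLp f 2 volume)
    (h : X 0 = 𝓕 fun x => (f x : ℂ)) : realPath X hX 0 =ᵐ[volume] f := by
  have h3 := fourier_ae_eq_Lp (memLp_ofReal h1) (memLp_ofReal h2)
  have h4 : (hX 0 le_rfl).toLp (X 0) = (𝓕 ((memLp_ofReal h2).toLp fun x => (f x : ℂ)) :
      Lp ℂ 2 (volume : Measure (Space n))) := by
    refine Lp.ext ?_
    filter_upwards [h3, (hX 0 le_rfl).coeFn_toLp] with x a1 a2
    rw [a2, h, a1]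
  have h5 : (𝓕⁻ (𝓕 ((memLp_ofReal h2).toLp fun x => (f x : ℂ)) : Lp ℂ 2 (volume : Measure (Space n)))
      : Lp ℂ 2 (volume : Measure (Space n))) = (memLp_ofReal h2).toLp fun x => (f x : ℂ) :=
    FourierTransform.fourierInv_fourier_eq _
  filter_upwards [realPath_ae hX 0 le_rfl, (memLp_ofReal h2).coeFn_toLp] with x a1 a2
  rw [a1, h4, h5, a2, Complex.ofReal_re]

/-- Parseval's identity for a real function and a test function. -/
lemma integral_fourierInv_mul_fourier {f : Space n → ℝ} (h1 : MemLp f 1 volume)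
    (h2 : MemLp f 2 volume) (φ : 𝓢(Space n, ℝ)) :
    ∫ w, (𝓕⁻ (toC φ)) w * 𝓕 (fun x => (f x : ℂ)) w = (pair f φ : ℂ) := by
  have a := integral_mul_fourier_Lp ((memLp_ofReal h2).toLp fun x => (f x : ℂ)) (𝓕⁻ (toC φ))
  rw [FourierTransform.fourier_fourierInv_eq] at a
  have a1 : ∫ w, (𝓕⁻ (toC φ)) w * 𝓕 (fun x => (f x : ℂ)) w = ∫ w, (𝓕⁻ (toC φ)) w *
      (𝓕 ((memLp_ofReal h2).toLp fun x => (f x : ℂ)) : Lp ℂ 2 (volume : Measure (Space n))) w := by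
    refine integral_congr_ae ?_
    filter_upwards [fourier_ae_eq_Lp (memLp_ofReal h1) (memLp_ofReal h2)] with x hx
    rw [hx]
  rw [a1, a, pair, ← integral_complex_ofReal]
  refine integral_congr_ae ?_
  filter_upwards [(memLp_ofReal h2).coeFn_toLp] with x hx
  rw [hx]
  simp [mul_comm]

end Paths

/-! ### Time derivatives of paired states -/

section Moments

variable {n : ℕ} {b κ γ δ : ℝ}

/-- The wave vector `k = 2 π w` of the frequency `w` in Mathlib's normalization. -/
noncomputable def waveVec (w : Space n) : Space n := (2 * Real.pi) • w

lemma norm_waveVec (w : Space n) : ‖waveVec w‖ = 2 * Real.pi * ‖w‖ := by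
  rw [waveVec, norm_smul, Real.norm_of_nonneg (by positivity)]

lemma continuous_waveVec : Continuous (waveVec : Space n → Space n) := by
  unfold waveVec; fun_prop

lemma exists_norm_gen_le (b κ γ δ : ℝ) (n : ℕ) : ∃ G : ℝ, 0 < G ∧ ∀ (k : Space n) (X : Phase n),
    ‖gen b κ γ δ k X‖ ≤ G * (1 + ‖k‖ ^ 2) * ‖X‖ := by
  refine ⟨1 + b ^ 2 + |γ| + |δ| + |κ|, by positivity, fun k X => ?_⟩
  have x1 : ‖X.1‖ ≤ ‖X‖ := norm_fst_le X
  have x2 : ‖X.2.1‖ ≤ ‖X‖ := (norm_fst_le X.2).trans (norm_snd_le X)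
  have x3 : ‖X.2.2.1‖ ≤ ‖X‖ := (norm_fst_le X.2.2).trans ((norm_snd_le X.2).trans (norm_snd_le X))
  have x4 : ‖X.2.2.2‖ ≤ ‖X‖ := (norm_snd_le X.2.2).trans ((norm_snd_le X.2).trans (norm_snd_le X))
  have hk : ‖k‖ ≤ 1 + ‖k‖ ^ 2 := by nlinarith [sq_nonneg (‖k‖ - 1), norm_nonneg k]
  have hq : ‖k‖ ^ 2 ≤ 1 + ‖k‖ ^ 2 := by linarith
  have h1 : 1 ≤ 1 + ‖k‖ ^ 2 := by nlinarith [sq_nonneg ‖k‖]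
  set Q := 1 + ‖k‖ ^ 2 with hQ
  have hX := norm_nonneg X
  have t0 : ‖X‖ ≤ Q * ‖X‖ := by nlinarith
  have m1 : 0 ≤ b ^ 2 * (Q * ‖X‖) := by positivity
  have m2 : 0 ≤ |γ| * (Q * ‖X‖) := by positivity
  have m3 : 0 ≤ |δ| * (Q * ‖X‖) := by positivity
  have m4 : 0 ≤ |κ| * (Q * ‖X‖) := by positivity
  have m0 : 0 ≤ Q * ‖X‖ := by positivity
  have e : (1 + b ^ 2 + |γ| + |δ| + |κ|) * Q * ‖X‖ = Q * ‖X‖ + b ^ 2 * (Q * ‖X‖)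
    + |γ| * (Q * ‖X‖) + |δ| * (Q * ‖X‖) + |κ| * (Q * ‖X‖) := by ring
  rw [e, gen_apply]
  have r1 : ‖((b ^ 2 * ‖k‖ ^ 2 : ℝ) : ℂ) • X.1‖ ≤ b ^ 2 * (Q * ‖X‖) := by
    rw [norm_smul, Complex.norm_real, Real.norm_of_nonneg (by positivity), mul_assoc]
    gcongr
  have r2 : ‖(γ * Complex.I * X.2.2.1) • vecC k‖ ≤ |γ| * (Q * ‖X‖) := by
    rw [norm_smul, norm_vecC, norm_mul, norm_mul, Complex.norm_I, Complex.norm_real, mul_one,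
      Real.norm_eq_abs]
    calc _ ≤ |γ| * ‖X‖ * Q := by gcongr
      _ = _ := by ring
  have r3 : ‖((δ * ‖k‖ ^ 2 : ℝ) : ℂ) * X.2.2.1‖ ≤ |δ| * (Q * ‖X‖) := by
    rw [norm_mul, Complex.norm_real, norm_mul, norm_pow, norm_norm, Real.norm_eq_abs, mul_assoc]
    gcongr
  have r4 : ‖γ * Complex.I * dotC k X.2.1‖ ≤ |γ| * (Q * ‖X‖) := by
    rw [norm_mul, norm_mul, Complex.norm_I, Complex.norm_real, mul_one, Real.norm_eq_abs]
    gcongr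
    exact (norm_dotC_le _ _).trans (by gcongr)
  have r5 : ‖((κ * ‖k‖ ^ 2 : ℝ) : ℂ) * X.2.2.1‖ ≤ |κ| * (Q * ‖X‖) := by
    rw [norm_mul, Complex.norm_real, norm_mul, norm_pow, norm_norm, Real.norm_eq_abs, mul_assoc]
    gcongr
  rw [norm_prod_le_iff, norm_prod_le_iff, norm_prod_le_iff]
  refine ⟨by linarith, ?_, ?_, ?_⟩
  · have := norm_sub_le (-((b ^ 2 * ‖k‖ ^ 2 : ℝ) : ℂ) • X.1) ((γ * Complex.I * X.2.2.1) • vecC k)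
    rw [neg_smul, norm_neg] at this
    rw [neg_smul]
    linarith
  · refine (norm_sub_le _ _).trans ?_
    have := norm_sub_le (X.2.2.2) (((δ * ‖k‖ ^ 2 : ℝ) : ℂ) * X.2.2.1)
    linarith
  · rw [norm_neg]; linarith

variable (b κ γ δ) in
/-- The state at time `t` and frequency `w`, for given Fourier transforms of the data. -/
noncomputable def spec (U₀ U₁ : Space n → EuclideanSpace ℂ (Fin n)) (Θ₀ Θ₁ : Space n → ℂ)
    (t : ℝ) (w : Space n) : Phase n :=
  sol b κ γ δ (waveVec w) t (U₀ w) (U₁ w) (Θ₀ w) (Θ₁ w)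

/-- The size of the data at the frequency `w`. -/
noncomputable def dataSize (U₀ U₁ : Space n → EuclideanSpace ℂ (Fin n)) (Θ₀ Θ₁ : Space n → ℂ)
    (w : Space n) : ℝ :=
  (1 + ‖waveVec w‖) * ‖U₀ w‖ + ‖U₁ w‖ + ‖Θ₀ w‖ + ‖Θ₁ w‖

variable {U₀ U₁ : Space n → EuclideanSpace ℂ (Fin n)} {Θ₀ Θ₁ : Space n → ℂ}

lemma continuous_spec (hU₀ : Continuous U₀) (hU₁ : Continuous U₁) (hΘ₀ : Continuous Θ₀)
    (hΘ₁ : Continuous Θ₁) (t : ℝ) : Continuous (spec b κ γ δ U₀ U₁ Θ₀ Θ₁ t) := by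
  have hk := continuous_waveVec (n := n)
  have hf := (continuous_flow (n := n) (b := b) (κ := κ) (γ := γ) (δ := δ) t).comp hk
  have hg := (continuous_gen (n := n) (b := b) (κ := κ) (γ := γ) (δ := δ)).comp hk
  have hd : Continuous fun w => dotC (waveVec w) (U₁ w) := continuous_dotC.comp (hk.prodMk hU₁)
  have h1 : Continuous fun w => ((U₀ w, U₁ w, 0, Θ₁ w + γ * Complex.I * dotC (waveVec w) (U₁ w)) :
      Phase n) := by fun_prop
  have h2 : Continuous fun w => ((0, 0, 0, Θ₀ w) : Phase n) := by fun_prop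
  have a1 := hf.clm_apply h1
  have a2 := hf.clm_apply h2
  have a3 := hg.clm_apply a2
  have hn : Continuous fun w : Space n => ((δ * ‖waveVec w‖ ^ 2 : ℝ) : ℂ) := by fun_prop
  exact a1.add (a3.add (hn.smul a2))

lemma hasDerivAt_gen_pow_spec (m : ℕ) (w : Space n) (t : ℝ) :
    HasDerivAt (fun t => (gen b κ γ δ (waveVec w) ^ m) (spec b κ γ δ U₀ U₁ Θ₀ Θ₁ t w))
      ((gen b κ γ δ (waveVec w) ^ (m + 1)) (spec b κ γ δ U₀ U₁ Θ₀ Θ₁ t w)) t := by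
  have h := hasDerivAt_sol (b := b) (κ := κ) (γ := γ) (δ := δ) (waveVec w) (U₀ w) (U₁ w) (Θ₀ w)
    (Θ₁ w) t
  have h2 := ((gen b κ γ δ (waveVec w) ^ m).restrictScalars ℝ).hasFDerivAt.comp_hasDerivAt t h
  rw [pow_succ]
  exact h2

/-- Every time derivative costs two powers of the frequency, which test functions absorb. -/
lemma exists_norm_gen_pow_spec_le (hb : 0 < b) (hκ : 0 < κ) (hδ : 0 < δ) (m : ℕ) (T : ℝ) :
    ∃ C : ℝ, 0 < C ∧ ∀ (w : Space n) (t : ℝ), 0 ≤ t → t ≤ T →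
      ‖(gen b κ γ δ (waveVec w) ^ m) (spec b κ γ δ U₀ U₁ Θ₀ Θ₁ t w)‖
        ≤ C * (1 + ‖waveVec w‖ ^ 2) ^ (m + 1) * dataSize U₀ U₁ Θ₀ Θ₁ w := by
  obtain ⟨G, hG, hgen⟩ := exists_norm_gen_le b κ γ δ n
  obtain ⟨C, hC, h⟩ := exists_sol_bounds (γ := γ) hb hκ hδ n T
  refine ⟨G ^ m * C, by positivity, fun w t ht htT => ?_⟩
  induction m with
  | zero =>
    have := (h (waveVec w) t ht htT (U₀ w) (U₁ w) (Θ₀ w) (Θ₁ w)).2.2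
    simpa [dataSize, spec] using this
  | succ m ih =>
    rw [pow_succ' (gen b κ γ δ (waveVec w)), mul_apply_eq_comp]
    refine (hgen _ _).trans ?_
    calc _ ≤ G * (1 + ‖waveVec w‖ ^ 2) * (G ^ m * C * (1 + ‖waveVec w‖ ^ 2) ^ (m + 1)
          * dataSize U₀ U₁ Θ₀ Θ₁ w) := by gcongr
      _ = _ := by ring

/-- The states paired with a test function on the Fourier side, after `m` time derivatives. -/
noncomputable def moment (b κ γ δ : ℝ) (U₀ U₁ : Space n → EuclideanSpace ℂ (Fin n))
    (Θ₀ Θ₁ : Space n → ℂ) (ψ : 𝓢(Space n, ℂ)) (m : ℕ) (t : ℝ) : Phase n :=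
  ∫ w, ψ w • (gen b κ γ δ (waveVec w) ^ m) (spec b κ γ δ U₀ U₁ Θ₀ Θ₁ t w)

lemma integrable_schwartz_mul_dataSize (hD : MemLp (dataSize U₀ U₁ Θ₀ Θ₁) 2 volume)
    (ψ : 𝓢(Space n, ℂ)) (m : ℕ) :
    Integrable fun w => ‖ψ w‖ * ((1 + ‖waveVec w‖ ^ 2) ^ m * dataSize U₀ U₁ Θ₀ Θ₁ w) := by
  have hg : (fun w : Space n => (1 + ‖(2 * Real.pi) • w‖ ^ 2) ^ m).HasTemperateGrowth := by
    have : (fun w : Space n => (1 + ‖(2 * Real.pi) • w‖ ^ 2) ^ m)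
        = fun w : Space n => (1 + (2 * Real.pi) ^ 2 * ‖w‖ ^ 2) ^ m := by
      funext w; rw [norm_smul, mul_pow, Real.norm_of_nonneg (by positivity)]
    rw [this]
    fun_prop
  have h := ((SchwartzMap.smulLeftCLM ℂ (fun w : Space n => (1 + ‖(2 * Real.pi) • w‖ ^ 2) ^ m) ψ).memLp
    2 volume).norm.integrable_mul hD
  refine h.congr (Eventually.of_forall fun w => ?_)
  simp only [Pi.mul_apply]
  rw [SchwartzMap.smulLeftCLM_apply_apply hg, norm_smul, Real.norm_of_nonneg (by positivity),
    waveVec]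
  ring

section

variable (hU₀ : Continuous U₀) (hU₁ : Continuous U₁) (hΘ₀ : Continuous Θ₀) (hΘ₁ : Continuous Θ₁)
  (hD : MemLp (dataSize U₀ U₁ Θ₀ Θ₁) 2 volume)

include hU₀ hU₁ hΘ₀ hΘ₁ hD

lemma integrable_moment (hb : 0 < b) (hκ : 0 < κ) (hδ : 0 < δ) (ψ : 𝓢(Space n, ℂ)) (m : ℕ) {t : ℝ}
    (ht : 0 ≤ t) :
    Integrable fun w => ψ w • (gen b κ γ δ (waveVec w) ^ m) (spec b κ γ δ U₀ U₁ Θ₀ Θ₁ t w) := by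
  obtain ⟨C, hC, h⟩ := exists_norm_gen_pow_spec_le (γ := γ) (U₀ := U₀) (U₁ := U₁) (Θ₀ := Θ₀)
    (Θ₁ := Θ₁) hb hκ hδ m t
  refine ((integrable_schwartz_mul_dataSize hD ψ (m + 1)).const_mul C).mono' ?_
    (Eventually.of_forall fun w => ?_)
  · refine Continuous.aestronglyMeasurable (ψ.continuous.smul (Continuous.clm_apply ?_
      (continuous_spec hU₀ hU₁ hΘ₀ hΘ₁ t)))
    exact (continuous_gen.comp continuous_waveVec).pow m
  · rw [norm_smul]
    calc _ ≤ ‖ψ w‖ * (C * (1 + ‖waveVec w‖ ^ 2) ^ (m + 1) * dataSize U₀ U₁ Θ₀ Θ₁ w) := by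
          gcongr; exact h w t ht le_rfl
      _ = _ := by ring

lemma hasDerivWithinAt_moment (hb : 0 < b) (hκ : 0 < κ) (hδ : 0 < δ) (ψ : 𝓢(Space n, ℂ)) (m : ℕ)
    {t : ℝ} (ht : 0 ≤ t) :
    HasDerivWithinAt (moment b κ γ δ U₀ U₁ Θ₀ Θ₁ ψ m) (moment b κ γ δ U₀ U₁ Θ₀ Θ₁ ψ (m + 1) t)
      (Ici 0) t := by
  obtain ⟨C, hC, h⟩ := exists_norm_gen_pow_spec_le (γ := γ) (U₀ := U₀) (U₁ := U₁) (Θ₀ := Θ₀)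
    (Θ₁ := Θ₁) hb hκ hδ (m + 1) (t + 1)
  refine hasDerivWithinAt_integral_Ici
    (F := fun s w => ψ w • (gen b κ γ δ (waveVec w) ^ m) (spec b κ γ δ U₀ U₁ Θ₀ Θ₁ s w))
    (F' := fun s w => ψ w • (gen b κ γ δ (waveVec w) ^ (m + 1)) (spec b κ γ δ U₀ U₁ Θ₀ Θ₁ s w)) ht
    (fun s hs => integrable_moment hU₀ hU₁ hΘ₀ hΘ₁ hD hb hκ hδ ψ m hs)
    ((integrable_schwartz_mul_dataSize hD ψ (m + 2)).const_mul C) (fun w s hs => ?_)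
    (fun w s hs hst => ?_)
  · exact ((hasDerivAt_gen_pow_spec m w s).const_smul (ψ w)).hasDerivWithinAt
  · rw [norm_smul]
    calc _ ≤ ‖ψ w‖ * (C * (1 + ‖waveVec w‖ ^ 2) ^ (m + 1 + 1) * dataSize U₀ U₁ Θ₀ Θ₁ w) := by
          gcongr; exact h w s hs hst
      _ = _ := by ring

/-- Real functionals of the paired state are twice continuously differentiable on `[0, ∞)`. -/
lemma contDiffOn_moment (hb : 0 < b) (hκ : 0 < κ) (hδ : 0 < δ) (ψ : 𝓢(Space n, ℂ))
    (L : Phase n →L[ℝ] ℝ) {f : ℝ → ℝ}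
    (hf : ∀ t, 0 ≤ t → f t = L (moment b κ γ δ U₀ U₁ Θ₀ Θ₁ ψ 0 t)) :
    ContDiffOn ℝ 2 f (Ici 0) ∧ ∀ t, 0 ≤ t →
      derivWithin f (Ici 0) t = L (moment b κ γ δ U₀ U₁ Θ₀ Θ₁ ψ 1 t) ∧
      iteratedDerivWithin 2 f (Ici 0) t = L (moment b κ γ δ U₀ U₁ Θ₀ Θ₁ ψ 2 t) := by
  have hu : UniqueDiffOn ℝ (Ici (0 : ℝ)) := uniqueDiffOn_Ici 0
  have hL : ∀ m t, 0 ≤ t → HasDerivWithinAt (fun t => L (moment b κ γ δ U₀ U₁ Θ₀ Θ₁ ψ m t))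
      (L (moment b κ γ δ U₀ U₁ Θ₀ Θ₁ ψ (m + 1) t)) (Ici 0) t := fun m t ht =>
    L.hasFDerivAt.comp_hasDerivWithinAt t
      (hasDerivWithinAt_moment hU₀ hU₁ hΘ₀ hΘ₁ hD hb hκ hδ ψ m ht)
  have d1 : ∀ t, 0 ≤ t → HasDerivWithinAt f (L (moment b κ γ δ U₀ U₁ Θ₀ Θ₁ ψ 1 t)) (Ici 0) t :=
    fun t ht => (hL 0 t ht).congr (fun s hs => hf s hs) (hf t ht)
  have e1 : ∀ t, 0 ≤ t → derivWithin f (Ici 0) t = L (moment b κ γ δ U₀ U₁ Θ₀ Θ₁ ψ 1 t) :=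
    fun t ht => (d1 t ht).derivWithin (hu t ht)
  have d2 : ∀ t, 0 ≤ t → HasDerivWithinAt (derivWithin f (Ici 0))
      (L (moment b κ γ δ U₀ U₁ Θ₀ Θ₁ ψ 2 t)) (Ici 0) t :=
    fun t ht => (hL 1 t ht).congr (fun s hs => e1 s hs) (e1 t ht)
  have e2 : ∀ t, 0 ≤ t → iteratedDerivWithin 2 f (Ici 0) t
      = L (moment b κ γ δ U₀ U₁ Θ₀ Θ₁ ψ 2 t) := fun t ht => by
    have h4 : iteratedDerivWithin 1 f (Ici 0) = derivWithin f (Ici 0) := iteratedDerivWithin_one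
    rw [iteratedDerivWithin_succ, h4]
    exact (d2 t ht).derivWithin (hu t ht)
  refine ⟨?_, fun t ht => ⟨e1 t ht, e2 t ht⟩⟩
  have hc : ContinuousOn (derivWithin (derivWithin f (Ici 0)) (Ici 0)) (Ici 0) := by
    have : ContinuousOn (fun t => L (moment b κ γ δ U₀ U₁ Θ₀ Θ₁ ψ 2 t)) (Ici 0) :=
      fun t ht => (hL 2 t ht).continuousWithinAt
    exact this.congr fun t ht => (d2 t ht).derivWithin (hu t ht)
  have h1 : ContDiffOn ℝ 1 (derivWithin f (Ici 0)) (Ici 0) := by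
    rw [show (1 : WithTop ℕ∞) = 0 + 1 from (zero_add 1).symm, contDiffOn_succ_iff_derivWithin hu]
    exact ⟨fun t ht => (d2 t ht).differentiableWithinAt, by simp, contDiffOn_zero.2 hc⟩
  rw [show (2 : WithTop ℕ∞) = 1 + 1 from one_add_one_eq_two.symm, contDiffOn_succ_iff_derivWithin hu]
  exact ⟨fun t ht => (d1 t ht).differentiableWithinAt, by simp, h1⟩

end

end Moments

/-! ### Fourier transforms of the data -/

section Construction

variable {n : ℕ} {b κ γ δ : ℝ}

/-- The componentwise Fourier transform of a vector field. -/
noncomputable def fourierVec (f : Space n → Space n) (w : Space n) : EuclideanSpace ℂ (Fin n) :=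
  WithLp.toLp 2 fun j => 𝓕 (fun x => (f x j : ℂ)) w

/-- The Fourier transform of a real function. -/
noncomputable def fourierReal (f : Space n → ℝ) (w : Space n) : ℂ := 𝓕 (fun x => (f x : ℂ)) w

lemma memLp_apply {f : Space n → Space n} {p : ENNReal} (hf : MemLp f p volume) (j : Fin n) :
    MemLp (fun x => f x j) p volume :=
  hf.of_le ((EuclideanSpace.proj (𝕜 := ℝ) j).continuous.comp_aestronglyMeasurable hf.1)
    (Eventually.of_forall fun x => PiLp.norm_apply_le (f x) j)

lemma eLpNorm_apply_le {f : Space n → Space n} {p : ENNReal} (hf : MemLp f p volume) (j : Fin n) :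
    (eLpNorm (fun x => (f x j : ℂ)) p volume).toReal ≤ (eLpNorm f p volume).toReal :=
  ENNReal.toReal_mono hf.2.ne (eLpNorm_mono fun x => by
    rw [Complex.norm_real]; exact PiLp.norm_apply_le (f x) j)

lemma norm_le_sum_norm {𝕜 : Type*} [RCLike 𝕜] (v : EuclideanSpace 𝕜 (Fin n)) :
    ‖v‖ ≤ ∑ j, ‖v j‖ := by
  have h : v = ∑ j, EuclideanSpace.single j (v j) := by
    ext i; simp
  calc ‖v‖ = ‖∑ j, EuclideanSpace.single j (v j)‖ := by rw [← h]
    _ ≤ ∑ j, ‖EuclideanSpace.single j (v j)‖ := norm_sum_le _ _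
    _ = _ := by simp

lemma continuous_fourierVec {f : Space n → Space n} (hf : MemL2L1 f) :
    Continuous (fourierVec f) := by
  have h : ∀ j, Continuous fun w => 𝓕 (fun x => (f x j : ℂ)) w := fun j =>
    continuous_fourier_of_memLp (memLp_ofReal (memLp_apply hf.2 j))
  exact (PiLp.continuous_toLp 2 _).comp (continuous_pi h)

lemma continuous_fourierReal {f : Space n → ℝ} (hf : MemL2L1 f) : Continuous (fourierReal f) :=
  continuous_fourier_of_memLp (memLp_ofReal hf.2)

/-- A function dominated by finitely many square-integrable ones. -/
lemma memLp_of_norm_le_sum {α ι F : Type*} [Fintype ι] [MeasurableSpace α] {μ : Measure α}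
    [NormedAddCommGroup F] {g : α → F} {f : ι → α → ℂ} (hg : AEStronglyMeasurable g μ)
    (hf : ∀ i, MemLp (f i) 2 μ) (h : ∀ᵐ x ∂μ, ‖g x‖ ≤ ∑ i, ‖f i x‖) {K : ℝ}
    (hK : ∀ i, (eLpNorm (f i) 2 μ).toReal ≤ K) :
    MemLp g 2 μ ∧ (eLpNorm g 2 μ).toReal ≤ Fintype.card ι * K := by
  have hs : MemLp (∑ i, fun x => ‖f i x‖) 2 μ := memLp_finsetSum' _ fun i _ => (hf i).norm
  have h' : ∀ᵐ x ∂μ, ‖g x‖ ≤ ‖(∑ i, fun x => ‖f i x‖) x‖ := by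
    filter_upwards [h] with x hx
    refine hx.trans ?_
    rw [Finset.sum_apply]
    exact le_abs_self _
  refine ⟨hs.of_le hg h', ?_⟩
  have h1 : eLpNorm g 2 μ ≤ ∑ i, eLpNorm (f i) 2 μ := by
    refine (eLpNorm_mono_ae h').trans
      ((eLpNorm_sum_le (fun i _ => (hf i).norm.1) (by norm_num)).trans (le_of_eq ?_))
    exact Finset.sum_congr rfl fun i _ => eLpNorm_norm _
  have h2 : ∑ i, eLpNorm (f i) 2 μ ≠ ⊤ := ENNReal.sum_ne_top.2 fun i _ => (hf i).2.ne
  refine (ENNReal.toReal_mono h2 h1).trans ?_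
  rw [ENNReal.toReal_sum fun i _ => (hf i).2.ne]
  refine (Finset.sum_le_card_nsmul _ _ K fun i _ => hK i).trans (le_of_eq ?_)
  rw [nsmul_eq_mul, Finset.card_univ]

lemma fourierVec_bounds {f : Space n → Space n} (hf : MemL2L1 f) :
    (MemLp (fourierVec f) 2 volume ∧
      (eLpNorm (fourierVec f) 2 volume).toReal ≤ n * (eLpNorm f 2 volume).toReal) ∧
    ∀ w, ‖fourierVec f w‖ ≤ n * (eLpNorm f 1 volume).toReal := by
  have c1 := fun j => memLp_ofReal (memLp_apply hf.2 j)
  have c2 := fun j => memLp_ofReal (memLp_apply hf.1 j)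
  refine ⟨?_, fun w => ?_⟩
  · have := memLp_of_norm_le_sum (K := (eLpNorm f 2 volume).toReal)
      (continuous_fourierVec hf).aestronglyMeasurable
      (fun j => memLp_fourier (c1 j) (c2 j))
      (Eventually.of_forall fun w => norm_le_sum_norm (fourierVec f w))
      (fun j => by rw [eLpNorm_fourier (c1 j) (c2 j)]; exact eLpNorm_apply_le hf.1 j)
    rwa [Fintype.card_fin] at this
  · refine (norm_le_sum_norm _).trans ((Finset.sum_le_card_nsmul _ _
      (eLpNorm f 1 volume).toReal fun j _ => ?_).trans (le_of_eq ?_))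
    · exact (norm_fourier_le (c1 j) w).trans (eLpNorm_apply_le hf.2 j)
    · rw [nsmul_eq_mul, Finset.card_univ, Fintype.card_fin]

lemma fourierReal_bounds {f : Space n → ℝ} (hf : MemL2L1 f) :
    (MemLp (fourierReal f) 2 volume ∧
      (eLpNorm (fourierReal f) 2 volume).toReal = (eLpNorm f 2 volume).toReal) ∧
    ∀ w, ‖fourierReal f w‖ ≤ (eLpNorm f 1 volume).toReal := by
  have c1 := memLp_ofReal hf.2
  have c2 := memLp_ofReal hf.1
  have e : ∀ p, eLpNorm (fun x => (f x : ℂ)) p volume = eLpNorm f p volume := fun p =>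
    eLpNorm_congr_norm_ae (Eventually.of_forall fun x => by simp)
  refine ⟨⟨memLp_fourier c1 c2, ?_⟩, fun w => ?_⟩
  · rw [← e, ← eLpNorm_fourier c1 c2]; rfl
  · rw [← e]; exact norm_fourier_le c1 w

/-- The weak derivatives control the Fourier transform weighted by the frequency. -/
lemma weighted_fourierVec_bounds {f : Space n → Space n} {Df : Fin n → Space n → Space n}
    (hf : MemL2L1 f) (hD : HasWeakPartials f Df) (hDf : ∀ j, MemLp (Df j) 2 volume) :
    MemLp (fun w => ‖waveVec w‖ * ‖fourierVec f w‖) 2 volume ∧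
      (eLpNorm (fun w => ‖waveVec w‖ * ‖fourierVec f w‖) 2 volume).toReal
        ≤ (n * n) * normH1L1 f Df := by
  have hae := fun i j : Fin n => fourier_weak_partial (memLp_apply hf.2 i) (memLp_apply hf.1 i)
    (memLp_apply (hDf j) i) (hD i j)
  have hL := fun i j : Fin n => Lp.memLp
    (𝓕 ((memLp_ofReal (memLp_apply (hDf j) i)).toLp fun x => (Df j x i : ℂ)) :
      Lp ℂ 2 (volume : Measure (Space n)))
  have hm := fun i j : Fin n => (memLp_congr_ae (hae i j)).2 (hL i j)
  have hK : ∀ p : Fin n × Fin n, (eLpNorm (fun w : Space n => 2 * Real.pi * Complex.I * w p.2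
      * 𝓕 (fun x => (f x p.1 : ℂ)) w) 2 volume).toReal ≤ normH1L1 f Df := by
    rintro ⟨i, j⟩
    rw [eLpNorm_congr_ae (hae i j), ← Lp.norm_def, Lp.norm_fourier_eq, Lp.norm_toLp]
    refine (eLpNorm_apply_le (hDf j) i).trans ?_
    rw [normH1L1]
    refine le_add_of_le_of_nonneg (Real.le_sqrt_of_sq_le ?_) ENNReal.toReal_nonneg
    have := Finset.single_le_sum (f := fun j => (eLpNorm (Df j) 2 volume).toReal ^ 2)
      (fun j _ => sq_nonneg _) (Finset.mem_univ j)
    have h2 := sq_nonneg (eLpNorm f 2 volume).toReal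
    linarith
  have := memLp_of_norm_le_sum (ι := Fin n × Fin n)
    (g := fun w => ‖waveVec w‖ * ‖fourierVec f w‖)
    (((continuous_waveVec).norm.mul (continuous_fourierVec hf).norm).aestronglyMeasurable)
    (fun p => hm p.1 p.2) (Eventually.of_forall fun w => ?_) hK
  · simpa [Fintype.card_prod] using this
  · rw [Real.norm_of_nonneg (by positivity), Fintype.sum_prod_type, mul_comm]
    calc ‖fourierVec f w‖ * ‖waveVec w‖
        ≤ (∑ i, ‖fourierVec f w i‖) * ∑ j, ‖waveVec w j‖ := by
          gcongr
          · exact norm_le_sum_norm _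
          · exact norm_le_sum_norm _
      _ = _ := by
          rw [Finset.sum_mul_sum]
          refine Finset.sum_congr rfl fun i _ => Finset.sum_congr rfl fun j _ => ?_
          simp only [waveVec, fourierVec, PiLp.smul_apply, smul_eq_mul, norm_mul,
            Complex.norm_real, Complex.norm_I, Complex.norm_ofNat, Real.norm_ofNat]
          ring

lemma memLp_dataSize {u₀ u₁ : Space n → Space n} {Du₀ : Fin n → Space n → Space n}
    {θ₀ θ₁ : Space n → ℝ} (hu₀ : MemL2L1 u₀) (hDu : HasWeakPartials u₀ Du₀)
    (hDu₀ : ∀ j, MemLp (Du₀ j) 2 volume) (hu₁ : MemL2L1 u₁) (hθ₀ : MemL2L1 θ₀)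
    (hθ₁ : MemL2L1 θ₁) :
    MemLp (dataSize (fourierVec u₀) (fourierVec u₁) (fourierReal θ₀) (fourierReal θ₁)) 2 volume := by
  have h := (((fourierVec_bounds hu₀).1.1.norm.add
    (weighted_fourierVec_bounds hu₀ hDu hDu₀).1).add ((fourierVec_bounds hu₁).1.1.norm)).add
    (fourierReal_bounds hθ₀).1.1.norm |>.add (fourierReal_bounds hθ₁).1.1.norm
  refine h.ae_eq (Eventually.of_forall fun w => ?_)
  simp only [Pi.add_apply, dataSize]
  ring

variable (b κ γ δ) in
/-- The Fourier transform of the temperature at time `t`. -/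
noncomputable def thetaHat (u₀ u₁ : Space n → Space n) (θ₀ θ₁ : Space n → ℝ) (t : ℝ) (w : Space n) :
    ℂ :=
  (spec b κ γ δ (fourierVec u₀) (fourierVec u₁) (fourierReal θ₀) (fourierReal θ₁) t w).2.2.1

variable (n) in
/-- The temperature component of a state. -/
noncomputable def projTheta : Phase n →L[ℂ] ℂ :=
  (ContinuousLinearMap.fst ℂ ℂ ℂ).comp
    ((ContinuousLinearMap.snd ℂ (EuclideanSpace ℂ (Fin n)) (ℂ × ℂ)).comp
      (ContinuousLinearMap.snd ℂ (EuclideanSpace ℂ (Fin n)) _))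

/-- The `j`-th displacement component of a state. -/
noncomputable def projU (j : Fin n) : Phase n →L[ℂ] ℂ :=
  (EuclideanSpace.proj j).comp (ContinuousLinearMap.fst ℂ (EuclideanSpace ℂ (Fin n)) _)

lemma projTheta_apply (X : Phase n) : projTheta n X = X.2.2.1 := rfl

lemma projU_apply (j : Fin n) (X : Phase n) : projU j X = X.1 j := rfl

section

variable {U₀ U₁ : Space n → EuclideanSpace ℂ (Fin n)} {Θ₀ Θ₁ : Space n → ℂ}
  (hU₀ : Continuous U₀) (hU₁ : Continuous U₁) (hΘ₀ : Continuous Θ₀) (hΘ₁ : Continuous Θ₁)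
  (hD : MemLp (dataSize U₀ U₁ Θ₀ Θ₁) 2 volume) (hb : 0 < b) (hκ : 0 < κ) (hδ : 0 < δ)

include hU₀ hU₁ hΘ₀ hΘ₁ hD hb hκ hδ

lemma integrable_proj_moment (ℓ : Phase n →L[ℂ] ℂ) (ψ : 𝓢(Space n, ℂ)) (m : ℕ) {t : ℝ}
    (ht : 0 ≤ t) : Integrable fun w =>
      ψ w * ℓ ((gen b κ γ δ (waveVec w) ^ m) (spec b κ γ δ U₀ U₁ Θ₀ Θ₁ t w)) := by
  have := ℓ.integrable_comp (integrable_moment (γ := γ) hU₀ hU₁ hΘ₀ hΘ₁ hD hb hκ hδ ψ m ht)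
  simpa only [map_smul, smul_eq_mul] using this

lemma proj_moment (ℓ : Phase n →L[ℂ] ℂ) (ψ : 𝓢(Space n, ℂ)) (m : ℕ) {t : ℝ} (ht : 0 ≤ t) :
    ℓ (moment b κ γ δ U₀ U₁ Θ₀ Θ₁ ψ m t)
      = ∫ w, ψ w * ℓ ((gen b κ γ δ (waveVec w) ^ m) (spec b κ γ δ U₀ U₁ Θ₀ Θ₁ t w)) := by
  rw [moment, ← ℓ.integral_comp_comm
    (integrable_moment (γ := γ) hU₀ hU₁ hΘ₀ hΘ₁ hD hb hκ hδ ψ m ht)]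
  simp only [map_smul, smul_eq_mul]

lemma memLp_theta {t : ℝ} (ht : 0 ≤ t) :
    MemLp (fun w => projTheta n (spec b κ γ δ U₀ U₁ Θ₀ Θ₁ t w)) 2 volume := by
  obtain ⟨C, hC, h⟩ := exists_sol_bounds (γ := γ) hb hκ hδ n t
  refine (hD.const_mul C).of_le ((projTheta n).continuous.comp
    (continuous_spec hU₀ hU₁ hΘ₀ hΘ₁ t)).aestronglyMeasurable (Eventually.of_forall fun w => ?_)
  refine le_trans ?_ (le_abs_self _)
  exact (h (waveVec w) t ht le_rfl (U₀ w) (U₁ w) (Θ₀ w) (Θ₁ w)).2.1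

lemma memLp_displacement (j : Fin n) {t : ℝ} (ht : 0 ≤ t) :
    MemLp (fun w => projU j (spec b κ γ δ U₀ U₁ Θ₀ Θ₁ t w)) 2 volume := by
  obtain ⟨C, hC, h⟩ := exists_sol_bounds (γ := γ) hb hκ hδ n t
  refine (hD.const_mul C).of_le ((projU j).continuous.comp
    (continuous_spec hU₀ hU₁ hΘ₀ hΘ₁ t)).aestronglyMeasurable (Eventually.of_forall fun w => ?_)
  refine le_trans ?_ (le_abs_self _)
  exact (PiLp.norm_apply_le _ j).trans
    (h (waveVec w) t ht le_rfl (U₀ w) (U₁ w) (Θ₀ w) (Θ₁ w)).1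

end

end Construction

/-! ### Existence -/

section ExistenceTheorem

variable {n : ℕ} {b κ γ δ : ℝ}

lemma projU_gen_sq (j : Fin n) (k : Space n) (X : Phase n) :
    projU j ((gen b κ γ δ k ^ 2) X)
      = -((b ^ 2 * ‖k‖ ^ 2 : ℝ) : ℂ) * projU j X - γ * Complex.I * projTheta n X * k j := by
  rw [pow_two, mul_apply_eq_comp]
  simp [projU_apply, projTheta_apply, gen_apply, vecC]

lemma projTheta_gen_sq (k : Space n) (X : Phase n) :
    projTheta n ((gen b κ γ δ k ^ 2) X)
      = -((κ * ‖k‖ ^ 2 : ℝ) : ℂ) * projTheta n X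
        - ((δ * ‖k‖ ^ 2 : ℝ) : ℂ) * projTheta n ((gen b κ γ δ k ^ 1) X)
        - γ * Complex.I * ∑ j, (k j : ℂ) * projU j ((gen b κ γ δ k ^ 2) X) := by
  rw [pow_two, pow_one, mul_apply_eq_comp]
  simp only [projU_apply, projTheta_apply]
  rw [← dotC_apply]
  simp only [gen_apply, neg_mul]

/-- The displacement field with given components. -/
noncomputable def vecPath (v : Fin n → ℝ → Lp ℝ 2 (volume : Measure (Space n))) (t : ℝ) :
    Lp (Space n) 2 (volume : Measure (Space n)) :=
  ∑ j, (ContinuousLinearMap.toSpanSingleton ℝ (EuclideanSpace.single j (1 : ℝ))).compLpL 2 volume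
    (v j t)

lemma vecPath_ae (v : Fin n → ℝ → Lp ℝ 2 (volume : Measure (Space n))) (t : ℝ) :
    ∀ᵐ x, ∀ j, vecPath v t x j = v j t x := by
  have h1 : ∀ᵐ x, ∀ j, (ContinuousLinearMap.toSpanSingleton ℝ
      (EuclideanSpace.single j (1 : ℝ) : Space n)).compLpL 2 volume (v j t) x
        = ContinuousLinearMap.toSpanSingleton ℝ (EuclideanSpace.single j (1 : ℝ)) (v j t x) :=
    ae_all_iff.2 fun j => ContinuousLinearMap.coeFn_compLpL _ _
  have h2 := Lp.coeFn_finsetSum (μ := (volume : Measure (Space n))) (p := 2) Finset.univ fun j => (ContinuousLinearMap.toSpanSingleton ℝ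
      (EuclideanSpace.single j (1 : ℝ) : Space n)).compLpL 2 volume (v j t)
  filter_upwards [h1, h2] with x a1 a2 j
  rw [vecPath, a2, Finset.sum_apply]
  simp [a1, Pi.single_apply]

lemma continuousOn_vecPath {v : Fin n → ℝ → Lp ℝ 2 (volume : Measure (Space n))}
    (h : ∀ j, ContinuousOn (v j) (Ici 0)) : ContinuousOn (vecPath v) (Ici 0) :=
  continuousOn_finsetSum _ fun j _ =>
    (ContinuousLinearMap.continuous _).comp_continuousOn (h j)

/-- The real part of a component of the state, as a real functional. -/
noncomputable def reProj (ℓ : Phase n →L[ℂ] ℂ) : Phase n →L[ℝ] ℝ :=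
  Complex.reCLM.comp (ℓ.restrictScalars ℝ)

lemma reProj_apply (ℓ : Phase n →L[ℂ] ℂ) (X : Phase n) : reProj ℓ X = (ℓ X).re := rfl

lemma integral_lincomb_three {α : Type*} [MeasurableSpace α] {μ : Measure α} {f g h : α → ℂ}
    {c d e : ℂ} (hf : Integrable f μ) (hg : Integrable g μ) (hh : Integrable h μ) :
    ∫ x, (c * f x + d * g x + e * h x) ∂μ
      = c * ∫ x, f x ∂μ + d * ∫ x, g x ∂μ + e * ∫ x, h x ∂μ := by
  have h1 : Integrable (fun x => c * f x + d * g x) μ := (hf.const_mul c).add (hg.const_mul d)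
  rw [integral_add h1 (hh.const_mul e), integral_add (hf.const_mul c) (hg.const_mul d),
    integral_const_mul, integral_const_mul, integral_const_mul]

lemma memLp_thetaHat {u₀ u₁ : Space n → Space n} {Du₀ : Fin n → Space n → Space n}
    {θ₀ θ₁ : Space n → ℝ} (hb : 0 < b) (hκ : 0 < κ) (hδ : 0 < δ)
    (hu₀ : MemL2L1 u₀) (hDu : HasWeakPartials u₀ Du₀)
    (hDu₀ : ∀ j, MemLp (Du₀ j) 2 volume) (hu₁ : MemL2L1 u₁) (hθ₀ : MemL2L1 θ₀)
    (hθ₁ : MemL2L1 θ₁) (t : ℝ) (ht : 0 ≤ t) :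
    MemLp (thetaHat b κ γ δ u₀ u₁ θ₀ θ₁ t) 2 volume :=
  memLp_theta (continuous_fourierVec hu₀) (continuous_fourierVec hu₁) (continuous_fourierReal hθ₀)
    (continuous_fourierReal hθ₁) (memLp_dataSize hu₀ hDu hDu₀ hu₁ hθ₀ hθ₁) hb hκ hδ ht

/-- Solving the system frequency by frequency gives a global solution. -/
lemma exists_isSolution {u₀ u₁ : Space n → Space n} {Du₀ : Fin n → Space n → Space n}
    {θ₀ θ₁ : Space n → ℝ} (hb : 0 < b) (hκ : 0 < κ) (hδ : 0 < δ)
    (hu₀ : MemL2L1 u₀) (hDu : HasWeakPartials u₀ Du₀)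
    (hDu₀ : ∀ j, MemLp (Du₀ j) 2 volume) (hu₁ : MemL2L1 u₁) (hθ₀ : MemL2L1 θ₀)
    (hθ₁ : MemL2L1 θ₁) :
    ∃ u, IsSolution b κ γ δ u₀ u₁ θ₀ θ₁ u
      (realPath (thetaHat b κ γ δ u₀ u₁ θ₀ θ₁)
        (memLp_thetaHat hb hκ hδ hu₀ hDu hDu₀ hu₁ hθ₀ hθ₁)) := by
  have cU₀ := continuous_fourierVec hu₀
  have cU₁ := continuous_fourierVec hu₁
  have cΘ₀ := continuous_fourierReal hθ₀
  have cΘ₁ := continuous_fourierReal hθ₁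
  have hD := memLp_dataSize hu₀ hDu hDu₀ hu₁ hθ₀ hθ₁
  set U₀ := fourierVec u₀ with hU₀
  set U₁ := fourierVec u₁ with hU₁
  set Θ₀ := fourierReal θ₀ with hΘ₀
  set Θ₁ := fourierReal θ₁ with hΘ₁
  set S := spec b κ γ δ U₀ U₁ Θ₀ Θ₁ with hS
  have hXU := fun (j : Fin n) (t : ℝ) (ht : 0 ≤ t) =>
    memLp_displacement (γ := γ) cU₀ cU₁ cΘ₀ cΘ₁ hD hb hκ hδ j ht
  have hXθ := memLp_thetaHat (γ := γ) hb hκ hδ hu₀ hDu hDu₀ hu₁ hθ₀ hθ₁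
  set v : Fin n → ℝ → Lp ℝ 2 (volume : Measure (Space n)) := fun j =>
    realPath (fun t w => projU j (S t w)) (hXU j) with hv
  have hcontS : ∀ (ℓ : Phase n →L[ℂ] ℂ) (w : Space n), Continuous fun t => ℓ (S t w) := by
    intro ℓ w
    have : Continuous fun t => S t w := continuous_iff_continuousAt.2 fun t =>
      (hasDerivAt_sol (waveVec w) (U₀ w) (U₁ w) (Θ₀ w) (Θ₁ w) t).continuousAt
    exact ℓ.continuous.comp this
  have hpairU : ∀ (j : Fin n) (φ : 𝓢(Space n, ℝ)) (t : ℝ), 0 ≤ t →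
      pair (fun x => vecPath v t x j) φ
        = reProj (projU j) (moment b κ γ δ U₀ U₁ Θ₀ Θ₁ (𝓕⁻ (toC φ)) 0 t) := by
    intro j φ t ht
    have h1 : pair (fun x => vecPath v t x j) φ = pair (v j t) φ := by
      refine integral_congr_ae ?_
      filter_upwards [vecPath_ae v t] with x hx
      rw [hx j]
    rw [h1, hv, pair_realPath _ ht, reProj_apply,
      proj_moment (γ := γ) cU₀ cU₁ cΘ₀ cΘ₁ hD hb hκ hδ _ _ _ ht]
    simp only [pow_zero, one_apply_eq_self, hS]
  have hpairθ : ∀ (φ : 𝓢(Space n, ℝ)) (t : ℝ), 0 ≤ t →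
      pair (realPath (thetaHat b κ γ δ u₀ u₁ θ₀ θ₁) hXθ t) φ
        = reProj (projTheta n) (moment b κ γ δ U₀ U₁ Θ₀ Θ₁ (𝓕⁻ (toC φ)) 0 t) := by
    intro φ t ht
    rw [pair_realPath _ ht, reProj_apply,
      proj_moment (γ := γ) cU₀ cU₁ cΘ₀ cΘ₁ hD hb hκ hδ _ _ _ ht]
    simp only [pow_zero, one_apply_eq_self, projTheta_apply]
    rfl
  have hCU := fun (j : Fin n) (φ : 𝓢(Space n, ℝ)) =>
    contDiffOn_moment (γ := γ) cU₀ cU₁ cΘ₀ cΘ₁ hD hb hκ hδ (𝓕⁻ (toC φ)) (reProj (projU j))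
      (hpairU j φ)
  have hCθ := fun (φ : 𝓢(Space n, ℝ)) =>
    contDiffOn_moment (γ := γ) cU₀ cU₁ cΘ₀ cΘ₁ hD hb hκ hδ (𝓕⁻ (toC φ)) (reProj (projTheta n))
      (hpairθ φ)
  have hint := fun (ℓ : Phase n →L[ℂ] ℂ) (ψ : 𝓢(Space n, ℂ)) (m : ℕ) (t : ℝ) (ht : 0 ≤ t) =>
    integrable_proj_moment (γ := γ) cU₀ cU₁ cΘ₀ cΘ₁ hD hb hκ hδ ℓ ψ m ht
  have hproj := fun (ℓ : Phase n →L[ℂ] ℂ) (ψ : 𝓢(Space n, ℂ)) (m : ℕ) (t : ℝ) (ht : 0 ≤ t) =>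
    proj_moment (γ := γ) cU₀ cU₁ cΘ₀ cΘ₁ hD hb hκ hδ ℓ ψ m ht
  have hS0 : ∀ w, S 0 w = (U₀ w, U₁ w, Θ₀ w, Θ₁ w + γ * Complex.I * dotC (waveVec w) (U₁ w)
      + (δ * ‖waveVec w‖ ^ 2 : ℝ) * Θ₀ w) := fun w => sol_zero _ _ _ _ _
  refine ⟨vecPath v, ?_, ?_, fun j φ => (hCU j φ).1, fun φ => (hCθ φ).1, ?_, ?_, ?_, ?_, ?_, ?_⟩
  · refine continuousOn_vecPath fun j => continuousOn_realPath _ (hcontS (projU j)) hD fun T => ?_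
    obtain ⟨C, hC, h⟩ := exists_sol_bounds (γ := γ) hb hκ hδ n T
    exact ⟨C, fun w t ht htT => (PiLp.norm_apply_le _ j).trans
      (h (waveVec w) t ht htT (U₀ w) (U₁ w) (Θ₀ w) (Θ₁ w)).1⟩
  · refine continuousOn_realPath _ (hcontS (projTheta n)) hD fun T => ?_
    obtain ⟨C, hC, h⟩ := exists_sol_bounds (γ := γ) hb hκ hδ n T
    exact ⟨C, fun w t ht htT => (h (waveVec w) t ht htT (U₀ w) (U₁ w) (Θ₀ w) (Θ₁ w)).2.1⟩
  · intro j φ t ht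
    rw [((hCU j φ).2 t ht).2, hpairU j _ t ht, hpairθ _ t ht]
    simp only [reProj_apply]
    have key : projU j (moment b κ γ δ U₀ U₁ Θ₀ Θ₁ (𝓕⁻ (toC φ)) 2 t)
        = ((b ^ 2 : ℝ) : ℂ) * projU j (moment b κ γ δ U₀ U₁ Θ₀ Θ₁ (𝓕⁻ (toC (lap φ))) 0 t)
          + (γ : ℂ) * projTheta n (moment b κ γ δ U₀ U₁ Θ₀ Θ₁ (𝓕⁻ (toC (partialD j φ))) 0 t) := by
      rw [hproj _ _ _ t ht, hproj _ _ _ t ht, hproj _ _ _ t ht, ← integral_const_mul,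
        ← integral_const_mul, ← integral_add ((hint _ _ _ t ht).const_mul _)
          ((hint _ _ _ t ht).const_mul _)]
      refine integral_congr_ae (Eventually.of_forall fun w => ?_)
      simp only [fourierInv_lap, fourierInv_partialD, pow_zero, one_apply_eq_self, projU_gen_sq]
      rw [norm_waveVec]
      simp only [waveVec, PiLp.smul_apply, smul_eq_mul]
      push_cast
      ring
    rw [key, Complex.add_re, Complex.re_ofReal_mul, Complex.re_ofReal_mul]
    ring
  · intro φ t ht
    rw [((hCθ φ).2 t ht).2, hpairθ _ t ht, ((hCθ (lap φ)).2 t ht).1]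
    simp only [((hCU _ (partialD _ φ)).2 t ht).2, reProj_apply]
    have key : projTheta n (moment b κ γ δ U₀ U₁ Θ₀ Θ₁ (𝓕⁻ (toC φ)) 2 t)
        = (κ : ℂ) * projTheta n (moment b κ γ δ U₀ U₁ Θ₀ Θ₁ (𝓕⁻ (toC (lap φ))) 0 t)
          + (δ : ℂ) * projTheta n (moment b κ γ δ U₀ U₁ Θ₀ Θ₁ (𝓕⁻ (toC (lap φ))) 1 t)
          + (γ : ℂ) * ∑ j,
            projU j (moment b κ γ δ U₀ U₁ Θ₀ Θ₁ (𝓕⁻ (toC (partialD j φ))) 2 t) := by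
      simp only [hproj _ _ _ t ht]
      rw [← integral_finsetSum _ fun j _ => hint _ _ _ t ht,
        ← integral_lincomb_three (hint _ _ _ t ht) (hint _ _ _ t ht)
          (integrable_finsetSum _ fun j _ => hint _ _ _ t ht)]
      refine integral_congr_ae (Eventually.of_forall fun w => ?_)
      simp only [fourierInv_lap, fourierInv_partialD, pow_zero, one_apply_eq_self]
      rw [projTheta_gen_sq, norm_waveVec]
      have e : ∑ j, -(2 * Real.pi * Complex.I * w j) * (𝓕⁻ (toC φ)) w
            * projU j ((gen b κ γ δ (waveVec w) ^ 2) (spec b κ γ δ U₀ U₁ Θ₀ Θ₁ t w))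
          = -Complex.I * (𝓕⁻ (toC φ)) w * ∑ j, (waveVec w j : ℂ)
            * projU j ((gen b κ γ δ (waveVec w) ^ 2) (spec b κ γ δ U₀ U₁ Θ₀ Θ₁ t w)) := by
        rw [Finset.mul_sum]
        refine Finset.sum_congr rfl fun j _ => ?_
        simp only [waveVec, PiLp.smul_apply, smul_eq_mul]
        push_cast
        ring
      rw [e]
      push_cast
      ring
    rw [key, Complex.add_re, Complex.add_re, Complex.re_ofReal_mul, Complex.re_ofReal_mul,
      Complex.re_ofReal_mul, Complex.re_sum]
    ring
  · have h : ∀ᵐ x, ∀ j, v j 0 x = u₀ x j := ae_all_iff.2 fun j =>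
      realPath_zero (hXU j) (memLp_apply hu₀.2 j) (memLp_apply hu₀.1 j)
        (funext fun w => by
          change projU j (S 0 w) = _
          rw [hS0]; rfl)
    filter_upwards [h, vecPath_ae v 0] with x h1 h2
    ext j
    rw [h2, h1]
  · intro j φ
    rw [((hCU j φ).2 0 le_rfl).1, reProj_apply, hproj _ _ _ 0 le_rfl]
    have := integral_fourierInv_mul_fourier (memLp_apply hu₁.2 j) (memLp_apply hu₁.1 j) φ
    rw [← Complex.ofReal_re (pair _ _), ← this]
    congr 2
    funext w
    rw [← hS, hS0, pow_one, gen_apply]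
    rfl
  · exact realPath_zero hXθ hθ₀.2 hθ₀.1 (funext fun w => by
      change (S 0 w).2.2.1 = _
      rw [hS0]; rfl)
  · intro φ
    rw [((hCθ φ).2 0 le_rfl).1, reProj_apply, hproj _ _ _ 0 le_rfl]
    have := integral_fourierInv_mul_fourier hθ₁.2 hθ₁.1 φ
    rw [← Complex.ofReal_re (pair _ _), ← this]
    congr 2
    funext w
    rw [← hS, hS0, pow_one, gen_apply, projTheta_apply]
    simp only [hΘ₁, fourierReal]
    ring

end ExistenceTheorem

/-! ### Radial integrals -/

section Radial

variable {n : ℕ}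

/-- Polar coordinates in the wave vector. -/
lemma exists_radial (hn : 1 ≤ n) : ∃ K : ℝ, 0 < K ∧ ∀ f : ℝ → ℝ,
    (Integrable (fun w : Space n => f ‖waveVec w‖) ↔
      IntegrableOn (fun r => r ^ (n - 1) * f r) (Ioi 0)) ∧
    ∫ w : Space n, f ‖waveVec w‖ = K * ∫ r in Ioi (0 : ℝ), r ^ (n - 1) * f r := by
  have : Nonempty (Fin n) := ⟨⟨0, hn⟩⟩
  have hdim : Module.finrank ℝ (Space n) = n := by simp
  have hpi : (2 * Real.pi : ℝ) ≠ 0 := by positivity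
  refine ⟨|((2 * Real.pi) ^ n)⁻¹| * (n * (volume : Measure (Space n)).real (Metric.ball 0 1)),
    ?_, fun f => ⟨?_, ?_⟩⟩
  · have h1 : 0 < (volume : Measure (Space n)).real (Metric.ball 0 1) :=
      ENNReal.toReal_pos (Metric.measure_ball_pos _ _ one_pos).ne' measure_ball_lt_top.ne
    have h2 : (0 : ℝ) < n := by exact_mod_cast hn
    positivity
  · have h1 := integrable_comp_smul_iff (volume : Measure (Space n))
      (fun w : Space n => f ‖w‖) hpi
    have h2 := integrable_fun_norm_addHaar (volume : Measure (Space n)) (f := f)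
    rw [hdim] at h2
    simp only [smul_eq_mul] at h2
    exact h1.trans h2
  · have h1 := Measure.integral_comp_smul (volume : Measure (Space n))
      (fun w : Space n => f ‖w‖) (2 * Real.pi)
    have h2 := integral_fun_norm_addHaar (volume : Measure (Space n)) f
    rw [hdim] at h1 h2
    simp only [smul_eq_mul, nsmul_eq_mul] at h1 h2
    simp only [waveVec]
    rw [h1, h2]
    ring

lemma aestronglyMeasurable_radial {f : ℝ → ℝ} (hf : Measurable f) :
    AEStronglyMeasurable (fun w : Space n => f ‖waveVec w‖) volume :=
  (hf.comp continuous_waveVec.norm.measurable).aestronglyMeasurable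

/-- `L²` bound for a radial function supported in the unit ball. -/
lemma radial_L2_le (hn : 1 ≤ n) : ∃ K : ℝ, 0 < K ∧ ∀ f g : ℝ → ℝ, Measurable f →
    (∀ r, 1 < r → f r = 0) → (∀ r ∈ Ioc (0 : ℝ) 1, r ^ (n - 1) * f r ^ 2 ≤ g r) →
    IntegrableOn g (Ioc 0 1) →
    MemLp (fun w : Space n => f ‖waveVec w‖) 2 volume ∧
    (eLpNorm (fun w : Space n => f ‖waveVec w‖) 2 volume).toReal ^ 2
      ≤ K * ∫ r in Ioc (0 : ℝ) 1, g r := by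
  obtain ⟨K, hK, h⟩ := exists_radial hn
  refine ⟨K, hK, fun f g hf h0 hfg hg => ?_⟩
  have hsupp : ∀ r ∈ Ioi (0 : ℝ) \ Ioc 0 1, r ^ (n - 1) * f r ^ 2 = 0 := by
    intro r hr
    have : 1 < r := by
      by_contra h1
      exact hr.2 ⟨hr.1, not_lt.1 h1⟩
    rw [h0 r this]; simp
  have hi : IntegrableOn (fun r => r ^ (n - 1) * f r ^ 2) (Ioc 0 1) := by
    refine Integrable.mono' hg ?_ ?_
    · exact (Measurable.aestronglyMeasurable (by fun_prop))
    · refine (ae_restrict_mem measurableSet_Ioc).mono fun r hr => ?_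
      rw [Real.norm_of_nonneg (by have := hr.1; positivity)]
      exact hfg r hr
  have hi2 : IntegrableOn (fun r => r ^ (n - 1) * f r ^ 2) (Ioi 0) :=
    hi.of_forall_sdiff_eq_zero measurableSet_Ioi hsupp
  have hint := (h fun r => f r ^ 2).1.2 hi2
  have hm : MemLp (fun w : Space n => f ‖waveVec w‖) 2 volume :=
    (memLp_two_iff_integrable_sq (aestronglyMeasurable_radial hf)).2 hint
  refine ⟨hm, ?_⟩
  rw [toReal_eLpNorm_two_sq hm]
  have e1 : ∫ w : Space n, ‖f ‖waveVec w‖‖ ^ 2 = ∫ w : Space n, (fun r => f r ^ 2) ‖waveVec w‖ := by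
    refine integral_congr_ae (Eventually.of_forall fun w => ?_)
    simp
  rw [e1, (h fun r => f r ^ 2).2]
  have e2 : ∫ r in Ioi (0 : ℝ), r ^ (n - 1) * f r ^ 2 = ∫ r in Ioc (0 : ℝ) 1, r ^ (n - 1) * f r ^ 2 :=
    setIntegral_eq_of_subset_of_forall_sdiff_eq_zero measurableSet_Ioi (fun r hr => hr.1) hsupp
  rw [e2]
  exact mul_le_mul_of_nonneg_left (setIntegral_mono_on hi hg measurableSet_Ioc hfg) hK.le

lemma exists_gauss_moment {q c : ℝ} (hq : -1 < q) (hc : 0 < c) : ∃ C : ℝ, 0 < C ∧ ∀ t : ℝ, 0 ≤ t →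
    IntegrableOn (fun r : ℝ => r ^ q * Real.exp (-(c * (1 + t)) * r ^ 2)) (Ioi 0) ∧
    ∫ r in Ioi (0 : ℝ), r ^ q * Real.exp (-(c * (1 + t)) * r ^ 2)
      = C * (1 + t) ^ (-(q + 1) / 2) := by
  refine ⟨c ^ (-(q + 1) / 2) * (1 / 2) * Real.Gamma ((q + 1) / 2), ?_, fun t ht => ?_⟩
  · have : 0 < Real.Gamma ((q + 1) / 2) := Real.Gamma_pos_of_pos (by linarith)
    positivity
  · have h1 : 0 < c * (1 + t) := by positivity
    refine ⟨integrableOn_rpow_mul_exp_neg_mul_sq h1 hq, ?_⟩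
    have := integral_rpow_mul_exp_neg_mul_rpow (p := 2) two_pos hq h1
    simp only [Real.rpow_two] at this
    rw [this, Real.mul_rpow hc.le (by positivity)]
    ring

/-- The diffusive part of the low frequencies. -/
noncomputable def gaussLow (c t r : ℝ) : ℝ := if r ≤ 1 then Real.exp (-(c * r ^ 2 * t)) else 0

/-- The wave part of the low frequencies, including its singularity. -/
noncomputable def waveLow (c t r : ℝ) : ℝ :=
  if r ≤ 1 then min t (Real.exp (-(c * r ^ 2 * t)) / r) else 0

lemma measurable_gaussLow (c t : ℝ) : Measurable (gaussLow c t) :=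
  Measurable.ite measurableSet_Iic (by fun_prop) measurable_const

lemma measurable_waveLow (c t : ℝ) : Measurable (waveLow c t) :=
  Measurable.ite measurableSet_Iic
    (measurable_const.min (Measurable.div (by fun_prop) measurable_id)) measurable_const

/-- Gaussians on the unit interval are controlled, uniformly in `t ≥ 0`, by the shifted ones. -/
lemma exp_neg_le_shift {c r t : ℝ} (hc : 0 ≤ c) (hr : 0 ≤ r) (hr1 : r ≤ 1) :
    Real.exp (-(c * r ^ 2 * t)) ^ 2
      ≤ Real.exp (2 * c) * Real.exp (-(2 * c * (1 + t)) * r ^ 2) := by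
  rw [← Real.exp_add, ← Real.exp_nat_mul]
  refine Real.exp_le_exp.2 ?_
  have : r ^ 2 ≤ 1 := pow_le_one₀ hr hr1
  have h2 : c * r ^ 2 ≤ c * 1 := by gcongr
  push_cast
  linarith

/-- The diffusive part decays like the heat kernel. -/
lemma exists_gaussLow_le (hn : 1 ≤ n) {c : ℝ} (hc : 0 < c) : ∃ C : ℝ, 0 < C ∧ ∀ t : ℝ, 0 ≤ t →
    MemLp (fun w : Space n => gaussLow c t ‖waveVec w‖) 2 volume ∧
    (eLpNorm (fun w : Space n => gaussLow c t ‖waveVec w‖) 2 volume).toReal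
      ≤ C * (1 + t) ^ (-(n : ℝ) / 4) := by
  obtain ⟨K, hK, h⟩ := radial_L2_le hn
  have hn' : (1 : ℝ) ≤ n := by exact_mod_cast hn
  obtain ⟨C, hC, hm⟩ := exists_gauss_moment (q := (n : ℝ) - 1) (c := 2 * c) (by linarith) (by linarith)
  refine ⟨√(K * (Real.exp (2 * c) * C)), by positivity, fun t ht => ?_⟩
  obtain ⟨h1, h2⟩ := hm t ht
  have hsub : Ioc (0 : ℝ) 1 ⊆ Ioi 0 := fun r hr => hr.1
  have := h (gaussLow c t) (fun r => Real.exp (2 * c) * (r ^ ((n : ℝ) - 1)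
    * Real.exp (-(2 * c * (1 + t)) * r ^ 2))) (measurable_gaussLow c t)
    (fun r hr => if_neg (not_le.2 hr)) (fun r hr => ?_) ((h1.mono_set hsub).const_mul _)
  · refine ⟨this.1, ?_⟩
    have h0 : 0 ≤ 1 + t := by linarith
    refine (pow_le_pow_iff_left₀ ENNReal.toReal_nonneg (by positivity) two_ne_zero).1
      (this.2.trans ?_)
    rw [mul_pow, Real.sq_sqrt (by positivity), ← Real.rpow_natCast _ 2, ← Real.rpow_mul h0,
      integral_const_mul]
    have h3 : ∫ r in Ioc (0 : ℝ) 1, r ^ ((n : ℝ) - 1) * Real.exp (-(2 * c * (1 + t)) * r ^ 2)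
        ≤ C * (1 + t) ^ (-(n : ℝ) / 4 * (2 : ℕ)) := by
      have e : -(n : ℝ) / 4 * (2 : ℕ) = -((n : ℝ) - 1 + 1) / 2 := by push_cast; ring
      rw [e, ← h2]
      refine setIntegral_mono_set h1 ?_ hsub.eventuallyLE
      refine (ae_restrict_mem measurableSet_Ioi).mono fun r hr => ?_
      have : (0 : ℝ) < r := hr
      simp only [Pi.zero_apply]; positivity
    calc _ ≤ K * (Real.exp (2 * c) * (C * (1 + t) ^ (-(n : ℝ) / 4 * (2 : ℕ)))) := by gcongr
      _ = _ := by ring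
  · have e : r ^ (n - 1) = r ^ ((n : ℝ) - 1) := by
      rw [← Real.rpow_natCast, Nat.cast_sub hn, Nat.cast_one]
    have := exp_neg_le_shift (t := t) hc.le hr.1.le hr.2
    have hr0 := hr.1
    rw [gaussLow, if_pos hr.2, e]
    calc _ ≤ r ^ ((n : ℝ) - 1) * (Real.exp (2 * c) * Real.exp (-(2 * c * (1 + t)) * r ^ 2)) := by
          gcongr
      _ = _ := by ring

/-- An upper bound without the exponential factor, which has an elementary primitive also after
multiplication by `r`. -/
lemma waveLow_sq_le {c t r : ℝ} (hc : 0 ≤ c) (ht : 0 ≤ t) (hr : 0 < r) (hr1 : r ≤ 1) :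
    waveLow c t r ^ 2 ≤ 2 * t ^ 2 / (1 + t ^ 2 * r ^ 2) := by
  rw [waveLow, if_pos hr1]
  have h0 : 0 ≤ min t (Real.exp (-(c * r ^ 2 * t)) / r) := le_min ht (by positivity)
  rw [le_div_iff₀ (by positivity)]
  have h1 : min t (Real.exp (-(c * r ^ 2 * t)) / r) ≤ t := min_le_left _ _
  have h2 : min t (Real.exp (-(c * r ^ 2 * t)) / r) * r ≤ 1 := by
    have : min t (Real.exp (-(c * r ^ 2 * t)) / r) ≤ 1 / r := (min_le_right _ _).trans (by
      gcongr
      exact Real.exp_le_one_iff.2 (by have : 0 ≤ c * r ^ 2 * t := by positivity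
                                      linarith))
    rwa [le_div_iff₀ hr] at this
  set m := min t (Real.exp (-(c * r ^ 2 * t)) / r)
  have h3 : m ^ 2 ≤ t ^ 2 := by gcongr
  have h4 : (m * r) ^ 2 ≤ 1 := pow_le_one₀ (by positivity) h2
  calc m ^ 2 * (1 + t ^ 2 * r ^ 2) = m ^ 2 + t ^ 2 * (m * r) ^ 2 := by ring
    _ ≤ t ^ 2 + t ^ 2 * 1 := by gcongr
    _ = _ := by ring

lemma rateE_nonneg (n : ℕ) {t : ℝ} (ht : 0 ≤ t) : 0 ≤ rateE n t := by
  unfold rateE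
  split_ifs
  · positivity
  · have : 0 ≤ Real.log (Real.exp 1 + t) :=
      Real.log_nonneg (by have := Real.add_one_le_exp (1 : ℝ); linarith)
    positivity
  · positivity

lemma rateE_sq (n : ℕ) {t : ℝ} (ht : 0 ≤ t) : rateE n t ^ 2 =
    if n = 1 then 1 + t else if n = 2 then Real.log (Real.exp 1 + t)
      else (1 + t) ^ (1 - (n : ℝ) / 2) := by
  have h0 : 0 ≤ 1 + t := by linarith
  unfold rateE
  split_ifs
  · rw [← Real.rpow_natCast, ← Real.rpow_mul h0]; norm_num
  · have : 0 ≤ Real.log (Real.exp 1 + t) :=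
      Real.log_nonneg (by have := Real.add_one_le_exp (1 : ℝ); linarith)
    rw [← Real.rpow_natCast, ← Real.rpow_mul this]; norm_num
  · rw [← Real.rpow_natCast, ← Real.rpow_mul h0]
    congr 1; push_cast; ring

/-- The wave part has the size `𝓔ₙ`. In dimensions one and two the singularity `1 / r` is not square
integrable, and its cut-off at the height `t` determines the growth; in higher dimensions the diffusion
does. -/
lemma exists_waveLow_le (hn : 1 ≤ n) {c : ℝ} (hc : 0 < c) : ∃ C : ℝ, 0 < C ∧ ∀ t : ℝ, 0 ≤ t →
    MemLp (fun w : Space n => waveLow c t ‖waveVec w‖) 2 volume ∧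
    (eLpNorm (fun w : Space n => waveLow c t ‖waveVec w‖) 2 volume).toReal ≤ C * rateE n t := by
  obtain ⟨K, hK, h⟩ := radial_L2_le hn
  -- it is enough to bound the square, by an integral over the unit interval
  suffices H : ∃ C : ℝ, 0 < C ∧ ∀ t : ℝ, 0 ≤ t → ∃ g : ℝ → ℝ,
      (∀ r ∈ Ioc (0 : ℝ) 1, r ^ (n - 1) * waveLow c t r ^ 2 ≤ g r) ∧ IntegrableOn g (Ioc 0 1) ∧
      ∫ r in Ioc (0 : ℝ) 1, g r ≤ C * rateE n t ^ 2 by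
    obtain ⟨C, hC, H⟩ := H
    refine ⟨√(K * C), by positivity, fun t ht => ?_⟩
    obtain ⟨g, g1, g2, g3⟩ := H t ht
    have := h (waveLow c t) g (measurable_waveLow c t) (fun r hr => if_neg (not_le.2 hr)) g1 g2
    refine ⟨this.1, (pow_le_pow_iff_left₀ ENNReal.toReal_nonneg
      (mul_nonneg (Real.sqrt_nonneg _) (rateE_nonneg n ht)) two_ne_zero).1 (this.2.trans ?_)⟩
    rw [mul_pow, Real.sq_sqrt (by positivity)]
    calc _ ≤ K * (C * rateE n t ^ 2) := by gcongr
      _ = _ := by ring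
  rcases eq_or_ne n 1 with h1 | h1
  · subst h1
    refine ⟨2 * Real.pi, by positivity, fun t ht =>
      ⟨fun r => 2 * t ^ 2 / (1 + t ^ 2 * r ^ 2), ?_, ?_, ?_⟩⟩
    · intro r hr
      simpa using waveLow_sq_le hc.le ht hr.1 hr.2
    · refine (Continuous.integrableOn_Icc ?_).mono_set Ioc_subset_Icc_self
      exact continuous_const.div (by fun_prop) fun r => by positivity
    · rw [rateE_sq _ ht, if_pos rfl, ← intervalIntegral.integral_of_le zero_le_one,
        intervalIntegral.integral_eq_sub_of_hasDerivAt
          (f := fun r => 2 * t * Real.arctan (t * r)) (fun r _ => ?_) ?_]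
      · simp only [mul_one, mul_zero, Real.arctan_zero, sub_zero]
        have := (Real.arctan_lt_pi_div_two t).le
        calc 2 * t * Real.arctan t ≤ 2 * t * (Real.pi / 2) := by gcongr
          _ = Real.pi * t := by ring
          _ ≤ 2 * Real.pi * (1 + t) := by nlinarith [Real.pi_pos]
      · refine Continuous.intervalIntegrable ?_ _ _
        exact continuous_const.div (by fun_prop) fun r => by positivity
      · have := ((Real.hasDerivAt_arctan (t * r)).comp r ((hasDerivAt_id r).const_mul t)).const_mul
          (2 * t)
        refine this.congr_deriv ?_
        have : 1 + (t * r) ^ 2 ≠ 0 := by positivity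
        have : 1 + t ^ 2 * r ^ 2 ≠ 0 := by positivity
        field_simp
  rcases eq_or_ne n 2 with h2 | h2
  · subst h2
    refine ⟨2, by positivity, fun t ht =>
      ⟨fun r => 2 * t ^ 2 * r / (1 + t ^ 2 * r ^ 2), ?_, ?_, ?_⟩⟩
    · intro r hr
      have := mul_le_mul_of_nonneg_left (waveLow_sq_le hc.le ht hr.1 hr.2) hr.1.le
      calc r ^ (2 - 1) * waveLow c t r ^ 2 = r * waveLow c t r ^ 2 := by norm_num
        _ ≤ _ := this
        _ = _ := by ring
    · refine (Continuous.integrableOn_Icc ?_).mono_set Ioc_subset_Icc_self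
      exact Continuous.div (by fun_prop) (by fun_prop) fun r => by positivity
    · rw [rateE_sq _ ht, if_neg (by norm_num), if_pos rfl,
        ← intervalIntegral.integral_of_le zero_le_one,
        intervalIntegral.integral_eq_sub_of_hasDerivAt
          (f := fun r => Real.log (1 + t ^ 2 * r ^ 2)) (fun r _ => ?_) ?_]
      · simp only [one_pow, mul_one, ne_eq, OfNat.ofNat_ne_zero, not_false_eq_true, zero_pow,
          mul_zero, add_zero, Real.log_one, sub_zero]
        have he : 1 ≤ Real.exp 1 := by have := Real.add_one_le_exp (1 : ℝ); linarith
        have : 1 + t ^ 2 ≤ (Real.exp 1 + t) ^ 2 := by nlinarith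
        calc Real.log (1 + t ^ 2) ≤ Real.log ((Real.exp 1 + t) ^ 2) :=
              Real.log_le_log (by positivity) this
          _ = _ := by rw [Real.log_pow]; norm_num
      · refine Continuous.intervalIntegrable ?_ _ _
        exact Continuous.div (by fun_prop) (by fun_prop) fun r => by positivity
      · have := (((hasDerivAt_pow 2 r).const_mul (t ^ 2)).const_add 1).log
          (by positivity : 1 + t ^ 2 * r ^ 2 ≠ 0)
        refine this.congr_deriv ?_
        norm_num
        ring
  · have h3 : 3 ≤ n := by omega
    have h3' : (3 : ℝ) ≤ n := by exact_mod_cast h3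
    obtain ⟨C, hC, hm⟩ := exists_gauss_moment (q := (n : ℝ) - 3) (c := 2 * c) (by linarith)
      (by linarith)
    refine ⟨Real.exp (2 * c) * C, by positivity, fun t ht => ⟨fun r => Real.exp (2 * c)
      * (r ^ ((n : ℝ) - 3) * Real.exp (-(2 * c * (1 + t)) * r ^ 2)), ?_, ?_, ?_⟩⟩
    · intro r hr
      have hr0 := hr.1
      have a1 : waveLow c t r ^ 2 ≤ (Real.exp (-(c * r ^ 2 * t)) / r) ^ 2 := by
        rw [waveLow, if_pos hr.2]
        exact pow_le_pow_left₀ (le_min ht (by positivity)) (min_le_right _ _) 2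
      have a2 := exp_neg_le_shift (t := t) hc.le hr.1.le hr.2
      have e : r ^ (n - 1) = r ^ ((n : ℝ) - 3) * r ^ 2 := by
        rw [← Real.rpow_natCast, ← Real.rpow_natCast r 2, ← Real.rpow_add hr0,
          Nat.cast_sub (by omega)]
        congr 1; push_cast; ring
      calc r ^ (n - 1) * waveLow c t r ^ 2
          ≤ r ^ (n - 1) * (Real.exp (-(c * r ^ 2 * t)) / r) ^ 2 := by gcongr
        _ = r ^ ((n : ℝ) - 3) * Real.exp (-(c * r ^ 2 * t)) ^ 2 := by
            rw [e]; field_simp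
        _ ≤ r ^ ((n : ℝ) - 3) * (Real.exp (2 * c) * Real.exp (-(2 * c * (1 + t)) * r ^ 2)) := by
            gcongr
        _ = _ := by ring
    · exact ((hm t ht).1.mono_set fun r hr => hr.1).const_mul _
    · rw [rateE_sq _ ht, if_neg h1, if_neg h2, integral_const_mul,
        mul_assoc (Real.exp (2 * c))]
      refine mul_le_mul_of_nonneg_left ?_ (Real.exp_pos _).le
      have e : 1 - (n : ℝ) / 2 = -((n : ℝ) - 3 + 1) / 2 := by ring
      rw [e, ← (hm t ht).2]
      have hsub : Ioc (0 : ℝ) 1 ⊆ Ioi 0 := fun r hr => hr.1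
      refine setIntegral_mono_set (hm t ht).1 ?_ hsub.eventuallyLE
      refine (ae_restrict_mem measurableSet_Ioi).mono fun r hr => ?_
      have : (0 : ℝ) < r := hr
      simp only [Pi.zero_apply]; positivity

lemma memLp_gauss (hn : 1 ≤ n) {a : ℝ} (ha : 0 < a) :
    MemLp (fun w : Space n => Real.exp (-(a * ‖waveVec w‖ ^ 2))) 1 volume ∧
    MemLp (fun w : Space n => Real.exp (-(a * ‖waveVec w‖ ^ 2))) 2 volume := by
  obtain ⟨K, -, h⟩ := exists_radial hn
  have hn' : (1 : ℝ) ≤ n := by exact_mod_cast hn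
  have hi : ∀ a : ℝ, 0 < a → Integrable (fun w : Space n => Real.exp (-(a * ‖waveVec w‖ ^ 2))) := by
    intro a ha
    refine (h fun r => Real.exp (-(a * r ^ 2))).1.2 ?_
    refine (integrableOn_rpow_mul_exp_neg_mul_sq ha (s := (n : ℝ) - 1) (by linarith)).congr_fun
      (fun r hr => ?_) measurableSet_Ioi
    have e : r ^ (n - 1) = r ^ ((n : ℝ) - 1) := by
      rw [← Real.rpow_natCast, Nat.cast_sub hn, Nat.cast_one]
    simp only [e, neg_mul]
  refine ⟨memLp_one_iff_integrable.2 (hi a ha), ?_⟩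
  rw [memLp_two_iff_integrable_sq (hi a ha).1]
  refine (hi (2 * a) (by linarith)).congr (Eventually.of_forall fun w => ?_)
  simp only
  rw [← Real.exp_nat_mul]
  congr 1; push_cast; ring

/-- All remainders decay like `(1 + t) ^ (-n / 4)`, which is negligible against the rate. -/
lemma rpow_le_rateE (hn : 1 ≤ n) {t : ℝ} (ht : 0 ≤ t) :
    (1 + t) ^ (-(n : ℝ) / 4) ≤ (1 + t) ^ (-(1 : ℝ) / 4) * rateE n t := by
  have h1 : 1 ≤ 1 + t := by linarith
  have h0 : 0 < 1 + t := by linarith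
  unfold rateE
  split_ifs with a a'
  · subst a
    rw [Nat.cast_one]
    refine le_mul_of_one_le_right (by positivity) (Real.one_le_rpow h1 (by norm_num))
  · subst a'
    have hl : 1 ≤ Real.log (Real.exp 1 + t) := by
      rw [Real.le_log_iff_exp_le (by positivity)]; linarith
    calc (1 + t) ^ (-((2 : ℕ) : ℝ) / 4) ≤ (1 + t) ^ (-(1 : ℝ) / 4) :=
          Real.rpow_le_rpow_of_exponent_le h1 (by norm_num)
      _ ≤ _ := le_mul_of_one_le_right (by positivity) (Real.one_le_rpow hl (by norm_num))
  · rw [← Real.rpow_add h0]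
    exact Real.rpow_le_rpow_of_exponent_le h1 (by linarith)

lemma rpow_isLittleO_rateE (hn : 1 ≤ n) :
    (fun t : ℝ => (1 + t) ^ (-(n : ℝ) / 4)) =o[atTop] fun t => rateE n t := by
  have h1 : (fun t : ℝ => (1 + t) ^ (-(n : ℝ) / 4)) =O[atTop]
      fun t => (1 + t) ^ (-(1 : ℝ) / 4) * rateE n t := by
    refine IsBigO.of_bound 1 ?_
    filter_upwards [eventually_ge_atTop 0] with t ht
    have h0 : 0 ≤ 1 + t := by linarith
    rw [one_mul, Real.norm_of_nonneg (by positivity),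
      Real.norm_of_nonneg (mul_nonneg (by positivity) (rateE_nonneg n ht))]
    exact rpow_le_rateE hn ht
  refine h1.trans_isLittleO ?_
  have h2 : Tendsto (fun t : ℝ => (1 + t) ^ (-(1 : ℝ) / 4)) atTop (nhds 0) := by
    have := (tendsto_rpow_neg_atTop (by norm_num : (0 : ℝ) < 1 / 4)).comp
      (tendsto_atTop_add_const_left atTop (1 : ℝ) tendsto_id)
    refine this.congr fun t => ?_
    simp only [Function.comp_apply, id]
    norm_num
  have := ((isLittleO_one_iff ℝ).2 h2).mul_isBigO (isBigO_refl (fun t => rateE n t) atTop)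
  simpa using this

/-- Exponential decay is faster than every polynomial one. -/
lemma exists_exp_le_rpow (n : ℕ) {c : ℝ} (hc : 0 < c) : ∃ C : ℝ, 0 < C ∧ ∀ t : ℝ, 0 ≤ t →
    Real.exp (-(c * t)) ≤ C * (1 + t) ^ (-(n : ℝ) / 4) := by
  refine ⟨n.factorial * Real.exp c / c ^ n, by positivity, fun t ht => ?_⟩
  have h1 : 1 ≤ 1 + t := by linarith
  have h0 : 0 < 1 + t := by linarith
  have h2 := Real.pow_div_factorial_le_exp (c * (1 + t)) (by positivity) n
  have h3 : (1 + t) ^ ((n : ℝ) / 4) ≤ (1 + t) ^ n := by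
    rw [← Real.rpow_natCast]
    exact Real.rpow_le_rpow_of_exponent_le h1 (by have : (0 : ℝ) ≤ n := Nat.cast_nonneg n
                                                  linarith)
  have e : -(n : ℝ) / 4 = -((n : ℝ) / 4) := by ring
  rw [e, Real.rpow_neg h0.le, ← div_eq_mul_inv, le_div_iff₀ (by positivity), le_div_iff₀ (by positivity)]
  rw [div_le_iff₀ (by positivity), mul_pow] at h2
  have h4 : Real.exp (c * (1 + t)) = Real.exp c * Real.exp (c * t) := by
    rw [← Real.exp_add]; ring_nf
  have h5 : Real.exp (-(c * t)) * Real.exp (c * t) = 1 := by rw [← Real.exp_add]; simp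
  calc Real.exp (-(c * t)) * (1 + t) ^ ((n : ℝ) / 4) * c ^ n
      ≤ Real.exp (-(c * t)) * (1 + t) ^ n * c ^ n := by gcongr
    _ = Real.exp (-(c * t)) * (c ^ n * (1 + t) ^ n) := by ring
    _ ≤ Real.exp (-(c * t)) * (Real.exp (c * (1 + t)) * n.factorial) := by gcongr
    _ = Real.exp (-(c * t)) * Real.exp (c * t) * (n.factorial * Real.exp c) := by rw [h4]; ring
    _ = _ := by rw [h5, one_mul]

end Radial

/-! ### The size of the profile -/

section Profile

variable {n : ℕ} {b κ γ δ : ℝ}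

lemma profileSymbol_zero_time (r : ℝ) : profileSymbol b κ γ δ 0 r = 0 := by
  simp [profileSymbol]

lemma measurable_profileSymbol (t : ℝ) : Measurable (profileSymbol b κ γ δ t) := by
  unfold profileSymbol
  fun_prop

/-- Bounds of the profile away from and near the frequency zero. The weights `2 cⱼ / δ` of the two waves
have the sum one. -/
lemma exists_profileSymbol_le (hb : 0 < b) (hκ : 0 < κ) (hγ : γ ≠ 0) (hδ : 0 < δ) :
    ∃ C c : ℝ, 0 < C ∧ 0 < c ∧ ∀ t r : ℝ, 0 ≤ t → 0 ≤ r →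
      |profileSymbol b κ γ δ t r| ≤ C * (Real.exp (-(c * r ^ 2 * t)) / r) ∧
      |profileSymbol b κ γ δ t r| ≤ t * Real.exp (-(c * r ^ 2 * t)) := by
  have p1 := c₁_pos (κ := κ) hb hγ hδ
  have p2 := c₂_pos (κ := κ) hb hγ hδ
  have v1 := ν₁_pos (γ := γ) hb hκ
  have v2 := ν₂_pos (γ := γ) hb hκ
  set a₁ := 2 * c₁ b κ γ δ / δ with ha₁
  set a₂ := 2 * c₂ b κ γ δ / δ with ha₂
  have q1 : 0 < a₁ := by positivity
  have q2 : 0 < a₂ := by positivity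
  have hsum : a₁ + a₂ = 1 := by
    rw [ha₁, ha₂, ← add_div, ← mul_add, c₁_add_c₂]; field_simp
  refine ⟨a₁ / ν₁ b κ γ + a₂ / ν₂ b κ γ, min (c₁ b κ γ δ) (c₂ b κ γ δ), by positivity,
    lt_min p1 p2, fun t r ht hr => ?_⟩
  set E := Real.exp (-(min (c₁ b κ γ δ) (c₂ b κ γ δ) * r ^ 2 * t)) with hE
  have e1 : Real.exp (-(c₁ b κ γ δ) * r ^ 2 * t) ≤ E := by
    refine Real.exp_le_exp.2 ?_
    have : min (c₁ b κ γ δ) (c₂ b κ γ δ) * (r ^ 2 * t) ≤ c₁ b κ γ δ * (r ^ 2 * t) := by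
      gcongr; exact min_le_left _ _
    linarith
  have e2 : Real.exp (-(c₂ b κ γ δ) * r ^ 2 * t) ≤ E := by
    refine Real.exp_le_exp.2 ?_
    have : min (c₁ b κ γ δ) (c₂ b κ γ δ) * (r ^ 2 * t) ≤ c₂ b κ γ δ * (r ^ 2 * t) := by
      gcongr; exact min_le_right _ _
    linarith
  have hs1 : ∀ ν : ℝ, 0 < ν → |Real.sin (ν * r * t) / (ν * r)| ≤ 1 / (ν * r) := by
    intro ν hν
    rw [abs_div, abs_of_nonneg (by positivity : 0 ≤ ν * r)]
    gcongr
    exact Real.abs_sin_le_one _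
  have hs2 : ∀ ν : ℝ, 0 < ν → |Real.sin (ν * r * t) / (ν * r)| ≤ t := by
    intro ν hν
    rw [abs_div, abs_of_nonneg (by positivity : 0 ≤ ν * r)]
    refine div_le_of_le_mul₀ (by positivity) ht ?_
    refine Real.abs_sin_le_abs.trans ?_
    rw [abs_of_nonneg (by positivity)]
    linarith
  have hstep : ∀ x₁ x₂ : ℝ, |Real.sin (ν₁ b κ γ * r * t) / (ν₁ b κ γ * r)| ≤ x₁ →
      |Real.sin (ν₂ b κ γ * r * t) / (ν₂ b κ γ * r)| ≤ x₂ →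
      |profileSymbol b κ γ δ t r| ≤ a₁ * x₁ * E + a₂ * x₂ * E := by
    intro x₁ x₂ h1 h2
    rw [profileSymbol_eq hb hγ hδ]
    refine (abs_add_le _ _).trans ?_
    rw [abs_mul, abs_mul, abs_mul, abs_mul, abs_of_pos q1, abs_of_pos q2, Real.abs_exp,
      Real.abs_exp]
    have := (abs_nonneg _).trans h1
    have := (abs_nonneg _).trans h2
    gcongr
  constructor
  · refine (hstep _ _ (hs1 _ v1) (hs1 _ v2)).trans (le_of_eq ?_)
    rw [div_eq_mul_inv, div_eq_mul_inv, mul_inv, mul_inv]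
    ring
  · refine (hstep _ _ (hs2 _ v1) (hs2 _ v2)).trans (le_of_eq ?_)
    rw [← add_mul, ← add_mul, hsum]; ring

lemma memLp_profileSymbol (hn : 1 ≤ n) (hb : 0 < b) (hκ : 0 < κ) (hγ : γ ≠ 0) (hδ : 0 < δ) {t : ℝ}
    (ht : 0 ≤ t) :
    MemLp (fun w : Space n => profileSymbol b κ γ δ t ‖waveVec w‖) 1 volume ∧
    MemLp (fun w : Space n => profileSymbol b κ γ δ t ‖waveVec w‖) 2 volume := by
  rcases ht.eq_or_lt with h | h
  · subst h
    simp only [profileSymbol_zero_time]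
    exact ⟨MemLp.zero, MemLp.zero⟩
  · obtain ⟨C, c, -, hc, hs⟩ := exists_profileSymbol_le (κ := κ) (γ := γ) hb hκ hγ hδ
    have hm := aestronglyMeasurable_radial (n := n) (measurable_profileSymbol (b := b) (κ := κ)
      (γ := γ) (δ := δ) t)
    have hg := memLp_gauss hn (mul_pos hc h)
    have hle : ∀ w : Space n, ‖profileSymbol b κ γ δ t ‖waveVec w‖‖
        ≤ ‖t * Real.exp (-(c * t * ‖waveVec w‖ ^ 2))‖ := by
      intro w
      refine ((hs t ‖waveVec w‖ ht (norm_nonneg _)).2).trans ((le_of_eq ?_).trans (le_abs_self _))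
      ring_nf
    exact ⟨(hg.1.const_mul t).of_le hm (Eventually.of_forall hle),
      (hg.2.const_mul t).of_le hm (Eventually.of_forall hle)⟩

/-- Oscillating integrals with a decreasing amplitude. -/
lemma abs_integral_mul_cos_le {g g' : ℝ → ℝ} {a b ω : ℝ} (hab : a ≤ b) (hω : 0 < ω)
    (hg : ∀ s ∈ Icc a b, HasDerivAt g (g' s) s) (hg' : ContinuousOn g' (Icc a b))
    (hneg : ∀ s ∈ Icc a b, g' s ≤ 0) (hb0 : 0 ≤ g b) :
    |∫ s in a..b, g s * Real.cos (ω * s)| ≤ 2 * g a / ω := by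
  have huIcc : uIcc a b = Icc a b := uIcc_of_le hab
  have hi : IntervalIntegrable g' volume a b := by
    rw [← huIcc] at hg'; exact hg'.intervalIntegrable
  have hFTC : ∫ s in a..b, g' s = g b - g a :=
    intervalIntegral.integral_eq_sub_of_hasDerivAt (fun s hs => hg s (huIcc ▸ hs)) hi
  have hsin : ∀ s, HasDerivAt (fun s => Real.sin (ω * s) / ω) (Real.cos (ω * s)) s := by
    intro s
    have := (((hasDerivAt_id s).const_mul ω).sin).div_const ω
    refine this.congr_deriv ?_
    simp only [id, mul_one]; field_simp
  have hparts := intervalIntegral.integral_mul_deriv_eq_deriv_mul (a := a) (b := b) (u := g)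
    (u' := g') (v := fun s => Real.sin (ω * s) / ω) (v' := fun s => Real.cos (ω * s))
    (fun s hs => hg s (huIcc ▸ hs)) (fun s _ => hsin s) hi
    (Continuous.intervalIntegrable (by fun_prop) _ _)
  rw [hparts]
  have hga : g b ≤ g a := by
    have := intervalIntegral.integral_nonneg (μ := volume) hab fun s hs => neg_nonneg.2 (hneg s hs)
    rw [intervalIntegral.integral_neg] at this
    linarith
  have hsb : ∀ s, |Real.sin (ω * s) / ω| ≤ 1 / ω := fun s => by
    rw [abs_div, abs_of_pos hω]
    gcongr
    exact Real.abs_sin_le_one _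
  have hint : |∫ s in a..b, g' s * (Real.sin (ω * s) / ω)| ≤ (g a - g b) / ω := by
    have h1 := intervalIntegral.norm_integral_le_of_norm_le (μ := volume) hab
      (f := fun s => g' s * (Real.sin (ω * s) / ω)) (g := fun s => -g' s * (1 / ω))
      (Eventually.of_forall fun s hs => ?_) (hi.neg.mul_const _)
    · rw [intervalIntegral.integral_mul_const, intervalIntegral.integral_neg, hFTC] at h1
      refine h1.trans (le_of_eq ?_)
      ring
    · have hs' : s ∈ Icc a b := ⟨hs.1.le, hs.2⟩
      rw [Real.norm_eq_abs, abs_mul, abs_of_nonpos (hneg s hs')]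
      have := hneg s hs'
      exact mul_le_mul_of_nonneg_left (hsb s) (by linarith)
  have t1 : |g b * (Real.sin (ω * b) / ω)| ≤ g b * (1 / ω) := by
    rw [abs_mul, abs_of_nonneg hb0]
    exact mul_le_mul_of_nonneg_left (hsb b) hb0
  have t2 : |g a * (Real.sin (ω * a) / ω)| ≤ g a * (1 / ω) := by
    rw [abs_mul, abs_of_nonneg (hb0.trans hga)]
    exact mul_le_mul_of_nonneg_left (hsb a) (hb0.trans hga)
  have e : 2 * g a / ω = g b * (1 / ω) + g a * (1 / ω) + (g a - g b) / ω := by ring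
  rw [e]
  exact (abs_sub _ _).trans (add_le_add ((abs_sub _ _).trans (add_le_add t1 t2)) hint)

/-- The oscillating integrals that occur in the square of the profile. -/
lemma abs_integral_gauss_cos_le {d ω B : ℝ} (hd : 0 ≤ d) (hω : 0 < ω) (hB : 1 ≤ B) :
    |∫ s in (1 : ℝ)..B, Real.exp (-(d * s ^ 2)) / s * Real.cos (ω * s)| ≤ 2 / ω := by
  have hpos : ∀ s ∈ Icc 1 B, 0 < s := fun s hs => lt_of_lt_of_le one_pos hs.1
  have h := abs_integral_mul_cos_le (g := fun s => Real.exp (-(d * s ^ 2)) / s)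
    (g' := fun s => -((2 * d + 1 / s ^ 2) * Real.exp (-(d * s ^ 2)))) hB hω
    (fun s hs => ?_) ?_ (fun s hs => ?_) ?_
  · refine h.trans ?_
    simp only [one_pow, mul_one, div_one]
    have : Real.exp (-d) ≤ 1 := Real.exp_le_one_iff.2 (by linarith)
    gcongr
    linarith
  · have hs0 := (hpos s hs).ne'
    have := ((((hasDerivAt_pow 2 s).const_mul d).neg).exp).div (hasDerivAt_id s) hs0
    refine this.congr_deriv ?_
    simp only [id, Pi.neg_apply]
    norm_num
    field_simp
    ring
  · refine ContinuousOn.neg (ContinuousOn.mul (ContinuousOn.add continuousOn_const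
      (ContinuousOn.div continuousOn_const (by fun_prop) fun s hs => ?_)) (by fun_prop))
    have := hpos s hs
    positivity
  · have := hpos s hs
    have : 0 ≤ (2 * d + 1 / s ^ 2) * Real.exp (-(d * s ^ 2)) := by positivity
    linarith
  · have := hpos B ⟨hB, le_rfl⟩
    positivity

/-- Two damped oscillations of different frequencies do not cancel in the mean square: the product of
the two waves oscillates, and contributes a bounded amount, whereas the square of the first has a mean
value of `1 / 2` and contributes a logarithm. -/
lemma integral_two_waves_ge {A₁ A₂ n₁ n₂ d₁ d₂ B : ℝ} (hA₁ : 0 ≤ A₁) (hA₂ : 0 ≤ A₂) (hn₂ : 0 < n₂)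
    (hn : n₂ < n₁) (hd₁ : 0 ≤ d₁) (hd₂ : 0 ≤ d₂) (hB : 1 ≤ B) :
    A₁ ^ 2 / 2 * (Real.exp (-(2 * d₁ * B ^ 2)) * Real.log B)
      - (A₁ ^ 2 / (2 * n₁) + A₂ ^ 2 / (2 * n₂) + 4 * (A₁ * A₂) / (n₁ - n₂))
    ≤ ∫ s in (1 : ℝ)..B, (A₁ * Real.sin (n₁ * s) * Real.exp (-(d₁ * s ^ 2))
      + A₂ * Real.sin (n₂ * s) * Real.exp (-(d₂ * s ^ 2))) ^ 2 / s := by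
  have hn₁ : 0 < n₁ := hn₂.trans hn
  have hpos : ∀ s ∈ uIcc 1 B, 0 < s := fun s hs => by
    rw [uIcc_of_le hB] at hs; exact lt_of_lt_of_le one_pos hs.1
  set G : ℝ → ℝ → ℝ := fun d s => Real.exp (-(d * s ^ 2)) / s with hG
  have hGi : ∀ d ω, IntervalIntegrable (fun s => G d s * Real.cos (ω * s)) volume 1 B := by
    intro d ω
    refine ContinuousOn.intervalIntegrable (ContinuousOn.mul (ContinuousOn.div (by fun_prop)
      (by fun_prop) fun s hs => (hpos s hs).ne') (by fun_prop))
  have hGi0 : ∀ d, IntervalIntegrable (G d) volume 1 B := by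
    intro d
    simpa using hGi d 0
  have e : ∀ s, (A₁ * Real.sin (n₁ * s) * Real.exp (-(d₁ * s ^ 2))
      + A₂ * Real.sin (n₂ * s) * Real.exp (-(d₂ * s ^ 2))) ^ 2 / s
      = (A₁ ^ 2 / 2 * G (2 * d₁) s + A₂ ^ 2 / 2 * G (2 * d₂) s)
        - (A₁ ^ 2 / 2 * (G (2 * d₁) s * Real.cos (2 * n₁ * s))
          + A₂ ^ 2 / 2 * (G (2 * d₂) s * Real.cos (2 * n₂ * s)))
        + (A₁ * A₂ * (G (d₁ + d₂) s * Real.cos ((n₁ - n₂) * s))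
          - A₁ * A₂ * (G (d₁ + d₂) s * Real.cos ((n₁ + n₂) * s))) := by
    intro s
    have x1 : Real.exp (-(2 * d₁ * s ^ 2)) = Real.exp (-(d₁ * s ^ 2)) ^ 2 := by
      rw [← Real.exp_nat_mul]; congr 1; push_cast; ring
    have x2 : Real.exp (-(2 * d₂ * s ^ 2)) = Real.exp (-(d₂ * s ^ 2)) ^ 2 := by
      rw [← Real.exp_nat_mul]; congr 1; push_cast; ring
    have x3 : Real.exp (-((d₁ + d₂) * s ^ 2))
        = Real.exp (-(d₁ * s ^ 2)) * Real.exp (-(d₂ * s ^ 2)) := by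
      rw [← Real.exp_add]; congr 1; ring
    have y1 : Real.cos (2 * n₁ * s) = 1 - 2 * Real.sin (n₁ * s) ^ 2 := by
      rw [mul_assoc, Real.cos_two_mul, Real.cos_sq']; ring
    have y2 : Real.cos (2 * n₂ * s) = 1 - 2 * Real.sin (n₂ * s) ^ 2 := by
      rw [mul_assoc, Real.cos_two_mul, Real.cos_sq']; ring
    have y3 : Real.cos ((n₁ - n₂) * s) = Real.cos (n₁ * s) * Real.cos (n₂ * s)
        + Real.sin (n₁ * s) * Real.sin (n₂ * s) := by rw [sub_mul, Real.cos_sub]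
    have y4 : Real.cos ((n₁ + n₂) * s) = Real.cos (n₁ * s) * Real.cos (n₂ * s)
        - Real.sin (n₁ * s) * Real.sin (n₂ * s) := by rw [add_mul, Real.cos_add]
    simp only [hG]
    rw [x1, x2, x3, y1, y2, y3, y4]
    ring
  simp_rw [e]
  have i1 := (hGi0 (2 * d₁)).const_mul (A₁ ^ 2 / 2)
  have i2 := (hGi0 (2 * d₂)).const_mul (A₂ ^ 2 / 2)
  have i3 := (hGi (2 * d₁) (2 * n₁)).const_mul (A₁ ^ 2 / 2)
  have i4 := (hGi (2 * d₂) (2 * n₂)).const_mul (A₂ ^ 2 / 2)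
  have i5 := (hGi (d₁ + d₂) (n₁ - n₂)).const_mul (A₁ * A₂)
  have i6 := (hGi (d₁ + d₂) (n₁ + n₂)).const_mul (A₁ * A₂)
  rw [intervalIntegral.integral_add ((i1.add i2).sub (i3.add i4)) (i5.sub i6),
    intervalIntegral.integral_sub (i1.add i2) (i3.add i4), intervalIntegral.integral_add i1 i2,
    intervalIntegral.integral_add i3 i4, intervalIntegral.integral_sub i5 i6]
  simp only [intervalIntegral.integral_const_mul]
  have b3 := (abs_le.1 (abs_integral_gauss_cos_le (d := 2 * d₁) (ω := 2 * n₁) (by positivity)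
    (by positivity) hB)).2
  have b4 := (abs_le.1 (abs_integral_gauss_cos_le (d := 2 * d₂) (ω := 2 * n₂) (by positivity)
    (by positivity) hB)).2
  have b5 := (abs_le.1 (abs_integral_gauss_cos_le (d := d₁ + d₂) (ω := n₁ - n₂) (by positivity)
    (by linarith) hB)).1
  have b6 := (abs_le.1 (abs_integral_gauss_cos_le (d := d₁ + d₂) (ω := n₁ + n₂) (by positivity)
    (by linarith) hB)).2
  have b6' : 2 / (n₁ + n₂) ≤ 2 / (n₁ - n₂) := by
    have : 0 < n₁ - n₂ := by linarith
    gcongr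
    linarith
  have hlog : ∫ s in (1 : ℝ)..B, Real.exp (-(2 * d₁ * B ^ 2)) * s⁻¹
      = Real.exp (-(2 * d₁ * B ^ 2)) * Real.log B := by
    rw [intervalIntegral.integral_const_mul, integral_inv_of_pos one_pos (by linarith), div_one]
  have b1 : Real.exp (-(2 * d₁ * B ^ 2)) * Real.log B ≤ ∫ s in (1 : ℝ)..B, G (2 * d₁) s := by
    rw [← hlog]
    refine intervalIntegral.integral_mono_on hB ?_ (hGi0 _) fun s hs => ?_
    · exact ContinuousOn.intervalIntegrable (continuousOn_const.mul
        (continuousOn_id.inv₀ fun s hs => (hpos s hs).ne'))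
    · have hs0 : 0 < s := lt_of_lt_of_le one_pos hs.1
      simp only [hG, div_eq_mul_inv]
      have : s ^ 2 ≤ B ^ 2 := pow_le_pow_left₀ hs0.le hs.2 2
      gcongr
  have b2 : 0 ≤ ∫ s in (1 : ℝ)..B, G (2 * d₂) s :=
    intervalIntegral.integral_nonneg hB fun s hs => by
      have hs0 : 0 < s := lt_of_lt_of_le one_pos hs.1
      simp only [hG]; positivity
  have c1 := mul_le_mul_of_nonneg_left b1 (by positivity : 0 ≤ A₁ ^ 2 / 2)
  have c2 := mul_nonneg (by positivity : 0 ≤ A₂ ^ 2 / 2) b2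
  have c3 := mul_le_mul_of_nonneg_left b3 (by positivity : 0 ≤ A₁ ^ 2 / 2)
  have c4 := mul_le_mul_of_nonneg_left b4 (by positivity : 0 ≤ A₂ ^ 2 / 2)
  have c5 := mul_le_mul_of_nonneg_left b5 (by positivity : 0 ≤ A₁ * A₂)
  have c6 := mul_le_mul_of_nonneg_left (b6.trans b6') (by positivity : 0 ≤ A₁ * A₂)
  have f3 : A₁ ^ 2 / 2 * (2 / (2 * n₁)) = A₁ ^ 2 / (2 * n₁) := by field_simp
  have f4 : A₂ ^ 2 / 2 * (2 / (2 * n₂)) = A₂ ^ 2 / (2 * n₂) := by field_simp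
  have f5 : 4 * (A₁ * A₂) / (n₁ - n₂) = A₁ * A₂ * (2 / (n₁ - n₂)) + A₁ * A₂ * (2 / (n₁ - n₂)) := by
    ring
  rw [f3] at c3
  rw [f4] at c4
  rw [f5]
  simp only [hG] at c1 c2 c3 c4 c5 c6 ⊢
  linarith

end Profile

/-! ### Lower bounds for the profile -/

section ProfileLower

variable {n : ℕ} {b κ γ δ : ℝ}

lemma integrableOn_profileSymbol_sq (hn : 1 ≤ n) (hb : 0 < b) (hκ : 0 < κ) (hγ : γ ≠ 0) (hδ : 0 < δ)
    {t : ℝ} (ht : 0 ≤ t) :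
    IntegrableOn (fun r => r ^ (n - 1) * profileSymbol b κ γ δ t r ^ 2) (Ioi 0) := by
  obtain ⟨K, hK, h⟩ := exists_radial hn
  exact (h fun r => profileSymbol b κ γ δ t r ^ 2).1.1
    (memLp_profileSymbol hn hb hκ hγ hδ ht).2.integrable_sq

/-- On the scale `r = α s` the profile consists of two damped waves with constant amplitudes. -/
lemma profileSymbol_scaled_ge (hn : 2 ≤ n) (hb : 0 < b) (hκ : 0 < κ) (hγ : γ ≠ 0) (hδ : 0 < δ)
    {t α B : ℝ} (ht : 0 < t) (hα : 0 < α) (hB : 1 ≤ B) :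
    α ^ (n - 2) * ∫ s in (1 : ℝ)..B,
      (2 * c₁ b κ γ δ / δ / ν₁ b κ γ * Real.sin (ν₁ b κ γ * α * t * s)
          * Real.exp (-(c₁ b κ γ δ * α ^ 2 * t * s ^ 2))
        + 2 * c₂ b κ γ δ / δ / ν₂ b κ γ * Real.sin (ν₂ b κ γ * α * t * s)
          * Real.exp (-(c₂ b κ γ δ * α ^ 2 * t * s ^ 2))) ^ 2 / s
    ≤ ∫ r in Ioi (0 : ℝ), r ^ (n - 1) * profileSymbol b κ γ δ t r ^ 2 := by
  have hi := integrableOn_profileSymbol_sq (n := n) (by omega) hb hκ hγ hδ ht.le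
  have v1 := ν₁_pos (γ := γ) hb hκ
  have v2 := ν₂_pos (γ := γ) hb hκ
  have hαB : α * 1 ≤ α * B := by gcongr
  have hsub : Ioc (α * 1) (α * B) ⊆ Ioi 0 := fun r hr => by
    have : α * 1 < r := hr.1
    have : 0 < α * 1 := by positivity
    exact (by linarith : (0 : ℝ) < r)
  have h1 : ∫ r in (α * 1)..(α * B), r ^ (n - 1) * profileSymbol b κ γ δ t r ^ 2
      ≤ ∫ r in Ioi (0 : ℝ), r ^ (n - 1) * profileSymbol b κ γ δ t r ^ 2 := by
    rw [intervalIntegral.integral_of_le hαB]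
    refine setIntegral_mono_set hi ?_ hsub.eventuallyLE
    refine (ae_restrict_mem measurableSet_Ioi).mono fun r hr => ?_
    have : (0 : ℝ) < r := hr
    simp only [Pi.zero_apply]; positivity
  refine le_trans ?_ h1
  have hi2 : IntervalIntegrable (fun r => r ^ (n - 1) * profileSymbol b κ γ δ t r ^ 2) volume
      (α * 1) (α * B) :=
    (intervalIntegrable_iff_integrableOn_Ioc_of_le hαB).2 (hi.mono_set hsub)
  have hi3 : IntervalIntegrable (fun s => (α * s) ^ (n - 1) * profileSymbol b κ γ δ t (α * s) ^ 2)
      volume 1 B := by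
    have := hi2.comp_mul_left (c := α)
    rwa [mul_div_cancel_left₀ _ hα.ne', mul_div_cancel_left₀ _ hα.ne'] at this
  have h2 := intervalIntegral.mul_integral_comp_mul_left (a := 1) (b := B) α
    (f := fun r => r ^ (n - 1) * profileSymbol b κ γ δ t r ^ 2)
  rw [← h2, ← intervalIntegral.integral_const_mul, ← intervalIntegral.integral_const_mul]
  refine intervalIntegral.integral_mono_on hB ?_ (hi3.const_mul α) fun s hs => ?_
  · refine ContinuousOn.intervalIntegrable (continuousOn_const.mul (ContinuousOn.div (by fun_prop)
      continuousOn_id fun s hs => ?_))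
    rw [uIcc_of_le hB] at hs
    exact (lt_of_lt_of_le one_pos hs.1).ne'
  · have hs0 : 0 < s := lt_of_lt_of_le one_pos hs.1
    have hsym : α * s * profileSymbol b κ γ δ t (α * s)
        = 2 * c₁ b κ γ δ / δ / ν₁ b κ γ * Real.sin (ν₁ b κ γ * α * t * s)
          * Real.exp (-(c₁ b κ γ δ * α ^ 2 * t * s ^ 2))
        + 2 * c₂ b κ γ δ / δ / ν₂ b κ γ * Real.sin (ν₂ b κ γ * α * t * s)
          * Real.exp (-(c₂ b κ γ δ * α ^ 2 * t * s ^ 2)) := by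
      rw [profileSymbol_eq hb hγ hδ]
      have e1 : ν₁ b κ γ * (α * s) * t = ν₁ b κ γ * α * t * s := by ring
      have e2 : ν₂ b κ γ * (α * s) * t = ν₂ b κ γ * α * t * s := by ring
      have e3 : -(c₁ b κ γ δ) * (α * s) ^ 2 * t = -(c₁ b κ γ δ * α ^ 2 * t * s ^ 2) := by ring
      have e4 : -(c₂ b κ γ δ) * (α * s) ^ 2 * t = -(c₂ b κ γ δ * α ^ 2 * t * s ^ 2) := by ring
      rw [e1, e2, e3, e4]
      field_simp
    rw [← hsym]
    obtain ⟨m, rfl⟩ : ∃ m, n = m + 2 := ⟨n - 2, by omega⟩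
    have e5 : α * ((α * s) ^ (m + 2 - 1) * profileSymbol b κ γ δ t (α * s) ^ 2)
        = s ^ m * (α ^ (m + 2 - 2)
          * ((α * s * profileSymbol b κ γ δ t (α * s)) ^ 2 / s)) := by
      simp only [Nat.add_sub_cancel, show m + 2 - 1 = m + 1 from rfl]
      rw [pow_succ, mul_pow α s m]
      field_simp
    rw [e5]
    exact le_mul_of_one_le_left (by positivity) (one_le_pow₀ hs.1)

/-- In dimension one the frequencies up to the order `1 / t`, where the symbol is of the size `t`, give
the growth. -/
lemma exists_profile_sq_ge_one (hb : 0 < b) (hκ : 0 < κ) (hγ : γ ≠ 0) (hδ : 0 < δ) :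
    ∃ c : ℝ, 0 < c ∧ ∀ᶠ t in atTop, c * (1 + t)
      ≤ ∫ r in Ioi (0 : ℝ), r ^ (1 - 1) * profileSymbol b κ γ δ t r ^ 2 := by
  have p1 := c₁_pos (κ := κ) hb hγ hδ
  have p2 := c₂_pos (κ := κ) hb hγ hδ
  have v1 := ν₁_pos (γ := γ) hb hκ
  have v2 := ν₂_pos (γ := γ) hb hκ
  have v12 := ν₂_lt_ν₁ hb hκ hγ
  set η := 1 / ν₁ b κ γ with hη
  have hη0 : 0 < η := by positivity
  set q := c₁ b κ γ δ + c₂ b κ γ δ with hq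
  have hsum : 2 * c₁ b κ γ δ / δ + 2 * c₂ b κ γ δ / δ = 1 := by
    rw [← add_div, ← mul_add, c₁_add_c₂]; field_simp
  set m := 2 / Real.pi * Real.exp (-(q * η ^ 2)) with hm
  have hm0 : 0 < m := by have := Real.pi_pos; positivity
  refine ⟨m ^ 2 * η / 2, by positivity, ?_⟩
  filter_upwards [eventually_ge_atTop 1] with t ht
  have ht0 : 0 < t := by linarith
  have hi := integrableOn_profileSymbol_sq (n := 1) le_rfl hb hκ hγ hδ ht0.le
  have hsub : Ioc 0 (η / t) ⊆ Ioi 0 := fun r hr => hr.1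
  -- before the first oscillation the symbol is comparable to `t`
  have hlow : ∀ r ∈ Ioc 0 (η / t), m * t ≤ profileSymbol b κ γ δ t r := by
    intro r hr
    have hr0 := hr.1
    have hrt : r * t ≤ η := (le_div_iff₀ ht0).1 hr.2
    have hr2 : r ^ 2 * t ≤ η ^ 2 := by
      calc r ^ 2 * t ≤ r ^ 2 * t * t := le_mul_of_one_le_right (by positivity) ht
        _ = (r * t) ^ 2 := by ring
        _ ≤ η ^ 2 := by gcongr
    have hs : ∀ ν, 0 < ν → ν ≤ ν₁ b κ γ → 2 / Real.pi * t ≤ Real.sin (ν * r * t) / (ν * r) := by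
      intro ν hν hle
      rw [le_div_iff₀ (by positivity)]
      have h1 : ν * r * t ≤ Real.pi / 2 := by
        have : ν * (r * t) ≤ ν₁ b κ γ * η := by gcongr
        rw [hη, mul_one_div_cancel v1.ne'] at this
        have := Real.pi_gt_three
        linarith
      have := Real.mul_le_sin (x := ν * r * t) (by positivity) h1
      calc _ = 2 / Real.pi * (ν * r * t) := by ring
        _ ≤ _ := this
    have he : ∀ c', 0 < c' → c' ≤ q → Real.exp (-(q * η ^ 2)) ≤ Real.exp (-c' * r ^ 2 * t) := by
      intro c' h0 hle
      refine Real.exp_le_exp.2 ?_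
      have : c' * (r ^ 2 * t) ≤ q * η ^ 2 := by gcongr
      linarith
    rw [profileSymbol_eq hb hγ hδ]
    have s1 := hs _ v1 le_rfl
    have s2 := hs _ v2 v12.le
    have e1 := he _ p1 (by rw [hq]; linarith)
    have e2 := he _ p2 (by rw [hq]; linarith)
    have hpi := Real.pi_pos
    calc m * t = 2 * c₁ b κ γ δ / δ * (2 / Real.pi * t) * Real.exp (-(q * η ^ 2))
          + 2 * c₂ b κ γ δ / δ * (2 / Real.pi * t) * Real.exp (-(q * η ^ 2)) := by
          rw [← add_mul, ← add_mul, hsum, hm]; ring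
      _ ≤ _ := by
          have h0 : 0 ≤ 2 / Real.pi * t := by positivity
          have := h0.trans s1
          have := h0.trans s2
          gcongr
  have h1 : ∫ r in Ioc 0 (η / t), r ^ (1 - 1) * profileSymbol b κ γ δ t r ^ 2
      ≤ ∫ r in Ioi (0 : ℝ), r ^ (1 - 1) * profileSymbol b κ γ δ t r ^ 2 := by
    refine setIntegral_mono_set hi ?_ hsub.eventuallyLE
    refine (ae_restrict_mem measurableSet_Ioi).mono fun r hr => ?_
    have : (0 : ℝ) < r := hr
    simp only [Pi.zero_apply]; positivity
  refine le_trans ?_ h1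
  have h2 : ∫ r in Ioc 0 (η / t), (m * t) ^ 2 = m ^ 2 * η * t := by
    rw [setIntegral_const, Measure.real, Real.volume_Ioc, sub_zero, ENNReal.toReal_ofReal (by positivity),
      smul_eq_mul]
    field_simp
  calc m ^ 2 * η / 2 * (1 + t) ≤ m ^ 2 * η / 2 * (t + t) := by gcongr
    _ = ∫ r in Ioc 0 (η / t), (m * t) ^ 2 := by rw [h2]; ring
    _ ≤ _ := by
        refine setIntegral_mono_on (integrableOn_const (by simp)) (hi.mono_set hsub)
          measurableSet_Ioc fun r hr => ?_
        simp only [Nat.sub_self, pow_zero, one_mul]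
        exact pow_le_pow_left₀ (by positivity) (hlow r hr) 2

/-- In dimension two the frequencies between `1 / t` and `1 / √t`, where the waves oscillate and are not
yet damped, give the logarithm. -/
lemma exists_profile_sq_ge_two (hb : 0 < b) (hκ : 0 < κ) (hγ : γ ≠ 0) (hδ : 0 < δ) :
    ∃ c : ℝ, 0 < c ∧ ∀ᶠ t in atTop, c * Real.log (Real.exp 1 + t)
      ≤ ∫ r in Ioi (0 : ℝ), r ^ (2 - 1) * profileSymbol b κ γ δ t r ^ 2 := by
  have p1 := c₁_pos (κ := κ) hb hγ hδ
  have p2 := c₂_pos (κ := κ) hb hγ hδ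
  have v1 := ν₁_pos (γ := γ) hb hκ
  have v2 := ν₂_pos (γ := γ) hb hκ
  have v12 := ν₂_lt_ν₁ hb hκ hγ
  set A₁ := 2 * c₁ b κ γ δ / δ / ν₁ b κ γ with hA₁
  set A₂ := 2 * c₂ b κ γ δ / δ / ν₂ b κ γ with hA₂
  have hA₁0 : 0 < A₁ := by positivity
  have hA₂0 : 0 < A₂ := by positivity
  set R := A₁ ^ 2 / (2 * ν₁ b κ γ) + A₂ ^ 2 / (2 * ν₂ b κ γ)
    + 4 * (A₁ * A₂) / (ν₁ b κ γ - ν₂ b κ γ) with hR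
  set D := A₁ ^ 2 / 2 * Real.exp (-(2 * c₁ b κ γ δ)) / 2 with hD
  have hD0 : 0 < D := by positivity
  refine ⟨D / 4, by positivity, ?_⟩
  filter_upwards [eventually_ge_atTop 3, Real.tendsto_log_atTop.eventually_ge_atTop (2 * R / D)]
    with t ht hlog
  have ht0 : 0 < t := by linarith
  have hB : 1 ≤ √t := Real.one_le_sqrt.2 (by linarith)
  have h1 := profileSymbol_scaled_ge (n := 2) le_rfl hb hκ hγ hδ ht0 (inv_pos.2 ht0) hB
  refine le_trans ?_ h1
  have e1 : ∀ ν : ℝ, ν * t⁻¹ * t = ν := fun ν => by field_simp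
  have e2 : ∀ c : ℝ, c * t⁻¹ ^ 2 * t = c * t⁻¹ := fun ν => by field_simp
  simp only [e1, e2, Nat.sub_self, pow_zero, one_mul]
  have h2 := integral_two_waves_ge hA₁0.le hA₂0.le v2 v12
    (by positivity : 0 ≤ c₁ b κ γ δ * t⁻¹) (by positivity : 0 ≤ c₂ b κ γ δ * t⁻¹) hB
  refine le_trans ?_ h2
  have e3 : 2 * (c₁ b κ γ δ * t⁻¹) * √t ^ 2 = 2 * c₁ b κ γ δ := by
    rw [Real.sq_sqrt ht0.le]; field_simp
  rw [e3, Real.log_sqrt ht0.le]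
  have h3 : Real.log (Real.exp 1 + t) ≤ 2 * Real.log t := by
    have he := Real.exp_one_lt_d9
    have : Real.exp 1 + t ≤ t ^ 2 := by nlinarith
    calc _ ≤ Real.log (t ^ 2) := Real.log_le_log (by positivity) this
      _ = _ := by rw [Real.log_pow]; norm_num
  have h4 : R ≤ D / 2 * Real.log t := by
    rw [div_le_iff₀ hD0] at hlog
    linarith
  have h5 : D / 4 * Real.log (Real.exp 1 + t) ≤ D / 4 * (2 * Real.log t) := by gcongr
  have h6 : A₁ ^ 2 / 2 * (Real.exp (-(2 * c₁ b κ γ δ)) * (Real.log t / 2)) = D * Real.log t := by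
    rw [hD]; ring
  rw [h6]
  linarith

/-- In higher dimensions the frequencies of the order `1 / √t` give the rate. -/
lemma exists_profile_sq_ge_three (hn : 3 ≤ n) (hb : 0 < b) (hκ : 0 < κ) (hγ : γ ≠ 0) (hδ : 0 < δ) :
    ∃ c : ℝ, 0 < c ∧ ∀ᶠ t in atTop, c * (1 + t) ^ (1 - (n : ℝ) / 2)
      ≤ ∫ r in Ioi (0 : ℝ), r ^ (n - 1) * profileSymbol b κ γ δ t r ^ 2 := by
  have p1 := c₁_pos (κ := κ) hb hγ hδ
  have p2 := c₂_pos (κ := κ) hb hγ hδ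
  have v1 := ν₁_pos (γ := γ) hb hκ
  have v2 := ν₂_pos (γ := γ) hb hκ
  have v12 := ν₂_lt_ν₁ hb hκ hγ
  set A₁ := 2 * c₁ b κ γ δ / δ / ν₁ b κ γ with hA₁
  set A₂ := 2 * c₂ b κ γ δ / δ / ν₂ b κ γ with hA₂
  have hA₁0 : 0 < A₁ := by positivity
  have hA₂0 : 0 < A₂ := by positivity
  set R := A₁ ^ 2 / (2 * ν₁ b κ γ) + A₂ ^ 2 / (2 * ν₂ b κ γ)
    + 4 * (A₁ * A₂) / (ν₁ b κ γ - ν₂ b κ γ) with hR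
  set D := A₁ ^ 2 / 2 * (Real.exp (-(2 * c₁ b κ γ δ * 2 ^ 2)) * Real.log 2) with hD
  have hD0 : 0 < D := by have := Real.log_pos one_lt_two; positivity
  refine ⟨D / 2, by positivity, ?_⟩
  have hsqrt : Tendsto (fun t : ℝ => √t) atTop atTop := Real.tendsto_sqrt_atTop
  filter_upwards [eventually_ge_atTop 1, hsqrt.eventually_ge_atTop (2 * R / D)] with t ht hlarge
  have ht0 : 0 < t := by linarith
  have hs0 : 0 < √t := Real.sqrt_pos.2 ht0
  have hst : √t ^ 2 = t := Real.sq_sqrt ht0.le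
  have h1 := profileSymbol_scaled_ge (n := n) (by omega) hb hκ hγ hδ ht0 (inv_pos.2 hs0)
    one_le_two
  refine le_trans ?_ h1
  have e1 : ∀ ν : ℝ, ν * (√t)⁻¹ * t = ν * √t := fun ν => by
    nth_rewrite 2 [← hst]; field_simp
  have e2 : ∀ c : ℝ, c * (√t)⁻¹ ^ 2 * t = c := fun ν => by rw [inv_pow, hst]; field_simp
  simp only [e1, e2]
  have h2 := integral_two_waves_ge hA₁0.le hA₂0.le (mul_pos v2 hs0)
    (mul_lt_mul_of_pos_right v12 hs0) p1.le p2.le one_le_two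
  have e3 : A₁ ^ 2 / (2 * (ν₁ b κ γ * √t)) + A₂ ^ 2 / (2 * (ν₂ b κ γ * √t))
      + 4 * (A₁ * A₂) / (ν₁ b κ γ * √t - ν₂ b κ γ * √t) = R / √t := by
    have : ν₁ b κ γ - ν₂ b κ γ ≠ 0 := by linarith
    rw [hR, ← sub_mul]; field_simp
  rw [e3, ← hD] at h2
  have h3 : R / √t ≤ D / 2 := by
    rw [div_le_iff₀ hD0] at hlarge
    rw [div_le_iff₀ hs0]
    linarith
  have h4 : (1 + t) ^ (1 - (n : ℝ) / 2) ≤ (√t)⁻¹ ^ (n - 2) := by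
    have e : (√t)⁻¹ ^ (n - 2) = t ^ (1 - (n : ℝ) / 2) := by
      rw [Real.sqrt_eq_rpow, ← Real.rpow_neg ht0.le, ← Real.rpow_natCast, ← Real.rpow_mul ht0.le,
        Nat.cast_sub (by omega)]
      congr 1; push_cast; ring
    rw [e]
    have : (3 : ℝ) ≤ n := by exact_mod_cast hn
    exact Real.rpow_le_rpow_of_nonpos ht0 (by linarith) (by linarith)
  calc D / 2 * (1 + t) ^ (1 - (n : ℝ) / 2) = (1 + t) ^ (1 - (n : ℝ) / 2) * (D / 2) := mul_comm _ _
    _ ≤ (√t)⁻¹ ^ (n - 2) * (D / 2) := by gcongr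
    _ ≤ _ := by
      refine mul_le_mul_of_nonneg_left (le_trans ?_ h2) (by positivity)
      linarith

/-- The profile attains the rate, in every dimension. -/
lemma exists_profile_ge (hn : 1 ≤ n) (hb : 0 < b) (hκ : 0 < κ) (hγ : γ ≠ 0) (hδ : 0 < δ) :
    ∃ c : ℝ, 0 < c ∧ ∀ᶠ t in atTop, c * rateE n t ≤
      (eLpNorm (fun w : Space n => profileSymbol b κ γ δ t ‖waveVec w‖) 2 volume).toReal := by
  have H : ∃ c : ℝ, 0 < c ∧ ∀ᶠ t in atTop, c * rateE n t ^ 2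
      ≤ ∫ r in Ioi (0 : ℝ), r ^ (n - 1) * profileSymbol b κ γ δ t r ^ 2 := by
    rcases eq_or_ne n 1 with h1 | h1
    · obtain ⟨c, hc, h⟩ := exists_profile_sq_ge_one (κ := κ) hb hκ hγ hδ
      refine ⟨c, hc, ?_⟩
      filter_upwards [h, eventually_ge_atTop 0] with t h ht
      rw [rateE_sq n ht, if_pos h1, h1]
      exact h
    rcases eq_or_ne n 2 with h2 | h2
    · obtain ⟨c, hc, h⟩ := exists_profile_sq_ge_two (κ := κ) hb hκ hγ hδ
      refine ⟨c, hc, ?_⟩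
      filter_upwards [h, eventually_ge_atTop 0] with t h ht
      rw [rateE_sq n ht, if_neg h1, if_pos h2, h2]
      exact h
    · obtain ⟨c, hc, h⟩ := exists_profile_sq_ge_three (n := n) (κ := κ) (by omega) hb hκ hγ hδ
      refine ⟨c, hc, ?_⟩
      filter_upwards [h, eventually_ge_atTop 0] with t h ht
      rw [rateE_sq n ht, if_neg h1, if_neg h2]
      exact h
  obtain ⟨c, hc, h⟩ := H
  obtain ⟨K, hK, hr⟩ := exists_radial hn
  refine ⟨√(K * c), by positivity, ?_⟩
  filter_upwards [h, eventually_ge_atTop 0] with t h ht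
  refine (pow_le_pow_iff_left₀ (mul_nonneg (Real.sqrt_nonneg _) (rateE_nonneg n ht))
    ENNReal.toReal_nonneg two_ne_zero).1 ?_
  rw [toReal_eLpNorm_two_sq (memLp_profileSymbol hn hb hκ hγ hδ ht).2, mul_pow,
    Real.sq_sqrt (by positivity)]
  simp only [Real.norm_eq_abs, sq_abs]
  rw [(hr fun r => profileSymbol b κ γ δ t r ^ 2).2, mul_assoc]
  gcongr

end ProfileLower

/-! ### The temperature against the profile -/

section Comparison

variable {n : ℕ} {b κ γ δ : ℝ}

/-- Bounds at one frequency: the low frequencies, where the temperature is the wave kernel up to a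
diffusive remainder, and the exponentially decaying frequencies away from zero. -/
lemma exists_pointwise_bounds (hb : 0 < b) (hκ : 0 < κ) (hγ : γ ≠ 0) (hδ : 0 < δ) :
    ∃ C c : ℝ, 0 < C ∧ 0 < c ∧ ∀ (n : ℕ) (k : Space n), k ≠ 0 → ∀ t, 0 ≤ t →
      ∀ (u₀ u₁ : EuclideanSpace ℂ (Fin n)) (θ₀ θ₁ : ℂ),
      (‖k‖ ≤ 1 →
        ‖thetaRest b κ γ δ k t u₀ u₁ θ₀‖ ≤ C * (‖u₀‖ + ‖u₁‖ + ‖θ₀‖) * gaussLow c t ‖k‖ ∧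
        ‖heatKernel b κ γ δ k t‖ ≤ C * waveLow c t ‖k‖ ∧
        ‖heatKernel b κ γ δ k t - profileSymbol b κ γ δ t ‖k‖‖ ≤ C * gaussLow c t ‖k‖ ∧
        |profileSymbol b κ γ δ t ‖k‖| ≤ C * waveLow c t ‖k‖) ∧
      ∀ η, 0 < η → η ≤ 1 → η ≤ ‖k‖ →
        ‖(sol b κ γ δ k t u₀ u₁ θ₀ θ₁).2.2.1‖ ≤ C / η * Real.exp (-(c * η ^ 2 * t))
          * (‖k‖ * ‖u₀‖ + ‖u₁‖ + ‖θ₀‖ + ‖θ₁‖) ∧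
        |profileSymbol b κ γ δ t ‖k‖| ≤ C / η * Real.exp (-(c * ‖k‖ ^ 2 * t)) := by
  obtain ⟨C₁, q₁, hC₁, hq₁, h1⟩ := exists_thetaRest_le hb hκ hγ hδ
  obtain ⟨C₂, q₂, hC₂, hq₂, h2⟩ := exists_heatKernel_bounds hb hκ hγ hδ
  obtain ⟨C₃, q₃, hC₃, hq₃, h3⟩ := exists_profileSymbol_le (κ := κ) (γ := γ) hb hκ hγ hδ
  set C := C₁ + C₂ + C₃ + 1 with hC
  set c := min q₁ (min q₂ q₃) / 2 with hc
  have hc0 : 0 < c := by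
    have : 0 < min q₁ (min q₂ q₃) := lt_min hq₁ (lt_min hq₂ hq₃)
    positivity
  have c1 : 2 * c ≤ q₁ := by rw [hc]; linarith [min_le_left q₁ (min q₂ q₃)]
  have c2 : 2 * c ≤ q₂ := by
    rw [hc]; linarith [(min_le_right q₁ (min q₂ q₃)).trans (min_le_left q₂ q₃)]
  have c3 : 2 * c ≤ q₃ := by
    rw [hc]; linarith [(min_le_right q₁ (min q₂ q₃)).trans (min_le_right q₂ q₃)]
  have k1 : C₁ ≤ C := by rw [hC]; linarith
  have k2 : C₂ ≤ C := by rw [hC]; linarith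
  have k3 : C₃ ≤ C := by rw [hC]; linarith
  have k4 : 1 ≤ C := by rw [hC]; linarith
  refine ⟨C, c, by positivity, hc0, fun n k hk t ht u₀ u₁ θ₀ θ₁ => ⟨fun hk1 => ?_, ?_⟩⟩
  · have hk0 : 0 < ‖k‖ := norm_pos_iff.2 hk
    have hk2 : ‖k‖ ^ 2 ≤ 1 := pow_le_one₀ hk0.le hk1
    have hρ : ‖k‖ ^ 2 / 2 ≤ ‖k‖ ^ 2 / (1 + ‖k‖ ^ 2) := by gcongr; linarith
    have hexp : ∀ q, 2 * c ≤ q → Real.exp (-(q * (‖k‖ ^ 2 / (1 + ‖k‖ ^ 2)) * t))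
        ≤ Real.exp (-(c * ‖k‖ ^ 2 * t)) := by
      intro q hq
      refine Real.exp_le_exp.2 (neg_le_neg ?_)
      calc c * ‖k‖ ^ 2 * t = 2 * c * (‖k‖ ^ 2 / 2) * t := by ring
        _ ≤ q * (‖k‖ ^ 2 / (1 + ‖k‖ ^ 2)) * t := by
          have : 0 ≤ q := by linarith
          gcongr
    have hexp' : ∀ q, 2 * c ≤ q → Real.exp (-(q * ‖k‖ ^ 2 * t)) ≤ Real.exp (-(c * ‖k‖ ^ 2 * t)) := by
      intro q hq
      refine Real.exp_le_exp.2 (neg_le_neg ?_)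
      gcongr
      linarith
    obtain ⟨a1, a2, a3⟩ := h2 n k hk t ht
    obtain ⟨s1, s2⟩ := h3 t ‖k‖ ht hk0.le
    simp only [gaussLow, waveLow, if_pos hk1]
    refine ⟨?_, ?_, ?_, ?_⟩
    · refine (h1 n k hk t ht u₀ u₁ θ₀).trans ?_
      calc _ ≤ C * Real.exp (-(c * ‖k‖ ^ 2 * t)) * (1 * ‖u₀‖ + ‖u₁‖ + ‖θ₀‖) := by
            have := hexp q₁ c1
            gcongr
        _ = _ := by ring
    · rw [mul_min_of_nonneg _ _ (by positivity)]
      refine le_min ((a2 hk1).trans (by gcongr)) (a1.trans ?_)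
      rw [mul_div_assoc]
      have := hexp q₂ c2
      gcongr
    · refine (a3 hk1).trans ?_
      have := hexp' q₂ c2
      gcongr
    · rw [mul_min_of_nonneg _ _ (by positivity)]
      refine le_min (s2.trans ?_) (s1.trans ?_)
      · have : Real.exp (-(q₃ * ‖k‖ ^ 2 * t)) ≤ 1 := Real.exp_le_one_iff.2 (by
          have : 0 ≤ q₃ * ‖k‖ ^ 2 * t := by positivity
          linarith)
        calc t * Real.exp (-(q₃ * ‖k‖ ^ 2 * t)) ≤ t * 1 := by gcongr
          _ = 1 * t := by ring
          _ ≤ C * t := by gcongr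
      · have := hexp' q₃ c3
        gcongr
  · intro η hη hη1 hηk
    have hk0 : 0 < ‖k‖ := norm_pos_iff.2 hk
    have hη2 : η ^ 2 ≤ ‖k‖ ^ 2 := by gcongr
    have hη3 : η ^ 2 ≤ 1 := pow_le_one₀ hη.le hη1
    have hρ : η ^ 2 / 2 ≤ ‖k‖ ^ 2 / (1 + ‖k‖ ^ 2) := by
      rw [div_le_div_iff₀ two_pos (by positivity)]
      nlinarith [sq_nonneg ‖k‖]
    have hexp : ∀ q, 2 * c ≤ q → Real.exp (-(q * (‖k‖ ^ 2 / (1 + ‖k‖ ^ 2)) * t))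
        ≤ Real.exp (-(c * η ^ 2 * t)) := by
      intro q hq
      refine Real.exp_le_exp.2 (neg_le_neg ?_)
      calc c * η ^ 2 * t = 2 * c * (η ^ 2 / 2) * t := by ring
        _ ≤ q * (‖k‖ ^ 2 / (1 + ‖k‖ ^ 2)) * t := by
          have : 0 ≤ q := by linarith
          gcongr
    have hη' : 1 ≤ 1 / η := by rw [le_div_iff₀ hη]; linarith
    obtain ⟨s1, s2⟩ := h3 t ‖k‖ ht hk0.le
    constructor
    · rw [theta_sol_eq]
      refine (norm_add_le _ _).trans ?_
      rw [norm_mul]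
      have a1 := (h2 n k hk t ht).1
      calc _ ≤ C₁ * Real.exp (-(q₁ * (‖k‖ ^ 2 / (1 + ‖k‖ ^ 2)) * t)) * (‖k‖ * ‖u₀‖ + ‖u₁‖ + ‖θ₀‖)
            + ‖θ₁‖ * (C₂ * Real.exp (-(q₂ * (‖k‖ ^ 2 / (1 + ‖k‖ ^ 2)) * t)) / ‖k‖) := by
            gcongr
            exact h1 n k hk t ht u₀ u₁ θ₀
        _ ≤ C * Real.exp (-(c * η ^ 2 * t)) * (‖k‖ * ‖u₀‖ + ‖u₁‖ + ‖θ₀‖)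
            + ‖θ₁‖ * (C * Real.exp (-(c * η ^ 2 * t)) / η) := by
            have e1 := hexp q₁ c1
            have e2 := hexp q₂ c2
            gcongr
        _ = C * Real.exp (-(c * η ^ 2 * t)) * (1 * (‖k‖ * ‖u₀‖ + ‖u₁‖ + ‖θ₀‖) + 1 / η * ‖θ₁‖) := by
            ring
        _ ≤ C * Real.exp (-(c * η ^ 2 * t)) * (1 / η * (‖k‖ * ‖u₀‖ + ‖u₁‖ + ‖θ₀‖)
            + 1 / η * ‖θ₁‖) := by gcongr
        _ = _ := by ring
    · calc _ ≤ _ := s1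
        _ ≤ C * (Real.exp (-(c * ‖k‖ ^ 2 * t)) / η) := by
            gcongr
            linarith
        _ = _ := by ring

/-- The triangle inequality in `L²` for a dominated function. -/
lemma toReal_eLpNorm_le_three {α F : Type*} [MeasurableSpace α] {μ : Measure α}
    [NormedAddCommGroup F] {f : α → F} {g₁ g₂ g₃ : α → ℝ} {a₁ a₂ a₃ : ℝ} (h₁ : MemLp g₁ 2 μ)
    (h₂ : MemLp g₂ 2 μ) (h₃ : MemLp g₃ 2 μ) (ha₁ : 0 ≤ a₁) (ha₂ : 0 ≤ a₂) (ha₃ : 0 ≤ a₃)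
    (h : ∀ᵐ x ∂μ, ‖f x‖ ≤ a₁ * g₁ x + a₂ * g₂ x + a₃ * g₃ x) :
    (eLpNorm f 2 μ).toReal ≤ a₁ * (eLpNorm g₁ 2 μ).toReal + a₂ * (eLpNorm g₂ 2 μ).toReal
      + a₃ * (eLpNorm g₃ 2 μ).toReal := by
  have m₁ := h₁.const_smul a₁
  have m₂ := h₂.const_smul a₂
  have m₃ := h₃.const_smul a₃
  have e : ∀ {a : ℝ} (g : α → ℝ), 0 ≤ a →
      (eLpNorm (a • g) 2 μ).toReal = a * (eLpNorm g 2 μ).toReal := by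
    intro a g ha
    rw [eLpNorm_const_smul, ENNReal.toReal_mul, toReal_enorm, Real.norm_of_nonneg ha]
  have h1 : eLpNorm f 2 μ ≤ eLpNorm (a₁ • g₁ + a₂ • g₂ + a₃ • g₃) 2 μ := by
    refine eLpNorm_mono_ae (h.mono fun x hx => hx.trans ?_)
    exact le_abs_self _
  have h2 : eLpNorm f 2 μ ≤ eLpNorm (a₁ • g₁) 2 μ + eLpNorm (a₂ • g₂) 2 μ
      + eLpNorm (a₃ • g₃) 2 μ :=
    h1.trans ((eLpNorm_add_le (m₁.add m₂).1 m₃.1 (by norm_num)).trans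
      (add_le_add_left (eLpNorm_add_le m₁.1 m₂.1 (by norm_num)) _))
  have h12 : eLpNorm (a₁ • g₁) 2 μ + eLpNorm (a₂ • g₂) 2 μ ≠ ⊤ :=
    ENNReal.add_ne_top.2 ⟨m₁.2.ne, m₂.2.ne⟩
  refine (ENNReal.toReal_mono (ENNReal.add_ne_top.2 ⟨h12, m₃.2.ne⟩) h2).trans ?_
  rw [ENNReal.toReal_add h12 m₃.2.ne, ENNReal.toReal_add m₁.2.ne m₂.2.ne, e _ ha₁, e _ ha₂, e _ ha₃]

lemma ae_waveVec_ne_zero (hn : 1 ≤ n) : ∀ᵐ w : Space n, waveVec w ≠ 0 := by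
  have : Nonempty (Fin n) := ⟨⟨0, hn⟩⟩
  have h : ∀ᵐ w : Space n, w ≠ 0 := compl_mem_ae_iff.2 (measure_singleton 0)
  filter_upwards [h] with w hw
  rw [waveVec, smul_ne_zero_iff]
  exact ⟨by positivity, hw⟩

/-- The size of the data that governs the frequencies away from zero. -/
noncomputable def highSize (u₀ u₁ : Space n → Space n) (θ₀ θ₁ : Space n → ℝ) (w : Space n) : ℝ :=
  ‖waveVec w‖ * ‖fourierVec u₀ w‖ + ‖fourierVec u₁ w‖ + ‖fourierReal θ₀ w‖ + ‖fourierReal θ₁ w‖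

variable {u₀ u₁ : Space n → Space n} {Du₀ : Fin n → Space n → Space n} {θ₀ θ₁ : Space n → ℝ}

lemma normL2L1_nonneg {F : Type*} [NormedAddCommGroup F] (f : Space n → F) : 0 ≤ normL2L1 f :=
  add_nonneg ENNReal.toReal_nonneg ENNReal.toReal_nonneg

lemma normH1L1_nonneg (f : Space n → Space n) (D : Fin n → Space n → Space n) :
    0 ≤ normH1L1 f D := add_nonneg (Real.sqrt_nonneg _) ENNReal.toReal_nonneg

lemma eLpNorm_one_le_normL2L1 {F : Type*} [NormedAddCommGroup F] (f : Space n → F) :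
    (eLpNorm f 1 volume).toReal ≤ normL2L1 f := le_add_of_nonneg_left ENNReal.toReal_nonneg

lemma eLpNorm_two_le_normL2L1 {F : Type*} [NormedAddCommGroup F] (f : Space n → F) :
    (eLpNorm f 2 volume).toReal ≤ normL2L1 f := le_add_of_nonneg_right ENNReal.toReal_nonneg

lemma eLpNorm_one_le_normH1L1 (f : Space n → Space n) (D : Fin n → Space n → Space n) :
    (eLpNorm f 1 volume).toReal ≤ normH1L1 f D := le_add_of_nonneg_left (Real.sqrt_nonneg _)

/-- The norm of the data. -/
noncomputable def dataNorm (u₀ u₁ : Space n → Space n) (Du₀ : Fin n → Space n → Space n)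
    (θ₀ θ₁ : Space n → ℝ) : ℝ :=
  normH1L1 u₀ Du₀ + normL2L1 u₁ + normL2L1 θ₀ + normL2L1 θ₁

lemma dataNorm_nonneg : 0 ≤ dataNorm u₀ u₁ Du₀ θ₀ θ₁ :=
  add_nonneg (add_nonneg (add_nonneg (normH1L1_nonneg _ _) (normL2L1_nonneg _))
    (normL2L1_nonneg _)) (normL2L1_nonneg _)

section

variable (hu₀ : MemL2L1 u₀) (hDu : HasWeakPartials u₀ Du₀) (hDu₀ : ∀ j, MemLp (Du₀ j) 2 volume)
  (hu₁ : MemL2L1 u₁) (hθ₀ : MemL2L1 θ₀) (hθ₁ : MemL2L1 θ₁)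

include hu₀ hDu hDu₀ hu₁ hθ₀ hθ₁

lemma highSize_bounds : MemLp (highSize u₀ u₁ θ₀ θ₁) 2 volume ∧
    (eLpNorm (highSize u₀ u₁ θ₀ θ₁) 2 volume).toReal
      ≤ (n * n + n + 2) * dataNorm u₀ u₁ Du₀ θ₀ θ₁ := by
  have w := weighted_fourierVec_bounds hu₀ hDu hDu₀
  have a1 := (fourierVec_bounds hu₁).1
  have a2 := (fourierReal_bounds hθ₀).1
  have a3 := (fourierReal_bounds hθ₁).1
  have m12 := w.1.add a1.1.norm
  have m3 := a2.1.norm.add a3.1.norm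
  have hm : MemLp (highSize u₀ u₁ θ₀ θ₁) 2 volume := by
    refine (m12.add m3).ae_eq (Eventually.of_forall fun x => ?_)
    simp only [Pi.add_apply, highSize]
    ring
  refine ⟨hm, ?_⟩
  have h1 := toReal_eLpNorm_le_three (f := highSize u₀ u₁ θ₀ θ₁) w.1 a1.1.norm m3 zero_le_one
    zero_le_one zero_le_one (Eventually.of_forall fun x => le_of_eq (by
      rw [Real.norm_of_nonneg (by unfold highSize; positivity)]
      simp only [Pi.add_apply, highSize]
      ring))
  have h2 := toReal_eLpNorm_le_three (f := (fun x => ‖fourierReal θ₀ x‖) + fun x => ‖fourierReal θ₁ x‖)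
    a2.1.norm a3.1.norm (MemLp.zero (ε := ℝ)) zero_le_one zero_le_one (le_refl (0 : ℝ))
    (Eventually.of_forall fun x => le_of_eq (by
      rw [Real.norm_of_nonneg (by simp only [Pi.add_apply]; positivity)]
      simp))
  rw [one_mul, one_mul, one_mul, eLpNorm_norm] at h1
  rw [one_mul, one_mul, zero_mul, add_zero, eLpNorm_norm, eLpNorm_norm, a2.2, a3.2] at h2
  have b1 := eLpNorm_two_le_normL2L1 u₁
  have b2 := eLpNorm_two_le_normL2L1 θ₀
  have b3 := eLpNorm_two_le_normL2L1 θ₁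
  have n0 := normH1L1_nonneg u₀ Du₀
  have n1 := normL2L1_nonneg u₁
  have n2 := normL2L1_nonneg θ₀
  have n3 := normL2L1_nonneg θ₁
  have hn0 : (0 : ℝ) ≤ n := Nat.cast_nonneg n
  have d1 : normH1L1 u₀ Du₀ ≤ dataNorm u₀ u₁ Du₀ θ₀ θ₁ := by unfold dataNorm; linarith
  have d2 : normL2L1 u₁ ≤ dataNorm u₀ u₁ Du₀ θ₀ θ₁ := by unfold dataNorm; linarith
  have d3 : normL2L1 θ₀ ≤ dataNorm u₀ u₁ Du₀ θ₀ θ₁ := by unfold dataNorm; linarith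
  have d4 : normL2L1 θ₁ ≤ dataNorm u₀ u₁ Du₀ θ₀ θ₁ := by unfold dataNorm; linarith
  have f1 : (n * n : ℝ) * normH1L1 u₀ Du₀ ≤ n * n * dataNorm u₀ u₁ Du₀ θ₀ θ₁ := by gcongr
  have f2 : (n : ℝ) * (eLpNorm u₁ 2 volume).toReal ≤ n * dataNorm u₀ u₁ Du₀ θ₀ θ₁ := by
    gcongr; exact b1.trans d2
  have g1 := w.2
  have g2 := a1.2
  calc _ ≤ _ := h1
    _ ≤ n * n * dataNorm u₀ u₁ Du₀ θ₀ θ₁ + n * dataNorm u₀ u₁ Du₀ θ₀ θ₁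
        + (dataNorm u₀ u₁ Du₀ θ₀ θ₁ + dataNorm u₀ u₁ Du₀ θ₀ θ₁) := by
        refine add_le_add (add_le_add (g1.trans f1) (g2.trans f2)) (h2.trans ?_)
        exact add_le_add (b2.trans d3) (b3.trans d4)
    _ = _ := by ring

omit hDu hDu₀ hθ₁ in
lemma fourier_sup_le (w : Space n) :
    ‖fourierVec u₀ w‖ + ‖fourierVec u₁ w‖ + ‖fourierReal θ₀ w‖
      ≤ (n + 1) * dataNorm u₀ u₁ Du₀ θ₀ θ₁ := by
  have a0 := (fourierVec_bounds hu₀).2 w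
  have a1 := (fourierVec_bounds hu₁).2 w
  have a2 := (fourierReal_bounds hθ₀).2 w
  have b0 := eLpNorm_one_le_normH1L1 u₀ Du₀
  have b1 := eLpNorm_one_le_normL2L1 u₁
  have b2 := eLpNorm_one_le_normL2L1 θ₀
  have n0 := normH1L1_nonneg u₀ Du₀
  have n1 := normL2L1_nonneg u₁
  have n2 := normL2L1_nonneg θ₀
  have n3 := normL2L1_nonneg θ₁
  have hn0 : (0 : ℝ) ≤ n := Nat.cast_nonneg n
  have f1 : (n : ℝ) * (eLpNorm u₀ 1 volume).toReal + n * (eLpNorm u₁ 1 volume).toReal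
      ≤ n * dataNorm u₀ u₁ Du₀ θ₀ θ₁ := by
    rw [← mul_add]
    gcongr
    unfold dataNorm; linarith
  have f2 : (eLpNorm θ₀ 1 volume).toReal ≤ dataNorm u₀ u₁ Du₀ θ₀ θ₁ := by
    unfold dataNorm; linarith
  linarith

omit hu₀ hDu hDu₀ hu₁ hθ₀ in
lemma fourier_sup_le' (w : Space n) :
    ‖fourierReal θ₁ w‖ ≤ dataNorm u₀ u₁ Du₀ θ₀ θ₁ := by
  have a := (fourierReal_bounds hθ₁).2 w
  have b1 := eLpNorm_one_le_normL2L1 θ₁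
  have n0 := normH1L1_nonneg u₀ Du₀
  have n1 := normL2L1_nonneg u₁
  have n2 := normL2L1_nonneg θ₀
  unfold dataNorm; linarith

end

lemma gaussLow_nonneg (c t r : ℝ) : 0 ≤ gaussLow c t r := by
  unfold gaussLow; split_ifs <;> positivity

lemma waveLow_nonneg {c t r : ℝ} (ht : 0 ≤ t) (hr : 0 ≤ r) : 0 ≤ waveLow c t r := by
  unfold waveLow; split_ifs
  · exact le_min ht (by positivity)
  · exact le_rfl

/-- The upper bound on the Fourier side. -/
lemma exists_thetaHat_le (hn : 1 ≤ n) (hb : 0 < b) (hκ : 0 < κ) (hγ : γ ≠ 0) (hδ : 0 < δ) :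
    ∃ C : ℝ, 0 < C ∧ ∀ (u₀ u₁ : Space n → Space n) (Du₀ : Fin n → Space n → Space n)
      (θ₀ θ₁ : Space n → ℝ), MemL2L1 u₀ → HasWeakPartials u₀ Du₀ →
      (∀ j, MemLp (Du₀ j) 2 volume) → MemL2L1 u₁ → MemL2L1 θ₀ → MemL2L1 θ₁ → ∀ t, 0 ≤ t →
      (eLpNorm (thetaHat b κ γ δ u₀ u₁ θ₀ θ₁ t) 2 volume).toReal
        ≤ C * rateE n t * dataNorm u₀ u₁ Du₀ θ₀ θ₁ := by
  obtain ⟨C, c, hC, hc, h⟩ := exists_pointwise_bounds hb hκ hγ hδ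
  obtain ⟨Cg, hCg, hg⟩ := exists_gaussLow_le (n := n) hn hc
  obtain ⟨Cw, hCw, hw⟩ := exists_waveLow_le (n := n) hn hc
  obtain ⟨Ce, hCe, he⟩ := exists_exp_le_rpow n hc
  refine ⟨C * (n + 1) * Cg + C * Cw + C * Ce * (n * n + n + 2), by positivity, ?_⟩
  intro u₀ u₁ Du₀ θ₀ θ₁ hu₀ hDu hDu₀ hu₁ hθ₀ hθ₁ t ht
  set N := dataNorm u₀ u₁ Du₀ θ₀ θ₁ with hN
  have hN0 : 0 ≤ N := dataNorm_nonneg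
  obtain ⟨hh1, hh2⟩ := highSize_bounds hu₀ hDu hDu₀ hu₁ hθ₀ hθ₁
  have hE := rateE_nonneg n ht
  have hrE : (1 + t) ^ (-(n : ℝ) / 4) ≤ rateE n t := by
    refine (rpow_le_rateE hn ht).trans ?_
    refine mul_le_of_le_one_left hE ?_
    exact Real.rpow_le_one_of_one_le_of_nonpos (by linarith) (by norm_num)
  have key := toReal_eLpNorm_le_three (f := thetaHat b κ γ δ u₀ u₁ θ₀ θ₁ t)
    (a₁ := C * ((n + 1) * N)) (a₂ := C * N) (a₃ := C * Real.exp (-(c * t)))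
    (hg t ht).1 (hw t ht).1 hh1 (by positivity) (by positivity) (by positivity) ?_
  · refine key.trans ?_
    calc _ ≤ C * ((n + 1) * N) * (Cg * rateE n t) + C * N * (Cw * rateE n t)
          + C * (Ce * rateE n t) * ((n * n + n + 2) * N) := by
          gcongr
          · exact (hg t ht).2.trans (by gcongr)
          · exact (hw t ht).2
          · exact (he t ht).trans (by gcongr)
      _ = _ := by ring
  · filter_upwards [ae_waveVec_ne_zero hn] with w hw0
    obtain ⟨hlow, hhigh⟩ := h n (waveVec w) hw0 t ht (fourierVec u₀ w) (fourierVec u₁ w)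
      (fourierReal θ₀ w) (fourierReal θ₁ w)
    have hs0 : 0 ≤ highSize u₀ u₁ θ₀ θ₁ w := by unfold highSize; positivity
    have hg0 := gaussLow_nonneg c t ‖waveVec w‖
    have hw0' := waveLow_nonneg (c := c) ht (norm_nonneg (waveVec w))
    rcases le_total ‖waveVec w‖ 1 with h1 | h1
    · obtain ⟨l1, l2, -, -⟩ := hlow h1
      have e : thetaHat b κ γ δ u₀ u₁ θ₀ θ₁ t w = _ := theta_sol_eq _ _ _ _ _ _
      rw [e]
      refine (norm_add_le _ _).trans ?_
      rw [norm_mul]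
      have s1 := fourier_sup_le (Du₀ := Du₀) (θ₁ := θ₁) hu₀ hu₁ hθ₀ w
      have s2 := fourier_sup_le' (u₀ := u₀) (u₁ := u₁) (Du₀ := Du₀) (θ₀ := θ₀) hθ₁ w
      have r1 := l1.trans (by gcongr : _ ≤ C * ((n + 1) * N) * gaussLow c t ‖waveVec w‖)
      have r2 : ‖fourierReal θ₁ w‖ * ‖heatKernel b κ γ δ (waveVec w) t‖
          ≤ N * (C * waveLow c t ‖waveVec w‖) := by gcongr
      have r3 : 0 ≤ C * Real.exp (-(c * t)) * highSize u₀ u₁ θ₀ θ₁ w := by positivity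
      linarith
    · have r1 := (hhigh 1 one_pos le_rfl h1).1
      rw [div_one, one_pow, mul_one] at r1
      refine r1.trans ?_
      have q1 : 0 ≤ C * ((n + 1) * N) * gaussLow c t ‖waveVec w‖ := by positivity
      have q2 : 0 ≤ C * N * waveLow c t ‖waveVec w‖ := by positivity
      have e : ‖waveVec w‖ * ‖fourierVec u₀ w‖ + ‖fourierVec u₁ w‖ + ‖fourierReal θ₀ w‖
          + ‖fourierReal θ₁ w‖ = highSize u₀ u₁ θ₀ θ₁ w := rfl
      rw [e]
      linarith

lemma fourierReal_zero (f : Space n → ℝ) : fourierReal f 0 = ((∫ x, f x : ℝ) : ℂ) := by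
  rw [fourierReal, Real.fourier_eq, ← integral_complex_ofReal]
  simp

/-- The difference to the profile on the Fourier side. The means of the data enter through the
continuity of the Fourier transform at the frequency zero. -/
lemma thetaHat_sub_isLittleO (hn : 1 ≤ n) (hb : 0 < b) (hκ : 0 < κ) (hγ : γ ≠ 0) (hδ : 0 < δ)
    (hu₀ : MemL2L1 u₀) (hDu : HasWeakPartials u₀ Du₀) (hDu₀ : ∀ j, MemLp (Du₀ j) 2 volume)
    (hu₁ : MemL2L1 u₁) (hθ₀ : MemL2L1 θ₀) (hθ₁ : MemL2L1 θ₁) :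
    (fun t : ℝ => (eLpNorm (fun w => thetaHat b κ γ δ u₀ u₁ θ₀ θ₁ t w
      - ((∫ x, θ₁ x : ℝ) : ℂ) * (profileSymbol b κ γ δ t ‖waveVec w‖ : ℂ)) 2 volume).toReal)
      =o[atTop] fun t => rateE n t := by
  obtain ⟨C, c, hC, hc, h⟩ := exists_pointwise_bounds hb hκ hγ hδ
  obtain ⟨Cg, hCg, hg⟩ := exists_gaussLow_le (n := n) hn hc
  obtain ⟨Cw, hCw, hw⟩ := exists_waveLow_le (n := n) hn hc
  set N := dataNorm u₀ u₁ Du₀ θ₀ θ₁ with hN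
  have hN0 : 0 ≤ N := dataNorm_nonneg
  set P : ℝ := ∫ x, θ₁ x with hP
  obtain ⟨hh1, -⟩ := highSize_bounds hu₀ hDu hDu₀ hu₁ hθ₀ hθ₁
  rw [isLittleO_iff]
  intro ε hε
  -- the mean of `θ₁` approximates its transform for frequencies below `η`
  set ε' := ε / (2 * (C * Cw)) with hε'
  have hε'0 : 0 < ε' := by positivity
  obtain ⟨η, hη, hη1, hηc⟩ : ∃ η : ℝ, 0 < η ∧ η ≤ 1 ∧ ∀ w : Space n, ‖waveVec w‖ < η →
      ‖fourierReal θ₁ w - P‖ ≤ ε' := by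
    have hcont := (continuous_fourierReal hθ₁).continuousAt (x := 0)
    rw [Metric.continuousAt_iff] at hcont
    obtain ⟨d, hd, hd'⟩ := hcont ε' hε'0
    refine ⟨min d 1, lt_min hd one_pos, min_le_right _ _, fun w hw => ?_⟩
    have h1 : ‖w‖ ≤ ‖waveVec w‖ := by
      rw [norm_waveVec]
      exact le_mul_of_one_le_left (norm_nonneg _) (by linarith [Real.pi_gt_three])
    have := hd' (x := w) (by
      rw [dist_zero_right]; exact h1.trans_lt (hw.trans_le (min_le_left _ _)))
    rw [fourierReal_zero, dist_eq_norm] at this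
    exact this.le
  obtain ⟨Ce, hCe, he⟩ := exists_exp_le_rpow n (by positivity : 0 < c * η ^ 2)
  set H : Space n → ℝ := fun w => highSize u₀ u₁ θ₀ θ₁ w
    + |P| * Real.exp (c * η ^ 2) * Real.exp (-(c * ‖waveVec w‖ ^ 2)) with hH
  have hHm : MemLp H 2 volume := hh1.add ((memLp_gauss hn hc).2.const_mul _)
  have hH0 : ∀ w, 0 ≤ H w := fun w => by
    have : 0 ≤ highSize u₀ u₁ θ₀ θ₁ w := by unfold highSize; positivity
    simp only [hH]; positivity
  set LH := (eLpNorm H 2 volume).toReal with hLH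
  have hsmall := rpow_isLittleO_rateE hn
  rw [isLittleO_iff] at hsmall
  set M := C * ((n + 1) * N + N) * Cg + C / η * Ce * LH with hM
  have hM0 : 0 ≤ M := by
    have : 0 ≤ LH := ENNReal.toReal_nonneg
    positivity
  filter_upwards [hsmall (by positivity : 0 < ε / (2 * (M + 1))), eventually_ge_atTop 1]
    with t hts ht1
  have ht : 0 ≤ t := by linarith
  have hE := rateE_nonneg n ht
  have ht0 : 0 ≤ 1 + t := by linarith
  rw [Real.norm_of_nonneg (by positivity), Real.norm_of_nonneg hE] at hts
  rw [Real.norm_of_nonneg ENNReal.toReal_nonneg, Real.norm_of_nonneg hE]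
  have key := toReal_eLpNorm_le_three (f := fun w => thetaHat b κ γ δ u₀ u₁ θ₀ θ₁ t w
      - (P : ℂ) * (profileSymbol b κ γ δ t ‖waveVec w‖ : ℂ))
    (a₁ := C * ((n + 1) * N + N)) (a₂ := ε' * C) (a₃ := C / η * Real.exp (-(c * η ^ 2 * t)))
    (hg t ht).1 (hw t ht).1 hHm (by positivity) (by positivity) (by positivity) ?_
  · refine key.trans ?_
    have hLH0 : 0 ≤ LH := ENNReal.toReal_nonneg
    have hM1 : M / (M + 1) ≤ 1 := (div_le_one (by positivity)).2 (by linarith)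
    calc _ ≤ C * ((n + 1) * N + N) * (Cg * (1 + t) ^ (-(n : ℝ) / 4)) + ε' * C * (Cw * rateE n t)
          + C / η * (Ce * (1 + t) ^ (-(n : ℝ) / 4)) * LH := by
          gcongr
          · exact (hg t ht).2
          · exact (hw t ht).2
          · exact he t ht
      _ = M * (1 + t) ^ (-(n : ℝ) / 4) + ε' * (C * Cw) * rateE n t := by rw [hM]; ring
      _ ≤ M * (ε / (2 * (M + 1)) * rateE n t) + ε' * (C * Cw) * rateE n t := by gcongr
      _ = (M / (M + 1)) * (ε / 2 * rateE n t) + ε / 2 * rateE n t := by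
          rw [hε']; field_simp
      _ ≤ 1 * (ε / 2 * rateE n t) + ε / 2 * rateE n t := by gcongr
      _ = ε * rateE n t := by ring
  · filter_upwards [ae_waveVec_ne_zero hn] with w hw0
    obtain ⟨hlow, hhigh⟩ := h n (waveVec w) hw0 t ht (fourierVec u₀ w) (fourierVec u₁ w)
      (fourierReal θ₀ w) (fourierReal θ₁ w)
    have hg0 := gaussLow_nonneg c t ‖waveVec w‖
    have hw0' := waveLow_nonneg (c := c) ht (norm_nonneg (waveVec w))
    have hHw := hH0 w
    rcases lt_or_ge ‖waveVec w‖ η with h1 | h1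
    · obtain ⟨l1, -, l3, l4⟩ := hlow (h1.le.trans hη1)
      have e : thetaHat b κ γ δ u₀ u₁ θ₀ θ₁ t w = _ := theta_sol_eq _ _ _ _ _ _
      have e2 : thetaHat b κ γ δ u₀ u₁ θ₀ θ₁ t w
            - (P : ℂ) * (profileSymbol b κ γ δ t ‖waveVec w‖ : ℂ)
          = thetaRest b κ γ δ (waveVec w) t (fourierVec u₀ w) (fourierVec u₁ w) (fourierReal θ₀ w)
            + fourierReal θ₁ w * (heatKernel b κ γ δ (waveVec w) t
              - profileSymbol b κ γ δ t ‖waveVec w‖)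
            + (fourierReal θ₁ w - P) * profileSymbol b κ γ δ t ‖waveVec w‖ := by
        rw [e]; ring
      rw [e2]
      refine (norm_add₃_le).trans ?_
      rw [norm_mul, norm_mul, Complex.norm_real, Real.norm_eq_abs]
      have s1 := fourier_sup_le (Du₀ := Du₀) (θ₁ := θ₁) hu₀ hu₁ hθ₀ w
      have s2 := fourier_sup_le' (u₀ := u₀) (u₁ := u₁) (Du₀ := Du₀) (θ₀ := θ₀) hθ₁ w
      have r1 := l1.trans (by gcongr : _ ≤ C * ((n + 1) * N) * gaussLow c t ‖waveVec w‖)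
      have r2 : ‖fourierReal θ₁ w‖ * ‖heatKernel b κ γ δ (waveVec w) t
          - profileSymbol b κ γ δ t ‖waveVec w‖‖ ≤ N * (C * gaussLow c t ‖waveVec w‖) := by gcongr
      have r3 : ‖fourierReal θ₁ w - P‖ * |profileSymbol b κ γ δ t ‖waveVec w‖|
          ≤ ε' * (C * waveLow c t ‖waveVec w‖) := by
        gcongr
        exact hηc w h1
      have r4 : 0 ≤ C / η * Real.exp (-(c * η ^ 2 * t)) * H w := by positivity
      linarith
    · obtain ⟨r1, r2⟩ := hhigh η hη hη1 h1
      refine (norm_sub_le _ _).trans ?_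
      rw [norm_mul, Complex.norm_real, Complex.norm_real, Real.norm_eq_abs, Real.norm_eq_abs]
      have q1 : 0 ≤ C * ((n + 1) * N + N) * gaussLow c t ‖waveVec w‖ := by positivity
      have q2 : 0 ≤ ε' * C * waveLow c t ‖waveVec w‖ := by positivity
      -- part of the Gaussian is kept to have a square-integrable bound
      have hexp : Real.exp (-(c * ‖waveVec w‖ ^ 2 * t)) ≤ Real.exp (-(c * η ^ 2 * t))
          * (Real.exp (c * η ^ 2) * Real.exp (-(c * ‖waveVec w‖ ^ 2))) := by
        rw [← Real.exp_add, ← Real.exp_add]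
        refine Real.exp_le_exp.2 ?_
        have : c * η ^ 2 * (t - 1) ≤ c * ‖waveVec w‖ ^ 2 * (t - 1) := by
          have : 0 ≤ t - 1 := by linarith
          gcongr
        linarith
      have r3 : |P| * |profileSymbol b κ γ δ t ‖waveVec w‖| ≤ |P| * (C / η *
          (Real.exp (-(c * η ^ 2 * t))
            * (Real.exp (c * η ^ 2) * Real.exp (-(c * ‖waveVec w‖ ^ 2))))) := by
        gcongr
        exact r2.trans (by gcongr)
      have e3 : C / η * Real.exp (-(c * η ^ 2 * t)) * H w
          = C / η * Real.exp (-(c * η ^ 2 * t)) * (‖waveVec w‖ * ‖fourierVec u₀ w‖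
            + ‖fourierVec u₁ w‖ + ‖fourierReal θ₀ w‖ + ‖fourierReal θ₁ w‖)
          + |P| * (C / η * (Real.exp (-(c * η ^ 2 * t))
            * (Real.exp (c * η ^ 2) * Real.exp (-(c * ‖waveVec w‖ ^ 2))))) := by
        simp only [hH, highSize]; ring
      rw [e3]
      have r1' : ‖thetaHat b κ γ δ u₀ u₁ θ₀ θ₁ t w‖ ≤ _ := r1
      linarith

end Comparison

/-! ### The profile in physical space -/

section Physical

variable {n : ℕ} {b κ γ δ P t : ℝ}

/-- The Fourier transform of the profile. -/
noncomputable def profileHat (b κ γ δ P t : ℝ) (w : Space n) : ℂ :=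
  (P : ℂ) * (profileSymbol b κ γ δ t ‖waveVec w‖ : ℂ)

lemma memLp_profileHat (hn : 1 ≤ n) (hb : 0 < b) (hκ : 0 < κ) (hγ : γ ≠ 0) (hδ : 0 < δ) (P : ℝ)
    (ht : 0 ≤ t) : MemLp (profileHat (n := n) b κ γ δ P t) 1 volume ∧
      MemLp (profileHat (n := n) b κ γ δ P t) 2 volume :=
  have h := memLp_profileSymbol (n := n) hn hb hκ hγ hδ ht
  ⟨(memLp_ofReal h.1).const_mul _, (memLp_ofReal h.2).const_mul _⟩

lemma profile_eq_fourierInv : profile n b κ γ δ P t = 𝓕⁻ (profileHat (n := n) b κ γ δ P t) := by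
  funext x
  rw [profile, Real.fourierInv_eq, Real.fourierInv_eq, ← integral_mul_const]
  refine integral_congr_ae (Eventually.of_forall fun w => ?_)
  simp only [profileHat, norm_waveVec, Circle.smul_def, smul_eq_mul]
  ring

/-- The profile is real, since its Fourier transform is real and even. -/
lemma conj_profile (x : Space n) :
    (starRingEnd ℂ) (profile n b κ γ δ P t x) = profile n b κ γ δ P t x := by
  rw [profile_eq_fourierInv, Real.fourierInv_eq, ← integral_conj, ← integral_neg_eq_self]
  refine integral_congr_ae (Eventually.of_forall fun w => ?_)
  simp only [profileHat, norm_waveVec, Circle.smul_def, smul_eq_mul, map_mul, Complex.conj_ofReal,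
    norm_neg, inner_neg_left, ← Circle.coe_inv_eq_conj, AddChar.map_neg_eq_inv, inv_inv]

lemma memLp_profile (hn : 1 ≤ n) (hb : 0 < b) (hκ : 0 < κ) (hγ : γ ≠ 0) (hδ : 0 < δ) (P : ℝ)
    (ht : 0 ≤ t) : MemLp (profile n b κ γ δ P t) 2 volume := by
  have h := memLp_profileHat (n := n) hn hb hκ hγ hδ P ht
  rw [profile_eq_fourierInv]
  exact memLp_fourierInv h.1 h.2

lemma eLpNorm_profile (hn : 1 ≤ n) (hb : 0 < b) (hκ : 0 < κ) (hγ : γ ≠ 0) (hδ : 0 < δ) (P : ℝ)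
    (ht : 0 ≤ t) : (eLpNorm (profile n b κ γ δ P t) 2 volume).toReal
      = |P| * (eLpNorm (fun w : Space n => profileSymbol b κ γ δ t ‖waveVec w‖) 2 volume).toReal := by
  have h := memLp_profileHat (n := n) hn hb hκ hγ hδ P ht
  rw [profile_eq_fourierInv, eLpNorm_congr_ae (fourierInv_ae_eq_Lp h.1 h.2), ← Lp.norm_def,
    norm_fourierInv_Lp, Lp.norm_toLp]
  have e : eLpNorm (profileHat (n := n) b κ γ δ P t) 2 volume
      = eLpNorm (P • fun w : Space n => profileSymbol b κ γ δ t ‖waveVec w‖) 2 volume := by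
    refine eLpNorm_congr_norm_ae (Eventually.of_forall fun w => ?_)
    simp [profileHat]
  rw [e, eLpNorm_const_smul, ENNReal.toReal_mul, toReal_enorm, Real.norm_eq_abs]

/-- As the profile is real, taking the real part of a path does not increase the distance to it. -/
lemma eLpNorm_realPath_sub_profile_le {X : ℝ → Space n → ℂ}
    (hX : ∀ t, 0 ≤ t → MemLp (X t) 2 volume) (hn : 1 ≤ n) (hb : 0 < b) (hκ : 0 < κ) (hγ : γ ≠ 0)
    (hδ : 0 < δ) (P : ℝ) (ht : 0 ≤ t) :
    (eLpNorm (fun x => ((realPath X hX t x : ℝ) : ℂ) - profile n b κ γ δ P t x) 2 volume).toReal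
      ≤ (eLpNorm (fun w => X t w - (P : ℂ) * (profileSymbol b κ γ δ t ‖waveVec w‖ : ℂ)) 2
          volume).toReal := by
  have h := memLp_profileHat (n := n) hn hb hκ hγ hδ P ht
  have e : (𝓕⁻ ((hX t ht).toLp (X t) - h.2.toLp _) : Lp ℂ 2 (volume : Measure (Space n)))
      = 𝓕⁻ ((hX t ht).toLp (X t)) - 𝓕⁻ (h.2.toLp _) :=
    map_sub (FourierTransform.fourierInvCLM ℂ (Lp ℂ 2 (volume : Measure (Space n)))) _ _
  have e1 : (eLpNorm (fun w => X t w - (P : ℂ) * (profileSymbol b κ γ δ t ‖waveVec w‖ : ℂ)) 2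
      volume).toReal = ‖𝓕⁻ ((hX t ht).toLp (X t)) - (𝓕⁻ (h.2.toLp _) :
        Lp ℂ 2 (volume : Measure (Space n)))‖ := by
    rw [← e, norm_fourierInv_Lp, ← MemLp.toLp_sub, Lp.norm_toLp]
    rfl
  rw [e1, Lp.norm_def]
  refine ENNReal.toReal_mono (Lp.memLp _).2.ne (eLpNorm_mono_ae ?_)
  filter_upwards [realPath_ae hX t ht, fourierInv_ae_eq_Lp h.1 h.2,
    Lp.coeFn_sub (𝓕⁻ ((hX t ht).toLp (X t)) : Lp ℂ 2 (volume : Measure (Space n)))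
      (𝓕⁻ (h.2.toLp _))] with x a1 a2 a3
  have a4 := (Complex.conj_eq_iff_re.1 (conj_profile (b := b) (κ := κ) (γ := γ) (δ := δ) (P := P)
    (t := t) x))
  rw [a3, Pi.sub_apply, a1, ← a2, ← profile_eq_fourierInv, ← a4, ← Complex.ofReal_sub,
    Complex.norm_real, Real.norm_eq_abs]
  refine le_trans (le_of_eq ?_) (Complex.abs_re_le_norm _)
  simp

lemma eLpNorm_ofReal_Lp (f : Lp ℝ 2 (volume : Measure (Space n))) :
    (eLpNorm (fun x => ((f x : ℝ) : ℂ)) 2 volume).toReal = ‖f‖ := by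
  rw [Lp.norm_def]
  congr 1
  exact eLpNorm_congr_norm_ae (Eventually.of_forall fun x => Complex.norm_real _)

/-- The reverse triangle inequality for the temperature and the profile. -/
lemma eLpNorm_profile_sub_le_norm (f : Lp ℝ 2 (volume : Measure (Space n))) {g : Space n → ℂ}
    (hg : MemLp g 2 volume) :
    (eLpNorm g 2 volume).toReal - (eLpNorm (fun x => ((f x : ℝ) : ℂ) - g x) 2 volume).toReal
      ≤ ‖f‖ := by
  have hf : MemLp (fun x => ((f x : ℝ) : ℂ)) 2 volume := memLp_ofReal (Lp.memLp f)
  have h1 : ‖hg.toLp g‖ - ‖hf.toLp _ - hg.toLp g‖ ≤ ‖hf.toLp _‖ := by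
    have := norm_sub_norm_le (hg.toLp g) (hf.toLp _)
    rw [norm_sub_rev] at this
    linarith
  rw [← MemLp.toLp_sub, Lp.norm_toLp, Lp.norm_toLp, Lp.norm_toLp, eLpNorm_ofReal_Lp] at h1
  exact h1

end Physical

end ThermoIII

/-! ### Large-time behaviour of the temperature -/

theorem mainTheorem2 (n : ℕ) (hn : 1 ≤ n) (b κ γ δ : ℝ)
    (hb : 0 < b) (hκ : 0 < κ) (hγ : γ ≠ 0) (hδ : 0 < δ) :
    ∃ C c : ℝ, 0 < C ∧ 0 < c ∧
      ∀ (u₀ u₁ : Space n → Space n) (Du₀ : Fin n → Space n → Space n) (θ₀ θ₁ : Space n → ℝ),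
        ThermoIII.MemL2L1 u₀ → ThermoIII.HasWeakPartials u₀ Du₀ →
        (∀ j, MemLp (Du₀ j) 2 volume) →
        ThermoIII.MemL2L1 u₁ → ThermoIII.MemL2L1 θ₀ → ThermoIII.MemL2L1 θ₁ →
        (∃ (u : ℝ → Lp (Space n) 2 (volume : Measure (Space n)))
            (θ : ℝ → Lp ℝ 2 (volume : Measure (Space n))),
          ThermoIII.IsSolution b κ γ δ u₀ u₁ θ₀ θ₁ u θ) ∧
        (∀ t : ℝ, 0 ≤ t →
          MemLp (ThermoIII.profile n b κ γ δ (∫ x, θ₁ x) t) 2 volume) ∧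
        ∀ (u : ℝ → Lp (Space n) 2 (volume : Measure (Space n)))
          (θ : ℝ → Lp ℝ 2 (volume : Measure (Space n))),
          ThermoIII.IsSolution b κ γ δ u₀ u₁ θ₀ θ₁ u θ →
          (∀ t : ℝ, 0 ≤ t →
            ‖θ t‖ ≤ C * ThermoIII.rateE n t *
              (ThermoIII.normH1L1 u₀ Du₀ + ThermoIII.normL2L1 u₁
                + ThermoIII.normL2L1 θ₀ + ThermoIII.normL2L1 θ₁)) ∧
          ((fun t : ℝ => (eLpNorm
              (fun x => ((θ t x : ℝ) : ℂ) - ThermoIII.profile n b κ γ δ (∫ y, θ₁ y) t x)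
              2 volume).toReal) =o[atTop] fun t : ℝ => ThermoIII.rateE n t) ∧
          ((n = 2 → ThermoIII.PlaneCondition b κ γ) → (∫ x, θ₁ x) ≠ 0 →
            ∃ T : ℝ, 0 ≤ T ∧ ∀ t : ℝ, T ≤ t →
              c * ThermoIII.rateE n t * |∫ x, θ₁ x| ≤ ‖θ t‖) := by
  obtain ⟨C, hC, hupper⟩ := ThermoIII.exists_thetaHat_le (n := n) hn hb hκ hγ hδ
  obtain ⟨c, hc, hlower⟩ := ThermoIII.exists_profile_ge (n := n) hn hb hκ hγ hδ
  refine ⟨C, c / 2, hC, by positivity, ?_⟩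
  intro u₀ u₁ Du₀ θ₀ θ₁ hu₀ hDu hDu₀ hu₁ hθ₀ hθ₁
  obtain ⟨v, hv⟩ := ThermoIII.exists_isSolution (γ := γ) hb hκ hδ hu₀ hDu hDu₀ hu₁ hθ₀ hθ₁
  refine ⟨⟨v, _, hv⟩, fun t ht => ThermoIII.memLp_profile hn hb hκ hγ hδ _ ht, ?_⟩
  intro u θ hsol
  -- by uniqueness it suffices to consider the solution constructed on the Fourier side
  have huniq := fun (t : ℝ) (ht : 0 ≤ t) =>
    ThermoIII.IsSolution.theta_unique hκ.le hδ.le hsol hv ht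
  set P : ℝ := ∫ x, θ₁ x with hP
  have hlittle : (fun t : ℝ => (eLpNorm
      (fun x => ((θ t x : ℝ) : ℂ) - ThermoIII.profile n b κ γ δ P t x) 2 volume).toReal)
      =o[atTop] fun t : ℝ => ThermoIII.rateE n t := by
    refine IsBigO.trans_isLittleO (IsBigO.of_bound 1 ?_)
      (ThermoIII.thetaHat_sub_isLittleO hn hb hκ hγ hδ hu₀ hDu hDu₀ hu₁ hθ₀ hθ₁)
    filter_upwards [eventually_ge_atTop 0] with t ht
    rw [one_mul, Real.norm_of_nonneg ENNReal.toReal_nonneg,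
      Real.norm_of_nonneg ENNReal.toReal_nonneg, huniq t ht]
    exact ThermoIII.eLpNorm_realPath_sub_profile_le _ hn hb hκ hγ hδ P ht
  refine ⟨fun t ht => ?_, hlittle, fun _ hP0 => ?_⟩
  · rw [huniq t ht]
    exact (ThermoIII.norm_realPath_le _ ht).trans
      (hupper u₀ u₁ Du₀ θ₀ θ₁ hu₀ hDu hDu₀ hu₁ hθ₀ hθ₁ t ht)
  · -- half of the lower bound for the profile absorbs the difference to it
    have hsmall := isLittleO_iff.1 hlittle
      (show 0 < c / 2 * |P| from mul_pos (half_pos hc) (abs_pos.2 hP0))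
    obtain ⟨T, hT⟩ := eventually_atTop.1 (hlower.and hsmall)
    refine ⟨max T 0, le_max_right _ _, fun t ht => ?_⟩
    have ht0 : 0 ≤ t := (le_max_right _ _).trans ht
    obtain ⟨h1, h2⟩ := hT t ((le_max_left _ _).trans ht)
    rw [Real.norm_of_nonneg ENNReal.toReal_nonneg,
      Real.norm_of_nonneg (ThermoIII.rateE_nonneg n ht0)] at h2
    have h3 := ThermoIII.eLpNorm_profile_sub_le_norm (θ t)
      (ThermoIII.memLp_profile hn hb hκ hγ hδ P ht0)
    rw [ThermoIII.eLpNorm_profile hn hb hκ hγ hδ P ht0] at h3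
    have h4 := mul_le_mul_of_nonneg_left h1 (abs_nonneg P)
    linarith
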